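/- Conventions. All actions on metric spaces are by isometries. A \emph{segment} in a metric space is the image of an isometric embedding of some interval $[0,\lambda]$, $\lambda\ge 0$. A \emph{real tree} is a metric space in which any two points are joined by a segment, such that two segments meeting in exactly one point, which is an endpoint of both, have a segment as their union, and the intersection of two segments with a common endpoint is a segment. The \emph{valence} of a point $x$ of a real tree $T$ is the number of geodesic-connected components of $T\setminus\{x\}$. The \emph{universal real tree with valence} $\kappa$ is the (unique up to isometry) non-empty complete real tree all of whose points have valence $\kappa$. Given metric spaces $\mathcal T=(T_n,d_n)_{n\in N}$ and $z\in\prod_{n}T_n$, the \emph{$\ell^1$ product} $\ell^1(\mathcal T,z)$ is $\{x\in\prod_n T_n:\sum_n d_n(x_n,z_n)<\infty\}$ with the metric $d(x,y)=\sum_n d_n(x_n,y_n)$. Let $N$ be $\mathbb N$ or $\{1,\dots,n\}$ for some $n\in\mathbb N$, and let $\mathbf R=\ell^1(N)$ be the real $\ell^1$ space, with its additive group structure and the $\ell^1$ norm. A \emph{maximal flat} in a metric space $X$ is a subset $F\subseteq X$ that is the image of an isometric embedding $\mathbf R\to X$ and is not properly contained in another such subset. Let $\mathcal K$ be the set of cardinals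 $\kappa\le 2^{\aleph_0}$, let $\mathrm{Sub}_D(\mathbf R)$ be the set of dense subgroups of $\mathbf R$, and let $\overline{\mathrm{Sub}}_D(\mathbf R)$ be its quotient by the relation $H\sim K$ if and only if $A(H)=K$ for some surjective linear isometry $A$ of $\mathbf R$; write $[H]$ for the class of $H$. Theorem. Let $\iota:\overline{\mathrm{Sub}}_D(\mathbf R)\to\mathcal K$ be a map that is non-zero on at most $2^{\aleph_0}$ classes, and let $\eta:N\to\{0,1\}$ be a map that is not identically zero. For each $n\in N$ let $T_n$ be the universal real tree with valence $2^{\aleph_0}$ if $\eta(n)=1$, and let $T_n$ be (isometric to) $\mathbb R$ if $\eta(n)=0$. Let $\mathcal T=(T_n)_{n\in N}$. Then, for some $z\in\prod_{n\in N}T_n$, there is a group $G$ acting freely and transitively on $\ell^1(\mathcal T,z)$ such that for every $H\in\mathrm{Sub}_D(\mathbf R)$ the following holds. Let $A_H$ be the set of $G$-orbits of maximal flats $F\subseteq\ell^1(\mathcal T,z)$ for which the action of the setwise stabiliser $\mathrm{Stab}_G(F)$ on $F$ is isomorphic to the action of $H$ on $\mathbf R$ by translations, i.e. there are an isometry $\varphi$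 from $\mathbf R$ onto $F$ and a group isomorphism $\psi:\mathrm{Stab}_G(F)\to H$ with $g\cdot\varphi(r)=\varphi(\psi(g)+r)$ for all $g\in\mathrm{Stab}_G(F)$ and $r\in\mathbf R$. Then $|A_H|=\iota([H])$. -/

import Mathlib

open scoped Pointwise Cardinal

/-- `IsSegment S x y`: the set `S` is a segment with endpoints `x` and `y`, i.e. the image of a
geodesic (an isometric embedding of an interval `[0, l]`, `0 ≤ l`) going from `x` to `y`. -/
def IsSegment {X : Type*} [MetricSpace X] (S : Set X) (x y : X) : Prop :=
  ∃ (l : ℝ) (γ : ℝ → X), 0 ≤ l ∧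
    (∀ s ∈ Set.Icc 0 l, ∀ t ∈ Set.Icc 0 l, dist (γ s) (γ t) = |s - t|) ∧
    γ 0 = x ∧ γ l = y ∧ γ '' Set.Icc 0 l = S

/-- Real trees: geodesic metric spaces in which two segments that meet in exactly one point, which
is an endpoint of both, have a segment as their union, and in which two segments with a common
endpoint intersect in a segment. -/
structure IsRealTree (X : Type*) [MetricSpace X] : Prop where
  geodesic : ∀ x y : X, ∃ S, IsSegment S x y
  union : ∀ (S S' : Set X) (x y z : X), IsSegment S x y → IsSegment S' y z →
    S ∩ S' = {y} → ∃ a b, IsSegment (S ∪ S') a b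
  inter : ∀ (S S' : Set X) (x y z : X), IsSegment S x y → IsSegment S' x z →
    ∃ a b, IsSegment (S ∩ S') a b

/-- The set of directions at `x`: the geodesic-connected components of `X - {x}`, that is, the
classes of points of `X - {x}` for the equivalence relation generated by being the endpoints of a
segment that avoids `x`. -/
def Directions {X : Type*} [MetricSpace X] (x : X) : Type _ :=
  Quot fun y z : {y : X // y ≠ x} => ∃ S : Set X, IsSegment S (y : X) (z : X) ∧ x ∉ S

/-- `X` is the universal real tree with valence `κ`: a (nonempty) complete real tree in which the
set of directions at every point has cardinality `κ`. -/
structure IsUniversalRealTree (X : Type*) [MetricSpace X] (κ : Cardinal) : Prop where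
  nonempty : Nonempty X
  complete : CompleteSpace X
  isRealTree : IsRealTree X
  valence : ∀ x : X, #(Directions x) = κ

/-- The `ℓ¹` product, based at `z`, of a family of metric spaces. -/
def L1Product {N : Type*} (T : N → Type*) [∀ n, MetricSpace (T n)] (z : ∀ n, T n) : Type _ :=
  {x : ∀ n, T n // Summable fun n => dist (x n) (z n)}

namespace L1Product

variable {N : Type*} {T : N → Type*} [∀ n, MetricSpace (T n)] {z : ∀ n, T n}

theorem summable_dist (x y : L1Product T z) : Summable fun n => dist (x.1 n) (y.1 n) :=
  Summable.of_nonneg_of_le (fun _ => dist_nonneg)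
    (fun n => dist_triangle_right (x.1 n) (y.1 n) (z n)) (x.2.add y.2)

/-- The `ℓ¹` metric `d(x, y) = ∑ d(xₙ, yₙ)`. -/
noncomputable instance : MetricSpace (L1Product T z) where
  dist x y := ∑' n, dist (x.1 n) (y.1 n)
  dist_self x := by simp
  dist_comm x y := by simp only [dist_comm]
  dist_triangle x y w := by
    rw [← (summable_dist x y).tsum_add (summable_dist y w)]
    exact (summable_dist x w).tsum_le_tsum (fun n => dist_triangle _ _ _)
      ((summable_dist x y).add (summable_dist y w))
  eq_of_dist_eq_zero {x y} h := by
    have h0 := (hasSum_zero_iff_of_nonneg (fun _ => dist_nonneg)).1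
      (h ▸ (summable_dist x y).hasSum)
    exact Subtype.ext (funext fun n => dist_eq_zero.1 (congrFun h0 n))

end L1Product

/-- The real Banach space `ℓ¹(N)`. -/
abbrev EllOne (N : Type*) : Type _ := lp (fun _ : N => ℝ) 1

/-- The set of dense subgroups of `ℓ¹(N)`. -/
abbrev DenseSubgroup (N : Type*) : Type _ :=
  {H : AddSubgroup (EllOne N) // Dense (H : Set (EllOne N))}

/-- Two dense subgroups of `ℓ¹(N)` are equivalent if a (surjective) linear isometry of `ℓ¹(N)`
maps the first onto the second. -/
instance denseSubgroupSetoid (N : Type*) : Setoid (DenseSubgroup N) where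
  r H K := ∃ A : EllOne N ≃ₗᵢ[ℝ] EllOne N, A '' (H.1 : Set (EllOne N)) = (K.1 : Set (EllOne N))
  iseqv :=
    { refl := fun _ => ⟨LinearIsometryEquiv.refl ℝ _, by simp⟩
      symm := by
        rintro H K ⟨A, hA⟩
        exact ⟨A.symm, by rw [← hA, ← Set.image_comp]; simp⟩
      trans := by
        rintro H K L ⟨A, hA⟩ ⟨B, hB⟩
        exact ⟨A.trans B, by rw [← hB, ← hA, ← Set.image_comp]; rfl⟩ }

/-- The set of classes of dense subgroups of `ℓ¹(N)` up to linear isometry of `ℓ¹(N)`. -/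
abbrev DenseSubgroupClass (N : Type*) : Type _ := Quotient (denseSubgroupSetoid N)

/-- An isometrically embedded copy of `ℓ¹(N)` in `X`. -/
def IsFlat (N : Type*) {X : Type*} [MetricSpace X] (F : Set X) : Prop :=
  ∃ φ : EllOne N → X, Isometry φ ∧ Set.range φ = F

/-- A maximal flat: a flat that is not properly contained in another flat. -/
def IsMaximalFlat (N : Type*) {X : Type*} [MetricSpace X] (F : Set X) : Prop :=
  Maximal (IsFlat N) F

/-- The action of the (setwise) stabiliser of `F` in `G` on `F` is isomorphic to the action of the
subgroup `H` on `ℓ¹(N)` by translations: there are an isometry `φ` from `ℓ¹(N)` onto `F` and a group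
isomorphism `ψ` from the stabiliser to `H` for which `φ` is equivariant. -/
def StabiliserActsLike {N : Type*} {X : Type*} [MetricSpace X] (G : Type*) [Group G]
    [MulAction G X] (F : Set X) (H : AddSubgroup (EllOne N)) : Prop :=
  ∃ (φ : EllOne N → X) (ψ : MulAction.stabilizer G F ≃* Multiplicative H),
    Isometry φ ∧ Set.range φ = F ∧
      ∀ (g : MulAction.stabilizer G F) (r : EllOne N),
        (g : G) • φ r = φ (((ψ g).toAdd : EllOne N) + r)

/-- The set of `G`-orbits of maximal flats `F` of `X` such that the action of the stabiliser of `F`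
on `F` is isomorphic to the action of `H` on `ℓ¹(N)`. -/
def flatOrbits {N : Type*} (G X : Type*) [MetricSpace X] [Group G] [MulAction G X]
    (H : AddSubgroup (EllOne N)) : Set (Set (Set X)) :=
  {O | ∃ F : Set X, IsMaximalFlat N F ∧ StabiliserActsLike G F H ∧ O = MulAction.orbit G F}

/-! The group is built so that the relevant flats carry labels on which `R = ℓ¹(N)` acts.

For a set `A` of `𝔠` labels with an `R`-action, let `V` be the functions `Option A → ℝ`, the
coordinate `none` being a height. Labelled paths in `V` are Lipschitz in each coordinate, move
countably many coordinates, and on every interval contain a piece run at unit speed with one label.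
Every point of `V` has `𝔠` germs of reduced labelled paths, as many as a point of the universal tree
has directions, so a Zorn argument (`exists_developing`) gives a map `π : T → V` matching directions
with germs. Reduced paths lift uniquely along `π`. Hence translations and relabellings of `V` lift
to isometries of `T` (`exists_isometry`), and the straight line of each label lifts to a line
through each point of `T`. A line of `T` on which such isometries induce a dense set of translations
is labelled: its development is pure on some interval, and density spreads this over the whole line
(`eq_labelled_line_of_dense`). `LabelledTree` records what is needed; `ℝ` with a single label is
another instance.

The group `symGroup` consists of families of isometries with a common translation part `r ∈ R`,
where factor `n` shifts heights by `r n` and labels by `r`. Height differences determine `r`, which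
gives freeness and transitivity on the `ℓ¹` product.

A rectangle in `ℓ¹` whose sides have disjoint supports must collapse in a tree, so each component of
a flat depends on at most one coordinate (`flat_component`). It follows that maximal flats with
dense stabilisers are products of labelled lines (`exists_eq_range_labelledFlat`), and that all such
products are maximal. The stabiliser of a product translates it by the subgroup fixing all its
labels (`stabiliserActsLike_labelledFlat_iff`), and group orbits correspond to `R`-orbits of label
families (`mk_flatOrbits`).

It remains to choose the labels. One coordinate `n₀` with `η n₀ = 1` carries, for each class, as
many orbits as `ι` prescribes, with a representative of the class as stabiliser, and one extra free
orbit. Every other coordinate has one fixed label, all other labels being free. A free label makes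
the fixer trivial, hence not dense, so only the prescribed families count. -/

/-- Geodesic metric spaces satisfying the four point condition. -/
class GeodesicTree (T : Type*) [MetricSpace T] : Prop where
  four : ∀ x y z w : T,
    dist x y + dist z w ≤ max (dist x z + dist y w) (dist x w + dist y z)
  geod : ∀ (x y : T) (t : ℝ), 0 ≤ t → t ≤ dist x y →
    ∃ p, dist x p = t ∧ dist p y = dist x y - t

/-! ### Segments and Gromov products in four-point spaces -/

namespace GeodesicTree

section Basic

variable {T : Type*} [MetricSpace T] [GeodesicTree T]

/-- In the four-point inequality for `x, y, p, q` both sums on the right equal `dist x y`, which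
leaves no room for `dist p q`. -/
theorem eq_of_between {x y p q : T} (h1 : dist x p = dist x q) (h2 : dist p y = dist q y)
    (h : dist x p + dist p y = dist x y) : p = q := by
  have := four x y p q
  rw [dist_comm y q, dist_comm y p, ← h1, ← h2, max_self] at this
  exact dist_le_zero.1 (by linarith)

theorem exists_pt (x y : T) (t : ℝ) : ∃ p : T, dist x p = max 0 (min t (dist x y)) ∧
    dist p y = dist x y - max 0 (min t (dist x y)) :=
  geod x y _ (le_max_left _ _) (max_le dist_nonneg (min_le_right _ _))

/-- The point at distance `t` from `x` on the segment from `x` to `y` (clamped). -/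
noncomputable def pt (x y : T) (t : ℝ) : T := (exists_pt x y t).choose

theorem dist_left_pt {x y : T} {t : ℝ} (h0 : 0 ≤ t) (h : t ≤ dist x y) :
    dist x (pt x y t) = t := by
  rw [pt, (exists_pt x y t).choose_spec.1, min_eq_left h, max_eq_right h0]

theorem dist_pt_right {x y : T} {t : ℝ} (h0 : 0 ≤ t) (h : t ≤ dist x y) :
    dist (pt x y t) y = dist x y - t := by
  rw [pt, (exists_pt x y t).choose_spec.2, min_eq_left h, max_eq_right h0]

theorem eq_pt {x y p : T} {t : ℝ} (h1 : dist x p = t) (h2 : dist p y = dist x y - t) :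
    p = pt x y t := by
  have h0 : 0 ≤ t := h1 ▸ dist_nonneg
  have h : t ≤ dist x y := by linarith [@dist_nonneg _ _ p y]
  exact eq_of_between (by rw [h1, dist_left_pt h0 h]) (by rw [h2, dist_pt_right h0 h])
    (by linarith)

@[simp] theorem pt_zero (x y : T) : pt x y 0 = x := (eq_pt (by simp) (by simp)).symm

@[simp] theorem pt_dist (x y : T) : pt x y (dist x y) = y := (eq_pt (by simp) (by simp)).symm

theorem pt_of_le {x y : T} {t : ℝ} (h : t ≤ 0) : pt x y t = x := by
  have : dist x (pt x y t) = _ := (exists_pt x y t).choose_spec.1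
  rw [max_eq_left ((min_le_left _ _).trans h)] at this
  exact (dist_eq_zero.1 this).symm

theorem pt_of_ge {x y : T} {t : ℝ} (h : dist x y ≤ t) : pt x y t = y := by
  have : dist (pt x y t) y = _ := (exists_pt x y t).choose_spec.2
  rw [min_eq_right h, max_eq_right dist_nonneg, sub_self] at this
  exact dist_eq_zero.1 this

theorem pt_comm {x y : T} {t : ℝ} (h0 : 0 ≤ t) (h : t ≤ dist x y) :
    pt y x t = pt x y (dist x y - t) := by
  have h' : t ≤ dist y x := by rwa [dist_comm]
  refine eq_pt ?_ ?_
  · rw [dist_comm, dist_pt_right h0 h', dist_comm]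
  · rw [dist_comm, dist_left_pt h0 h']; ring

theorem pt_pt_left {x y : T} {s t : ℝ} (h0 : 0 ≤ t) (hts : t ≤ s) (h : s ≤ dist x y) :
    pt x (pt x y s) t = pt x y t := by
  have hs := dist_left_pt (h0.trans hts) h
  have h1 : dist x (pt x (pt x y s) t) = t := dist_left_pt h0 (by rwa [hs])
  have h2 : dist (pt x (pt x y s) t) (pt x y s) = s - t := by
    rw [dist_pt_right h0 (by rwa [hs]), hs]
  have h3 := dist_pt_right (h0.trans hts) h
  refine eq_pt h1 (le_antisymm ?_ ?_)
  · linarith [dist_triangle (pt x (pt x y s) t) (pt x y s) y]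
  · linarith [dist_triangle x (pt x (pt x y s) t) y]

theorem pt_pt_right {x y : T} {s t : ℝ} (hs : 0 ≤ s) (ht : 0 ≤ t) (h : s + t ≤ dist x y) :
    pt (pt x y s) y t = pt x y (s + t) := by
  have hs1 := dist_left_pt hs (by linarith : s ≤ dist x y)
  have hs2 := dist_pt_right hs (by linarith : s ≤ dist x y)
  have h1 : dist (pt x y s) (pt (pt x y s) y t) = t := dist_left_pt ht (by linarith)
  have h2 : dist (pt (pt x y s) y t) y = dist x y - s - t := by
    rw [dist_pt_right ht (by linarith), hs2]
  refine eq_pt (le_antisymm ?_ ?_) (by linarith)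
  · linarith [dist_triangle x (pt x y s) (pt (pt x y s) y t)]
  · linarith [dist_triangle x (pt (pt x y s) y t) y]

theorem dist_pt_pt {x y : T} {s t : ℝ} (hs : 0 ≤ s) (hst : s ≤ t) (ht : t ≤ dist x y) :
    dist (pt x y s) (pt x y t) = t - s := by
  have h1 := dist_left_pt (hs.trans hst) ht
  rw [← pt_pt_left hs hst ht, dist_pt_right hs (by rwa [h1]), h1]

theorem pt_left_add {x y z : T} {t : ℝ} (h : dist x z = dist x y + dist y z) (ht : 0 ≤ t)
    (hty : t ≤ dist x y) : pt x z t = pt x y t := by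
  have : y = pt x z (dist x y) := eq_pt rfl (by linarith)
  rw [← pt_pt_left ht hty (by linarith [@dist_nonneg _ _ y z]), ← this]

theorem pt_right_add {x y z : T} {t : ℝ} (h : dist x z = dist x y + dist y z) (ht : 0 ≤ t)
    (hty : t ≤ dist y z) : pt x z (dist x y + t) = pt y z t := by
  have : y = pt x z (dist x y) := eq_pt rfl (by linarith)
  rw [← pt_pt_right dist_nonneg ht (by linarith), ← this]

/-- The Gromov product. -/
noncomputable def gp (x y z : T) : ℝ := (dist x y + dist x z - dist y z) / 2

omit [GeodesicTree T] in
theorem gp_comm (x y z : T) : gp x y z = gp x z y := by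
  unfold gp; rw [dist_comm y z]; ring

omit [GeodesicTree T] in
theorem gp_nonneg (x y z : T) : 0 ≤ gp x y z := by
  unfold gp; linarith [dist_triangle_left y z x]

omit [GeodesicTree T] in
theorem gp_le_left (x y z : T) : gp x y z ≤ dist x y := by
  unfold gp; linarith [dist_triangle x y z]

omit [GeodesicTree T] in
theorem gp_le_right (x y z : T) : gp x y z ≤ dist x z := gp_comm x y z ▸ gp_le_left x z y

/-- This is the four-point condition in its ultrametric form; it makes positivity of the Gromov
product at `x` a transitive relation. -/
theorem min_gp_le (x y z w : T) : min (gp x y z) (gp x z w) ≤ gp x y w := by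
  have := four x z y w
  unfold gp
  rcases le_max_iff.1 this with h | h
  · exact (min_le_right _ _).trans (by linarith [dist_comm z w])
  · exact (min_le_left _ _).trans (by linarith [dist_comm z y])

/-- Below the Gromov product, the four-point condition for `pt x z t, y, x, z` bounds the distance
from `pt x z t` to `y` by the value that characterises `pt x y t`. -/
theorem pt_eq_of_le_gp {x y z : T} {t : ℝ} (h0 : 0 ≤ t) (h : t ≤ gp x y z) :
    pt x y t = pt x z t := by
  have hy := h.trans (gp_le_left x y z)
  have hz := h.trans (gp_le_right x y z)
  symm
  have h1 := dist_left_pt h0 hz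
  have h2 := dist_pt_right h0 hz
  refine eq_pt h1 (le_antisymm ?_ ?_)
  · have := four (pt x z t) y x z
    rw [dist_comm (pt x z t) x, dist_comm y x, h1, h2] at this
    unfold gp at h
    rcases le_max_iff.1 this with h' | h' <;> linarith
  · linarith [dist_triangle x (pt x z t) y]

/-- The branch point of the segments from `x` to `y` and `z` lies on the segment from `y` to
`z`. -/
theorem dist_branch (x y z : T) : dist y z =
    dist y (pt x y (gp x y z)) + dist (pt x y (gp x y z)) z := by
  have h1 := dist_pt_right (gp_nonneg x y z) (gp_le_left x y z)
  have h2 := dist_pt_right (gp_nonneg x y z) (gp_le_right x y z)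
  rw [← pt_eq_of_le_gp (gp_nonneg x y z) le_rfl] at h2
  rw [dist_comm y (pt x y _), h1, h2]
  unfold gp
  ring

end Basic

/-! ### From the segment axioms to the four-point condition -/

section OfIsRealTree

variable {X : Type*} [MetricSpace X]

theorem _root_.IsSegment.dist_eq {x y : X} {l : ℝ} {γ : ℝ → X} (hl : 0 ≤ l)
    (hγ : ∀ s ∈ Set.Icc 0 l, ∀ t ∈ Set.Icc 0 l, dist (γ s) (γ t) = |s - t|)
    (h0 : γ 0 = x) (h1 : γ l = y) : dist x y = l := by
  rw [← h0, ← h1, hγ 0 ⟨le_rfl, hl⟩ l ⟨hl, le_rfl⟩, zero_sub, abs_neg, abs_of_nonneg hl]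

/-- Two geodesics of a real tree issuing from the same point agree up to the Gromov product. -/
theorem _root_.IsRealTree.geodesic_eq (hX : IsRealTree X) {x y z : X} {γ δ : ℝ → X}
    (hγ : ∀ s ∈ Set.Icc 0 (dist x y), ∀ t ∈ Set.Icc 0 (dist x y), dist (γ s) (γ t) = |s - t|)
    (hδ : ∀ s ∈ Set.Icc 0 (dist x z), ∀ t ∈ Set.Icc 0 (dist x z), dist (δ s) (δ t) = |s - t|)
    (hγ0 : γ 0 = x) (hγ1 : γ (dist x y) = y) (hδ0 : δ 0 = x) (hδ1 : δ (dist x z) = z)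
    {t : ℝ} (ht0 : 0 ≤ t) (ht : t ≤ gp x y z) : γ t = δ t := by
  set ly := dist x y with hly
  set lz := dist x z with hlz
  have hly0 : 0 ≤ ly := dist_nonneg
  have hlz0 : 0 ≤ lz := dist_nonneg
  have hdγ : ∀ s ∈ Set.Icc 0 ly, dist x (γ s) = s := fun s hs => by
    rw [← hγ0, hγ 0 ⟨le_rfl, hly0⟩ s hs, zero_sub, abs_neg, abs_of_nonneg hs.1]
  have hdδ : ∀ s ∈ Set.Icc 0 lz, dist x (δ s) = s := fun s hs => by
    rw [← hδ0, hδ 0 ⟨le_rfl, hlz0⟩ s hs, zero_sub, abs_neg, abs_of_nonneg hs.1]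
  obtain ⟨a, b, m, ε, hm, hε, hε0, hε1, hεI⟩ := hX.inter (γ '' Set.Icc 0 ly) (δ '' Set.Icc 0 lz)
    x y z ⟨ly, γ, hly0, hγ, hγ0, hγ1, rfl⟩ ⟨lz, δ, hlz0, hδ, hδ0, hδ1, rfl⟩
  have hεc : ContinuousOn ε (Set.Icc 0 m) := by
    refine LipschitzOnWith.continuousOn (K := 1) (LipschitzOnWith.of_dist_le_mul fun s hs t ht => ?_)
    rw [hε s hs t ht, NNReal.coe_one, one_mul, Real.dist_eq]
  have hIc : IsCompact (γ '' Set.Icc 0 ly ∩ δ '' Set.Icc 0 lz) :=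
    hεI ▸ isCompact_Icc.image_of_continuousOn hεc
  have hIp : IsPreconnected (γ '' Set.Icc 0 ly ∩ δ '' Set.Icc 0 lz) :=
    hεI ▸ isPreconnected_Icc.image _ hεc
  have hxI : x ∈ γ '' Set.Icc 0 ly ∩ δ '' Set.Icc 0 lz :=
    ⟨⟨0, ⟨le_rfl, hly0⟩, hγ0⟩, ⟨0, ⟨le_rfl, hlz0⟩, hδ0⟩⟩
  -- points of the intersection have the same parameter on both geodesics
  have hpar : ∀ p ∈ γ '' Set.Icc 0 ly ∩ δ '' Set.Icc 0 lz,
      dist x p ∈ Set.Icc 0 ly ∧ dist x p ∈ Set.Icc 0 lz ∧ γ (dist x p) = p ∧ δ (dist x p) = p := by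
    rintro p ⟨⟨s, hs, rfl⟩, ⟨s', hs', h⟩⟩
    have h1 := hdγ s hs
    have h2 := hdδ s' hs'
    rw [h, h1] at h2
    subst h2
    rw [h1]
    exact ⟨hs, hs', rfl, h⟩
  -- The common part of the two geodesics is compact, so it has a point `c` farthest from `x`. As it
  -- is also connected, the geodesics agree all the way to `c`, the branch point.
  obtain ⟨c, hcI, hcmax⟩ := hIc.exists_isMaxOn ⟨x, hxI⟩
    (continuous_const.dist continuous_id : Continuous fun p => dist x p).continuousOn
  obtain ⟨hcy, hcz, hγc, hδc⟩ := hpar c hcI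
  set k := dist x c with hk
  have hagree : ∀ s, 0 ≤ s → s ≤ k → γ s = δ s := by
    intro s hs0 hsk
    have := (hIp.image _ (continuous_const.dist continuous_id :
      Continuous fun p => dist x p).continuousOn).ordConnected.out
      (Set.mem_image_of_mem _ hxI) (Set.mem_image_of_mem _ hcI)
    obtain ⟨p, hp, hps⟩ := this ⟨by simpa using hs0, hsk⟩
    obtain ⟨-, -, h1, h2⟩ := hpar p hp
    simp only at hps
    rw [hps] at h1 h2
    rw [h1, h2]
  refine hagree t ht0 ?_
  -- This equality says that the Gromov product is exactly `k`, so that `t ≤ k`.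
  suffices hkey : dist y z = (ly - k) + (lz - k) by
    unfold gp at ht; rw [← hly, ← hlz] at ht; linarith
  -- the two remaining pieces meet in `c` only
  have hS1 : IsSegment (γ '' Set.Icc k ly) y c := by
    refine ⟨ly - k, fun s => γ (ly - s), by linarith [hcy.2], ?_, by simpa using hγ1,
      by simpa using hγc, ?_⟩
    · intro s hs t ht
      rw [hγ _ ⟨by linarith [hs.2, hcy.1], by linarith [hs.1]⟩ _
        ⟨by linarith [ht.2, hcy.1], by linarith [ht.1]⟩, abs_sub_comm]
      congr 1; ring
    · ext p; constructor
      · rintro ⟨s, hs, rfl⟩; exact ⟨ly - s, ⟨by linarith [hs.2], by linarith [hs.1]⟩, rfl⟩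
      · rintro ⟨s, hs, rfl⟩
        exact ⟨ly - s, ⟨by linarith [hs.2], by linarith [hs.1]⟩, by simp⟩
  have hS2 : IsSegment (δ '' Set.Icc k lz) c z := by
    refine ⟨lz - k, fun s => δ (k + s), by linarith [hcz.2], ?_, by simpa using hδc,
      by simpa using hδ1, ?_⟩
    · intro s hs t ht
      rw [hδ _ ⟨by linarith [hs.1, hcy.1], by linarith [hs.2]⟩ _
        ⟨by linarith [ht.1, hcy.1], by linarith [ht.2]⟩]
      congr 1; ring
    · ext p; constructor
      · rintro ⟨s, hs, rfl⟩; exact ⟨k + s, ⟨by linarith [hs.1], by linarith [hs.2]⟩, rfl⟩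
      · rintro ⟨s, hs, rfl⟩
        exact ⟨s - k, ⟨by linarith [hs.1], by linarith [hs.2]⟩, by simp⟩
  have hS12 : γ '' Set.Icc k ly ∩ δ '' Set.Icc k lz = {c} := by
    ext p
    constructor
    · rintro ⟨⟨s, hs, hsp⟩, ⟨s', hs', hsp'⟩⟩
      have hpI : p ∈ γ '' Set.Icc 0 ly ∩ δ '' Set.Icc 0 lz :=
        ⟨⟨s, ⟨hcy.1.trans hs.1, hs.2⟩, hsp⟩, ⟨s', ⟨hcy.1.trans hs'.1, hs'.2⟩, hsp'⟩⟩
      have h1 : dist x p ≤ k := hcmax hpI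
      have h2 : dist x p = s := hsp ▸ hdγ s ⟨hcy.1.trans hs.1, hs.2⟩
      have : s = k := le_antisymm (h2 ▸ h1) hs.1
      rw [Set.mem_singleton_iff, ← hsp, this, hγc]
    · rintro rfl
      exact ⟨⟨k, ⟨le_rfl, hcy.2⟩, hγc⟩, ⟨k, ⟨le_rfl, hcz.2⟩, hδc⟩⟩
  obtain ⟨a', b', M, ζ, hM, hζ, -, -, hζU⟩ := hX.union _ _ y c z hS1 hS2 hS12
  have hyU : y ∈ ζ '' Set.Icc 0 M := hζU ▸ Or.inl ⟨ly, ⟨hcy.2, le_rfl⟩, hγ1⟩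
  have hzU : z ∈ ζ '' Set.Icc 0 M := hζU ▸ Or.inr ⟨lz, ⟨hcz.2, le_rfl⟩, hδ1⟩
  have hcU : c ∈ ζ '' Set.Icc 0 M := hζU ▸ Or.inl ⟨k, ⟨le_rfl, hcy.2⟩, hγc⟩
  obtain ⟨ty, hty, hζy⟩ := hyU
  obtain ⟨tz, htz, hζz⟩ := hzU
  obtain ⟨tc, htc, hζc⟩ := hcU
  -- points of `[c, y]` and `[c, z]` in the coordinate `ζ`
  have hyc : dist y c = ly - k := by
    rw [← hγ1, ← hγc, hγ _ ⟨hly0, le_rfl⟩ _ hcy, abs_of_nonneg (by linarith [hcy.2])]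
  have hcz' : dist c z = lz - k := by
    rw [← hδ1, ← hδc, hδ _ hcz _ ⟨hlz0, le_rfl⟩, abs_sub_comm, abs_of_nonneg (by linarith [hcz.2])]
  have hyc2 : |ty - tc| = ly - k := by rw [← hζ _ hty _ htc, hζy, hζc, hyc]
  have hcz2 : |tc - tz| = lz - k := by rw [← hζ _ htc _ htz, hζc, hζz, hcz']
  have hyz2 : dist y z = |ty - tz| := by rw [← hζ _ hty _ htz, hζy, hζz]
  have hin1 : ∀ s ∈ Set.Icc k ly, ∃ r ∈ Set.Icc 0 M, ζ r = γ s ∧ |r - tc| = s - k ∧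
      |ty - r| = ly - s := by
    intro s hs
    have : γ s ∈ ζ '' Set.Icc 0 M := hζU ▸ Or.inl ⟨s, hs, rfl⟩
    obtain ⟨r, hr, h⟩ := this
    have hs' : s ∈ Set.Icc 0 ly := ⟨hcy.1.trans hs.1, hs.2⟩
    refine ⟨r, hr, h, ?_, ?_⟩
    · rw [← hζ _ hr _ htc, h, hζc, ← hγc, hγ _ hs' _ hcy, abs_of_nonneg (by linarith [hs.1])]
    · rw [← hζ _ hty _ hr, h, hζy, ← hγ1, hγ _ ⟨hly0, le_rfl⟩ _ hs',
        abs_of_nonneg (by linarith [hs.2])]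
  have hin2 : ∀ s ∈ Set.Icc k lz, ∃ r ∈ Set.Icc 0 M, ζ r = δ s ∧ |r - tc| = s - k ∧
      |tz - r| = lz - s := by
    intro s hs
    have : δ s ∈ ζ '' Set.Icc 0 M := hζU ▸ Or.inr ⟨s, hs, rfl⟩
    obtain ⟨r, hr, h⟩ := this
    have hs' : s ∈ Set.Icc 0 lz := ⟨hcz.1.trans hs.1, hs.2⟩
    refine ⟨r, hr, h, ?_, ?_⟩
    · rw [← hζ _ hr _ htc, h, hζc, ← hδc, hδ _ hs' _ hcz, abs_of_nonneg (by linarith [hs.1])]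
    · rw [← hζ _ htz _ hr, h, hζz, ← hδ1, hδ _ ⟨hlz0, le_rfl⟩ _ hs',
        abs_of_nonneg (by linarith [hs.2])]
  -- Compare the points at distance `e` beyond `c` on the two arms. If their `ζ`-parameters lay on
  -- the same side of `tc` they would coincide, and for `e > 0` the arms would meet outside `c`. So
  -- the arms lie on opposite sides of `tc` and their lengths add up; if `e = 0` one arm is trivial.
  set e := min (ly - k) (lz - k) with he
  have he0 : 0 ≤ e := le_min (by linarith [hcy.2]) (by linarith [hcz.2])
  obtain ⟨r1, hr1, hr1e, hr1a, hr1b⟩ := hin1 (k + e) ⟨by linarith, by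
    linarith [min_le_left (ly - k) (lz - k)]⟩
  obtain ⟨r2, hr2, hr2e, hr2a, hr2b⟩ := hin2 (k + e) ⟨by linarith, by
    linarith [min_le_right (ly - k) (lz - k)]⟩
  have hne : r1 = r2 → e = 0 := by
    intro h
    have h1 : γ (k + e) ∈ γ '' Set.Icc k ly ∩ δ '' Set.Icc k lz := by
      refine ⟨⟨_, ⟨by linarith, by linarith [min_le_left (ly - k) (lz - k)]⟩, rfl⟩,
        ⟨k + e, ⟨by linarith, by linarith [min_le_right (ly - k) (lz - k)]⟩, ?_⟩⟩
      rw [← hr1e, ← hr2e, h]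
    rw [hS12, Set.mem_singleton_iff] at h1
    have h2 := hdγ (k + e) ⟨by linarith [hcy.1], by linarith [min_le_left (ly - k) (lz - k)]⟩
    rw [h1] at h2
    linarith
  rw [hyz2]
  have hle1 := min_le_left (ly - k) (lz - k)
  have hle2 := min_le_right (ly - k) (lz - k)
  rw [← he] at hle1 hle2
  have hez : e = 0 → ly - k = 0 ∨ lz - k = 0 := by
    intro h
    rcases min_choice (ly - k) (lz - k) with h' | h'
    · left; rw [← h', ← he, h]
    · right; rw [← h', ← he, h]
  by_cases he' : e = 0
  · rcases hez he' with h | h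
    · rw [h, abs_eq_zero, sub_eq_zero] at hyc2
      rw [hyc2, h, hcz2]; ring
    · rw [h, abs_eq_zero, sub_eq_zero] at hcz2
      rw [← hcz2, h, hyc2]; ring
  · have hne' : r1 ≠ r2 := fun h => he' (hne h)
    have hep : 0 < e := lt_of_le_of_ne he0 (Ne.symm he')
    have hsum : k + e - k = e := by ring
    rw [hsum] at hr1a hr2a
    clear_value ly lz k e
    rcases (abs_eq he0).1 hr1a with h1 | h1 <;> rcases (abs_eq he0).1 hr2a with h2 | h2
    · exact absurd (by linarith) hne'
    · have a1 : ty - tc = ly - k := by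
        rcases abs_cases (ty - tc) with h | h <;> rcases abs_cases (ty - r1) with h' | h' <;>
          linarith
      have a2 : tc - tz = lz - k := by
        rcases abs_cases (tc - tz) with h | h <;> rcases abs_cases (tz - r2) with h' | h' <;>
          linarith
      rw [abs_of_nonneg] <;> linarith
    · have a1 : ty - tc = -(ly - k) := by
        rcases abs_cases (ty - tc) with h | h <;> rcases abs_cases (ty - r1) with h' | h' <;>
          linarith
      have a2 : tc - tz = -(lz - k) := by
        rcases abs_cases (tc - tz) with h | h <;> rcases abs_cases (tz - r2) with h' | h' <;>
          linarith
      rw [abs_of_nonpos] <;> linarith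
    · exact absurd (by linarith) hne'

/-- Geodesics issuing from one base point agree up to the Gromov product. At the smaller of two
consecutive Gromov products three geodesics therefore pass through a single point, and the triangle
inequality through that point is the ultrametric inequality. -/
theorem _root_.IsRealTree.geodesicTree (hX : IsRealTree X) : GeodesicTree X where
  geod x y t h0 h := by
    obtain ⟨S, l, γ, hl, hγ, h0', h1, -⟩ := hX.geodesic x y
    have hd := IsSegment.dist_eq hl hγ h0' h1
    rw [hd] at h ⊢
    refine ⟨γ t, ?_, ?_⟩
    · rw [← h0', hγ _ ⟨le_rfl, hl⟩ _ ⟨h0, h⟩, zero_sub, abs_neg, abs_of_nonneg h0]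
    · rw [← h1, hγ _ ⟨h0, h⟩ _ ⟨hl, le_rfl⟩, abs_sub_comm, abs_of_nonneg (by linarith)]
  four z x y w := by
    choose S l γ hl hγ h0 h1 _ using fun y => hX.geodesic x y
    have hd : ∀ y, dist x y = l y := fun y => IsSegment.dist_eq (hl y) (hγ y) (h0 y) (h1 y)
    simp only [← hd] at hl hγ h1
    have key : ∀ y z w, min (gp x y z) (gp x z w) ≤ gp x y w := by
      intro y z w
      set t := min (gp x y z) (gp x z w) with ht
      have ht0 : 0 ≤ t := le_min (gp_nonneg _ _ _) (gp_nonneg _ _ _)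
      have e1 : γ y t = γ z t := hX.geodesic_eq (hγ y) (hγ z) (h0 y) (h1 y) (h0 z) (h1 z) ht0
        (min_le_left _ _)
      have e2 : γ z t = γ w t := hX.geodesic_eq (hγ z) (hγ w) (h0 z) (h1 z) (h0 w) (h1 w) ht0
        (min_le_right _ _)
      have hty : t ≤ dist x y := (min_le_left _ _).trans (gp_le_left _ _ _)
      have htw : t ≤ dist x w := (min_le_right _ _).trans (gp_le_right _ _ _)
      have d1 : dist (γ y t) y = dist x y - t := by
        have := hγ y _ ⟨hl y, le_rfl⟩ _ ⟨ht0, hty⟩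
        rwa [h1 y, dist_comm, abs_of_nonneg (by linarith)] at this
      have d2 : dist (γ w t) w = dist x w - t := by
        have := hγ w _ ⟨hl w, le_rfl⟩ _ ⟨ht0, htw⟩
        rwa [h1 w, dist_comm, abs_of_nonneg (by linarith)] at this
      rw [← e2, ← e1] at d2
      unfold gp
      linarith [dist_triangle_left y w (γ y t)]
    have := key y z w
    unfold gp at this
    rw [dist_comm z x, dist_comm z y]
    rcases min_le_iff.1 this with h | h
    · exact le_max_of_le_left (by linarith)
    · exact le_max_of_le_right (by linarith)

theorem _root_.IsUniversalRealTree.geodesicTree {κ : Cardinal} (h : IsUniversalRealTree X κ) :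
    GeodesicTree X := h.isRealTree.geodesicTree

/-- The segment joining two points avoids `x` exactly when their Gromov product at `x` is positive.
By `min_gp_le` this relation is already an equivalence, so generating one adds nothing. -/
theorem directions_mk_eq_iff [GeodesicTree X] {x : X} (y z : {y : X // y ≠ x}) :
    (Quot.mk _ y : Directions x) = Quot.mk _ z ↔ 0 < gp x y.1 z.1 := by
  have hrel : ∀ y z : {y : X // y ≠ x}, (∃ S : Set X, IsSegment S (y : X) (z : X) ∧ x ∉ S) ↔
      0 < gp x y.1 z.1 := by
    rintro ⟨y, hy⟩ ⟨z, hz⟩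
    constructor
    · rintro ⟨S, ⟨l, γ, hl, hγ, h0, h1, rfl⟩, hx⟩
      by_contra hcon
      have h3 : gp x y z = 0 := le_antisymm (not_lt.1 hcon) (gp_nonneg x y z)
      have hd := IsSegment.dist_eq hl hγ h0 h1
      unfold gp at h3
      simp only at h0 h1 hd
      have hm : dist y x ∈ Set.Icc 0 l := ⟨dist_nonneg, by
        linarith [dist_comm x y, @dist_nonneg _ _ x z]⟩
      refine hx ⟨dist y x, hm, ?_⟩
      have e1 : dist y (γ (dist y x)) = dist y x := by
        have := hγ 0 ⟨le_rfl, hl⟩ _ hm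
        rwa [h0, zero_sub, abs_neg, abs_of_nonneg dist_nonneg] at this
      have e2 : dist (γ (dist y x)) z = l - dist y x := by
        have := hγ _ hm l ⟨hl, le_rfl⟩
        rwa [h1, abs_sub_comm, abs_of_nonneg (by linarith [hm.2])] at this
      exact eq_of_between (x := y) (y := z) e1 (by rw [e2]; linarith [dist_comm x y])
        (by rw [e1, e2]; linarith)
    · intro h
      refine ⟨pt y z '' Set.Icc 0 (dist y z), ⟨dist y z, pt y z, dist_nonneg, ?_, pt_zero y z,
        pt_dist y z, rfl⟩, ?_⟩
      · intro s hs t ht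
        rcases le_total s t with hst | hst
        · rw [dist_pt_pt hs.1 hst ht.2, abs_sub_comm, abs_of_nonneg (by linarith)]
        · rw [dist_comm, dist_pt_pt ht.1 hst hs.2, abs_of_nonneg (by linarith)]
      · rintro ⟨t, ht, hx⟩
        have e1 := dist_left_pt ht.1 ht.2
        have e2 := dist_pt_right ht.1 ht.2
        rw [hx] at e1 e2
        unfold gp at h
        linarith [dist_comm x y]
  have heq : Equivalence fun y z : {y : X // y ≠ x} => 0 < gp x y.1 z.1 :=
    { refl := fun y => by
        have := dist_pos.2 y.2.symm
        unfold gp; rw [dist_self]; linarith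
      symm := fun {y z} h => by rwa [gp_comm]
      trans := fun {y z w} h h' => lt_of_lt_of_le (lt_min h h') (min_gp_le x y.1 z.1 w.1) }
  have hfun : (fun y z : {y : X // y ≠ x} => ∃ S : Set X, IsSegment S (y : X) (z : X) ∧ x ∉ S) =
      fun y z : {y : X // y ≠ x} => 0 < gp x y.1 z.1 := by
    funext y z; exact propext (hrel y z)
  rw [Quot.eq, hfun, heq.eqvGen_iff]

end OfIsRealTree

end GeodesicTree

open GeodesicTree Cardinal

/-! ### Germs, reduced paths and path classes -/

/-- Two paths have the same germ at `0⁺`. -/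
def GermEq {V : Type*} (γ γ' : ℝ → V) : Prop := ∃ δ > 0, ∀ s, 0 ≤ s → s ≤ δ → γ s = γ' s

namespace GermEq

variable {V : Type*} {γ γ' γ'' : ℝ → V}

theorem refl (γ : ℝ → V) : GermEq γ γ := ⟨1, one_pos, fun _ _ _ => rfl⟩

theorem symm (h : GermEq γ γ') : GermEq γ' γ := by
  obtain ⟨δ, h0, h⟩ := h
  exact ⟨δ, h0, fun s h1 h2 => (h s h1 h2).symm⟩

theorem trans (h : GermEq γ γ') (h' : GermEq γ' γ'') : GermEq γ γ'' := by
  obtain ⟨δ, h0, h⟩ := h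
  obtain ⟨δ', h0', h'⟩ := h'
  exact ⟨min δ δ', lt_min h0 h0', fun s h1 h2 =>
    (h s h1 (h2.trans (min_le_left _ _))).trans (h' s h1 (h2.trans (min_le_right _ _)))⟩

end GermEq

/-- A path is reduced if it does not backtrack at any interior time. -/
def IsReducedPath {V : Type*} (γ : ℝ → V) (a b : ℝ) : Prop :=
  ∀ t, a < t → t < b → ¬ GermEq (fun s => γ (t - s)) (fun s => γ (t + s))

/-- A class of paths in `V`, closed under restriction, reparametrisation by isometries of the line,
concatenation and limits. -/
structure PathClass (V : Type*) where
  P : (ℝ → V) → ℝ → ℝ → Prop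
  point : ∀ γ a, P γ a a
  congr : ∀ {γ γ' a b}, Set.EqOn γ γ' (Set.Icc a b) → P γ a b → P γ' a b
  mono : ∀ {γ a b a' b'}, P γ a b → a ≤ a' → a' ≤ b' → b' ≤ b → P γ a' b'
  shift : ∀ {γ a b} c, P γ a b → P (fun s => γ (s + c)) (a - c) (b - c)
  rev : ∀ {γ a b}, P γ a b → P (fun s => γ (-s)) (-b) (-a)
  concat : ∀ {γ a b c}, a ≤ b → b ≤ c → P γ a b → P γ b c → P γ a c
  extend : ∀ {γ a b}, a < b → (∀ c, a ≤ c → c < b → P γ a c) →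
    ∃ v, P (Function.update γ b v) a b
  eq_right : ∀ {γ γ' a b}, a < b → P γ a b → P γ' a b → Set.EqOn γ γ' (Set.Ico a b) → γ b = γ' b

namespace PathClass

variable {V : Type} (Ω : PathClass V)

/-- Paths representing the germ of a reduced path issuing from `v`. -/
def IsGerm (v : V) (γ : ℝ → V) : Prop := ∃ l > 0, Ω.P γ 0 l ∧ IsReducedPath γ 0 l ∧ γ 0 = v

/-- Germs of reduced paths issuing from `v`. -/
def germSetoid (v : V) : Setoid {γ : ℝ → V // Ω.IsGerm v γ} where
  r γ γ' := GermEq γ.1 γ'.1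
  iseqv := ⟨fun _ => GermEq.refl _, fun h => h.symm, fun h h' => h.trans h'⟩

/-- The germs of reduced paths issuing from `v`. -/
def Germs (v : V) : Type := Quotient (Ω.germSetoid v)

variable {T : Type} [MetricSpace T] [GeodesicTree T]

/-! ### Charts and partial developing maps -/

/-- An identification of the directions at `p` with the germs of reduced paths at `v`. -/
structure Chart (p : T) (v : V) (B : T → ℝ → V) : Prop where
  germ : ∀ y, y ≠ p → Ω.IsGerm v (B y)
  eq : ∀ y z, y ≠ p → z ≠ p → 0 < gp p y z → B y = B z
  ne : ∀ y z, y ≠ p → z ≠ p → gp p y z = 0 → ¬ GermEq (B y) (B z)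
  surj : ∀ γ, Ω.IsGerm v γ → ∃ y, y ≠ p ∧ GermEq (B y) γ

variable {Ω} {κ : Cardinal.{0}}

/-- Any bijection between directions and germs can be corrected by two transpositions so as to take
two prescribed values. Two are needed at an interior point of a segment, where the backward and the
forward germ are both forced. -/
theorem exists_chart_two {p : T} {v : V} (h : #(Directions p) = #(Ω.Germs v)) {y₁ y₂ : T}
    (h₁ : y₁ ≠ p) (h₂ : y₂ ≠ p) (h₁₂ : gp p y₁ y₂ = 0) {γ₁ γ₂ : ℝ → V} (hγ₁ : Ω.IsGerm v γ₁)
    (hγ₂ : Ω.IsGerm v γ₂) (hγ : ¬ GermEq γ₁ γ₂) :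
    ∃ B, Ω.Chart p v B ∧ GermEq (B y₁) γ₁ ∧ GermEq (B y₂) γ₂ := by
  classical
  obtain ⟨e⟩ := Cardinal.eq.1 h
  let d : ∀ y, y ≠ p → Directions p := fun y hy => Quot.mk _ ⟨y, hy⟩
  let g : ∀ γ, Ω.IsGerm v γ → Ω.Germs v := fun γ hγ => Quotient.mk _ ⟨γ, hγ⟩
  have hd : d y₁ h₁ ≠ d y₂ h₂ := by
    intro h
    have := (directions_mk_eq_iff _ _).1 h
    simp only at this
    linarith
  have hg : g γ₁ hγ₁ ≠ g γ₂ hγ₂ := fun h => hγ (Quotient.exact h)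
  obtain ⟨e', he₁, he₂⟩ : ∃ e' : Directions p ≃ Ω.Germs v, e' (d y₁ h₁) = g γ₁ hγ₁ ∧
      e' (d y₂ h₂) = g γ₂ hγ₂ := by
    let e₁ := e.trans (Equiv.swap (e (d y₁ h₁)) (g γ₁ hγ₁))
    have h1 : e₁ (d y₁ h₁) = g γ₁ hγ₁ := by simp [e₁]
    refine ⟨e₁.trans (Equiv.swap (e₁ (d y₂ h₂)) (g γ₂ hγ₂)), ?_, ?_⟩
    · rw [Equiv.trans_apply, h1, Equiv.swap_apply_of_ne_of_ne _ hg]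
      rw [← h1]; exact fun h => hd (e₁.injective h)
    · simp
  let B : T → ℝ → V := fun y => if hy : y ≠ p then (e' (d y hy)).out.1 else fun _ => v
  have hB : ∀ y (hy : y ≠ p), B y = (e' (d y hy)).out.1 := fun y hy => dif_pos hy
  have hBg : ∀ y (hy : y ≠ p) γ (hγ : Ω.IsGerm v γ), e' (d y hy) = g γ hγ → GermEq (B y) γ := by
    intro y hy γ hγ h
    rw [hB y hy, h]
    exact Quotient.exact (Quotient.out_eq (g γ hγ))
  refine ⟨B, ⟨?_, ?_, ?_, ?_⟩, hBg _ _ _ _ he₁, hBg _ _ _ _ he₂⟩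
  · intro y hy
    rw [hB y hy]
    exact (e' (d y hy)).out.2
  · intro y z hy hz h
    rw [hB y hy, hB z hz]
    have : d y hy = d z hz := (directions_mk_eq_iff _ _).2 h
    rw [this]
  · intro y z hy hz h hcon
    rw [hB y hy, hB z hz] at hcon
    have h1 : e' (d y hy) = e' (d z hz) := by
      rw [← Quotient.out_eq (e' (d y hy)), ← Quotient.out_eq (e' (d z hz))]
      exact Quotient.sound hcon
    have := (directions_mk_eq_iff _ _).1 (e'.injective h1)
    simp only at this
    linarith
  · intro γ hγ
    obtain ⟨a, ha⟩ := e'.surjective (g γ hγ)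
    obtain ⟨⟨y, hy⟩, rfl⟩ := Quot.exists_rep a
    exact ⟨y, hy, hBg y hy γ hγ ha⟩

theorem exists_chart_one {p : T} {v : V} (hD : #(Directions p) = κ) (hG : #(Ω.Germs v) = κ)
    (hκ : 1 < κ) {y₁ : T} (h₁ : y₁ ≠ p) {γ₁ : ℝ → V} (hγ₁ : Ω.IsGerm v γ₁) :
    ∃ B, Ω.Chart p v B ∧ GermEq (B y₁) γ₁ := by
  have hD' : Nontrivial (Directions p) := Cardinal.one_lt_iff_nontrivial.1 (hD ▸ hκ)
  have hG' : Nontrivial (Ω.Germs v) := Cardinal.one_lt_iff_nontrivial.1 (hG ▸ hκ)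
  obtain ⟨d, hd⟩ := exists_ne (α := Directions p) (Quot.mk _ ⟨y₁, h₁⟩)
  obtain ⟨g, hg⟩ := exists_ne (α := Ω.Germs v) (Quotient.mk _ ⟨γ₁, hγ₁⟩)
  obtain ⟨⟨y₂, h₂⟩, rfl⟩ := Quot.exists_rep d
  obtain ⟨⟨γ₂, hγ₂⟩, rfl⟩ := Quotient.exists_rep g
  have h12 : gp p y₁ y₂ = 0 := by
    by_contra h
    refine hd ((directions_mk_eq_iff _ _).2 ?_)
    rw [gp_comm]
    exact lt_of_le_of_ne (gp_nonneg _ _ _) (Ne.symm h)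
  obtain ⟨B, h1, h2, -⟩ := exists_chart_two (hD.trans hG.symm) h₁ h₂ h12 hγ₁ hγ₂
    (fun h => hg (Quotient.sound h.symm))
  exact ⟨B, h1, h2⟩

theorem exists_chart {p : T} {v : V} (hD : #(Directions p) = κ) (hG : #(Ω.Germs v) = κ)
    (hκ : 1 < κ) : ∃ B, Ω.Chart p v B := by
  have hD' : Nontrivial (Directions p) := Cardinal.one_lt_iff_nontrivial.1 (hD ▸ hκ)
  have hG' : Nontrivial (Ω.Germs v) := Cardinal.one_lt_iff_nontrivial.1 (hG ▸ hκ)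
  obtain ⟨⟨y₁, h₁⟩, -⟩ := Quot.exists_rep (Classical.arbitrary (Directions p))
  obtain ⟨⟨γ₁, hγ₁⟩, -⟩ := Quotient.exists_rep (Classical.arbitrary (Ω.Germs v))
  obtain ⟨B, h, -⟩ := exists_chart_one hD hG hκ h₁ hγ₁
  exact ⟨B, h⟩

variable (Ω)

/-- A developing map `T → V`: it sends segments to paths of the class and induces at every point a
bijection between directions and germs of reduced paths. -/
structure Developing (π : T → V) : Prop where
  path : ∀ x y, Ω.P (fun s => π (pt x y s)) 0 (dist x y)
  inj : ∀ x y z, y ≠ x → z ≠ x → gp x y z = 0 →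
    ¬ GermEq (fun s => π (pt x y s)) (fun s => π (pt x z s))
  surj : ∀ x γ, Ω.IsGerm (π x) γ → ∃ y, y ≠ x ∧ GermEq (fun s => π (pt x y s)) γ

/-- The conditions on a partially defined developing map along the segment from `b` to `x`. -/
structure LocalDev (b : T) (f : T → V × (T → ℝ → V)) (x : T) : Prop where
  path : Ω.P (fun s => (f (pt b x s)).1) 0 (dist b x)
  chart : Ω.Chart x (f x).1 (f x).2
  out : ∀ t, 0 ≤ t → t < dist b x →
    GermEq (fun s => (f (pt (pt b x t) x s)).1) ((f (pt b x t)).2 x)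
  inn : x ≠ b → GermEq (fun s => (f (pt x b s)).1) ((f x).2 b)

/-- A developing map defined on a subset which is star-shaped about `b`. -/
structure PartialDev (b : T) where
  S : Set T
  f : T → V × (T → ℝ → V)
  base : b ∈ S
  star : ∀ x ∈ S, ∀ t, pt b x t ∈ S
  loc : ∀ x ∈ S, Ω.LocalDev b f x

end PathClass

namespace GeodesicTree

variable {T : Type*} [MetricSpace T] [GeodesicTree T]

theorem exists_pt_pt_left (x y : T) {s : ℝ} (h0 : 0 ≤ s) (h : s ≤ dist x y) (t : ℝ) :
    ∃ r, 0 ≤ r ∧ r ≤ s ∧ pt x (pt x y s) t = pt x y r := by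
  rcases le_total t 0 with ht | ht
  · exact ⟨0, le_rfl, h0, by rw [pt_of_le ht, pt_zero]⟩
  rcases le_total t s with hts | hts
  · exact ⟨t, ht, hts, pt_pt_left ht hts h⟩
  · exact ⟨s, h0, le_rfl, pt_of_ge (by rwa [dist_left_pt h0 h])⟩

theorem exists_pt_pt_right (x y : T) {s : ℝ} (h0 : 0 ≤ s) (h : s ≤ dist x y) (t : ℝ) :
    ∃ r, pt (pt x y s) y t = pt x y r := by
  rcases le_total t 0 with ht | ht
  · exact ⟨s, by rw [pt_of_le ht]⟩
  rcases le_total (s + t) (dist x y) with hts | hts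
  · exact ⟨s + t, pt_pt_right h0 ht hts⟩
  · exact ⟨dist x y, by rw [pt_dist, pt_of_ge]; rw [dist_pt_right h0 h]; linarith⟩

theorem exists_pt_comm (x y : T) (t : ℝ) : ∃ r, pt x y t = pt y x r := by
  rcases le_total t 0 with ht | ht
  · exact ⟨dist y x, by rw [pt_of_le ht, pt_dist]⟩
  rcases le_total t (dist x y) with hts | hts
  · exact ⟨_, pt_comm ht (by rwa [dist_comm])⟩
  · exact ⟨0, by rw [pt_of_ge hts, pt_zero]⟩

/-- The point at time `t` separates the endpoints of a segment. -/
theorem gp_pt_eq_zero {x y : T} {t : ℝ} (h0 : 0 ≤ t) (h : t ≤ dist x y) :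
    gp (pt x y t) x y = 0 := by
  have h1 := dist_left_pt h0 h
  have h2 := dist_pt_right h0 h
  unfold gp
  rw [dist_comm (pt x y t) x]
  linarith

theorem gp_pt_pos {x y : T} {s t : ℝ} (h0 : 0 ≤ s) (hst : s < t) (h : t ≤ dist x y) :
    0 < gp (pt x y s) (pt x y t) y := by
  have h1 := dist_pt_pt h0 hst.le h
  have h2 := dist_pt_right h0 (hst.le.trans h)
  have h3 := dist_pt_right (h0.trans hst.le) h
  unfold gp
  linarith

theorem pt_ne_right {x y : T} {t : ℝ} (h0 : 0 ≤ t) (h : t < dist x y) : y ≠ pt x y t := by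
  intro h'
  have h2 := dist_pt_right h0 h.le
  rw [← h', dist_self] at h2
  linarith

theorem pt_ne_left {x y : T} {t : ℝ} (h0 : 0 < t) (h : t ≤ dist x y) : x ≠ pt x y t := by
  intro h'
  have h2 := dist_left_pt h0.le h
  rw [← h', dist_self] at h2
  linarith

theorem pt_ne_pt {x y : T} {s t : ℝ} (h0 : 0 ≤ s) (hst : s < t) (h : t ≤ dist x y) :
    pt x y t ≠ pt x y s := by
  intro h'
  have h2 := dist_pt_pt h0 hst.le h
  rw [← h', dist_self] at h2
  linarith

end GeodesicTree

/-! ### Extending partial developing maps -/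

namespace PathClass

variable {V : Type} {Ω : PathClass V} {T : Type} [MetricSpace T] [GeodesicTree T]
  {κ : Cardinal.{0}}

theorem LocalDev.congr {b x : T} {f f' : T → V × (T → ℝ → V)} (h : Ω.LocalDev b f x)
    (hf : ∀ t, f (pt b x t) = f' (pt b x t)) : Ω.LocalDev b f' x := by
  have hx : f x = f' x := by simpa using hf (dist b x)
  refine ⟨?_, hx ▸ h.chart, ?_, ?_⟩
  · simpa only [hf] using h.path
  · intro t h0 ht
    have e : ∀ s, f (pt (pt b x t) x s) = f' (pt (pt b x t) x s) := fun s => by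
      obtain ⟨r, hr⟩ := exists_pt_pt_right b x h0 ht.le s
      rw [hr, hf]
    simpa only [hf, e] using h.out t h0 ht
  · intro hb
    have e : ∀ s, f (pt x b s) = f' (pt x b s) := fun s => by
      obtain ⟨r, hr⟩ := exists_pt_comm x b s
      rw [hr, hf]
    simpa only [hx, e] using h.inn hb

namespace PartialDev

variable {b : T}

instance : Preorder (PartialDev (T := T) Ω b) where
  le D D' := D.S ⊆ D'.S ∧ ∀ x ∈ D.S, D.f x = D'.f x
  le_refl D := ⟨subset_rfl, fun _ _ => rfl⟩
  le_trans D D' D'' h h' := ⟨h.1.trans h'.1, fun x hx => (h.2 x hx).trans (h'.2 x (h.1 hx))⟩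

/-- The local conditions at `x` involve only the segment from `b` to `x`, which lies in any member
of the chain that contains `x`. -/
theorem bddAbove_of_chain {c : Set (PartialDev (T := T) Ω b)} (hc : IsChain (· ≤ ·) c)
    (hne : c.Nonempty) : BddAbove c := by
  classical
  obtain ⟨D₀, hD₀⟩ := hne
  let f : T → V × (T → ℝ → V) := fun x =>
    if h : ∃ D ∈ c, x ∈ D.S then h.choose.f x else D₀.f x
  have hf : ∀ D ∈ c, ∀ x ∈ D.S, D.f x = f x := by
    intro D hD x hx
    have h : ∃ D ∈ c, x ∈ D.S := ⟨D, hD, hx⟩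
    have hfx : f x = h.choose.f x := dif_pos h
    rw [hfx]
    rcases hc.total hD h.choose_spec.1 with h' | h'
    · exact h'.2 x hx
    · exact (h'.2 x h.choose_spec.2).symm
  refine ⟨⟨{x | ∃ D ∈ c, x ∈ D.S}, f, ⟨D₀, hD₀, D₀.base⟩, ?_, ?_⟩, ?_⟩
  · rintro x ⟨D, hD, hx⟩ t
    exact ⟨D, hD, D.star x hx t⟩
  · rintro x ⟨D, hD, hx⟩
    exact (D.loc x hx).congr fun t => hf D hD _ (D.star x hx t)
  · intro D hD
    exact ⟨fun x hx => ⟨D, hD, hx⟩, hf D hD⟩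

/-- A reduced path along `[b, x]` that is compatible with the values and charts already chosen
supplies the missing values; new points receive charts aligned with the path in both directions. -/
theorem exists_extension (hD : ∀ p : T, #(Directions p) = κ) (hG : ∀ v, #(Ω.Germs v) = κ)
    (hκ : 1 < κ) (D : PartialDev (T := T) Ω b) {x : T} (hx : x ∉ D.S) {δ : ℝ → V}
    (hP : Ω.P δ 0 (dist b x)) (hred : IsReducedPath δ 0 (dist b x))
    (heq : ∀ t, 0 ≤ t → t ≤ dist b x → pt b x t ∈ D.S → δ t = (D.f (pt b x t)).1)
    (hout : ∀ t, 0 ≤ t → t < dist b x → pt b x t ∈ D.S →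
      GermEq (fun s => δ (t + s)) ((D.f (pt b x t)).2 x)) :
    ∃ D' : PartialDev (T := T) Ω b, D ≤ D' ∧ ¬ D' ≤ D := by
  classical
  -- Reducedness makes the two germs of `δ` at an interior time distinct, as `exists_chart_two`
  -- requires. At the endpoint only the backward germ is imposed, and time `0` is the base point,
  -- which has a chart already.
  have hchart : ∀ t, ∃ B, 0 < t → t ≤ dist b x → Ω.Chart (pt b x t) (δ t) B ∧
      GermEq (B b) (fun s => δ (t - s)) ∧ (t < dist b x → GermEq (B x) (fun s => δ (t + s))) := by
    intro t
    by_cases ht : 0 < t ∧ t ≤ dist b x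
    swap
    · exact ⟨fun _ _ => δ 0, fun h1 h2 => absurd ⟨h1, h2⟩ ht⟩
    obtain ⟨ht0, ht1⟩ := ht
    have hP1 : Ω.P (fun s => δ (t - s)) 0 t := by
      have h1 := Ω.shift (-t) (Ω.rev (Ω.mono hP le_rfl ht0.le ht1))
      simp only [sub_neg_eq_add, neg_add_cancel, neg_zero, zero_add] at h1
      refine Ω.congr (fun s _ => ?_) h1
      congr 1; ring
    have hg1 : Ω.IsGerm (δ t) (fun s => δ (t - s)) := by
      refine ⟨t, ht0, hP1, ?_, by simp⟩
      intro r hr0 hr1 h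
      refine hred (t - r) (by linarith) (by linarith) ?_
      obtain ⟨e, he, h⟩ := h
      refine ⟨e, he, fun s hs0 hs1 => ?_⟩
      have := h s hs0 hs1
      beta_reduce at this ⊢
      rw [show t - r - s = t - (r + s) by ring, ← this]
      congr 1; ring
    rcases ht1.lt_or_eq with hlt | heq'
    · have hP2 : Ω.P (fun s => δ (t + s)) 0 (dist b x - t) := by
        have h1 := Ω.shift t (Ω.mono hP ht0.le hlt.le le_rfl)
        rw [sub_self] at h1
        simpa only [add_comm] using h1
      have hg2 : Ω.IsGerm (δ t) (fun s => δ (t + s)) := by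
        refine ⟨dist b x - t, by linarith, hP2, ?_, by simp⟩
        intro r hr0 hr1 h
        refine hred (t + r) (by linarith) (by linarith) ?_
        simpa only [add_assoc, ← add_sub_assoc] using h
      obtain ⟨B, h1, h2, h3⟩ := exists_chart_two (Ω := Ω) (p := pt b x t) (v := δ t)
        ((hD _).trans (hG _).symm) (pt_ne_left ht0 ht1) (pt_ne_right ht0.le hlt)
        (gp_pt_eq_zero ht0.le ht1) hg1 hg2 (hred t ht0 hlt)
      exact ⟨B, fun _ _ => ⟨h1, h2, fun _ => h3⟩⟩
    · obtain ⟨B, h1, h2⟩ := exists_chart_one (Ω := Ω) (hD (pt b x t)) (hG (δ t)) hκ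
        (pt_ne_left ht0 ht1) hg1
      exact ⟨B, fun _ _ => ⟨h1, h2, fun h => absurd heq' h.ne⟩⟩
  choose B hB using hchart
  let f : T → V × (T → ℝ → V) := fun q => if q ∈ D.S then D.f q else (δ (dist b q), B (dist b q))
  have hfS : ∀ q ∈ D.S, D.f q = f q := fun q hq => (if_pos hq).symm
  have hf1 : ∀ t, 0 ≤ t → t ≤ dist b x → (f (pt b x t)).1 = δ t := by
    intro t h0 h1
    by_cases h : pt b x t ∈ D.S
    · rw [← hfS _ h, heq t h0 h1 h]
    · simp only [f, if_neg h, dist_left_pt h0 h1]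
  have hf2 : ∀ t, 0 ≤ t → t ≤ dist b x → pt b x t ∉ D.S → (f (pt b x t)).2 = B t := by
    intro t h0 h1 h
    simp only [f, if_neg h, dist_left_pt h0 h1]
  have hpos : ∀ t, 0 ≤ t → pt b x t ∉ D.S → 0 < t := by
    intro t h0 h
    rcases h0.lt_or_eq with h' | rfl
    · exact h'
    · exact absurd (by simpa using D.base) h
  have hfchart : ∀ t, 0 ≤ t → t ≤ dist b x →
      Ω.Chart (pt b x t) (f (pt b x t)).1 (f (pt b x t)).2 := by
    intro t h0 h1
    by_cases h : pt b x t ∈ D.S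
    · rw [← hfS _ h]; exact (D.loc _ h).chart
    · rw [hf1 t h0 h1, hf2 t h0 h1 h]; exact (hB t (hpos t h0 h) h1).1
  have hfout : ∀ t, 0 ≤ t → t < dist b x →
      GermEq (fun s => δ (t + s)) ((f (pt b x t)).2 x) := by
    intro t h0 h1
    by_cases h : pt b x t ∈ D.S
    · rw [← hfS _ h]; exact hout t h0 h1 h
    · rw [hf2 t h0 h1.le h]; exact ((hB t (hpos t h0 h) h1.le).2.2 h1).symm
  refine ⟨⟨D.S ∪ {q | ∃ t, 0 ≤ t ∧ t ≤ dist b x ∧ q = pt b x t}, f, Or.inl D.base, ?_, ?_⟩, ?_, ?_⟩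
  · rintro q (hq | ⟨t, h0, h1, rfl⟩) s
    · exact Or.inl (D.star q hq s)
    · obtain ⟨r, hr0, hr1, hr⟩ := exists_pt_pt_left b x h0 h1 s
      exact Or.inr ⟨r, hr0, hr1.trans h1, hr⟩
  · intro q hq
    by_cases hqS : q ∈ D.S
    · exact (D.loc q hqS).congr fun t => hfS _ (D.star q hqS t)
    obtain ⟨t, h0, h1, rfl⟩ := hq.resolve_left hqS
    have ht0 := hpos t h0 hqS
    have hd := dist_left_pt h0 h1
    refine ⟨?_, hfchart t h0 h1, ?_, ?_⟩
    · rw [hd]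
      refine Ω.congr (fun s hs => ?_) (Ω.mono hP le_rfl h0 h1)
      rw [pt_pt_left hs.1 hs.2 h1, hf1 s hs.1 (hs.2.trans h1)]
    · intro r hr0 hr1
      rw [hd] at hr1
      rw [pt_pt_left hr0 hr1.le h1]
      have hr := hr1.trans_le h1
      rw [(hfchart r hr0 hr.le).eq (pt b x t) x (pt_ne_pt hr0 hr1 h1) (pt_ne_right hr0 hr)
        (gp_pt_pos hr0 hr1 h1)]
      refine GermEq.trans ?_ (hfout r hr0 hr)
      refine ⟨t - r, by linarith, fun s hs0 hs1 => ?_⟩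
      simp only
      rw [← hf1 (r + s) (by linarith) (by linarith)]
      have : pt (pt b x r) (pt b x t) s = pt b x (r + s) := by
        have h' : pt b x r = pt b (pt b x t) r := (pt_pt_left hr0 hr1.le h1).symm
        rw [h', pt_pt_right hr0 hs0 (by rw [hd]; linarith), pt_pt_left (by linarith) (by linarith) h1]
      rw [this]
    · intro _
      rw [hf2 t h0 h1 hqS]
      refine GermEq.trans ?_ (hB t ht0 h1).2.1.symm
      refine ⟨t, ht0, fun s hs0 hs1 => ?_⟩
      simp only
      rw [← hf1 (t - s) (by linarith) (by linarith), pt_comm hs0 (by rw [hd]; exact hs1), hd,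
        pt_pt_left (by linarith) (by linarith) h1]
  · exact ⟨Set.subset_union_left, hfS⟩
  · intro h
    exact hx (h.1 (Or.inr ⟨dist b x, dist_nonneg, le_rfl, by simp⟩))

end PartialDev

end PathClass

theorem GermEq.congr_of_lt {V : Type*} {γ γ' δ δ' : ℝ → V} {e : ℝ} (he : 0 < e)
    (h : ∀ s, 0 ≤ s → s < e → γ s = δ s) (h' : ∀ s, 0 ≤ s → s < e → γ' s = δ' s)
    (H : GermEq γ γ') : GermEq δ δ' := by
  obtain ⟨r, hr, H⟩ := H
  refine ⟨min r (e / 2), lt_min hr (by linarith), fun s h0 h1 => ?_⟩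
  have h2 := h1.trans (min_le_right _ _)
  rw [← h s h0 (by linarith), ← h' s h0 (by linarith), H s h0 (h1.trans (min_le_left _ _))]

theorem GermEq.of_lt {V : Type*} {γ γ' : ℝ → V} {e : ℝ} (he : 0 < e)
    (h : ∀ s, 0 ≤ s → s < e → γ s = γ' s) : GermEq γ γ' :=
  ⟨e / 2, by linarith, fun s h0 h1 => h s h0 (by linarith)⟩

namespace PathClass

variable {V : Type} {Ω : PathClass V} {T : Type} [MetricSpace T] [GeodesicTree T]
  {κ : Cardinal.{0}}

theorem exists_partialDev (hD : ∀ p : T, #(Directions p) = κ) (hG : ∀ v, #(Ω.Germs v) = κ)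
    (hκ : 1 < κ) (b : T) (v : V) : Nonempty (PartialDev (T := T) Ω b) := by
  obtain ⟨B, hB⟩ := exists_chart (Ω := Ω) (hD b) (hG v) hκ
  have hb : ∀ t, pt b b t = b := fun t => by
    rcases le_total t 0 with h | h
    · exact pt_of_le h
    · exact pt_of_ge (by rwa [dist_self])
  refine ⟨⟨{b}, fun _ => (v, B), rfl, ?_, ?_⟩⟩
  · rintro x rfl t
    exact hb t
  · rintro x rfl
    refine ⟨?_, hB, ?_, fun h => absurd rfl h⟩
    · rw [dist_self]; exact Ω.point _ _
    · intro t h0 h1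
      rw [dist_self] at h1
      linarith

namespace PartialDev

variable {b : T}

/-- On `[b, x]` the domain is an initial interval with supremum `σ`. If `σ` is attained, the chart
there provides a path on which to continue; if not, the limit point can be added. -/
theorem exists_gt (hD : ∀ p : T, #(Directions p) = κ) (hG : ∀ v, #(Ω.Germs v) = κ)
    (hκ : 1 < κ) (D : PartialDev (T := T) Ω b) {x : T} (hx : x ∉ D.S) :
    ∃ D' : PartialDev (T := T) Ω b, D ≤ D' ∧ ¬ D' ≤ D := by
  classical
  set d := dist b x with hd
  set J : Set ℝ := {t | 0 ≤ t ∧ t ≤ d ∧ pt b x t ∈ D.S} with hJ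
  have hJ0 : (0 : ℝ) ∈ J := ⟨le_rfl, dist_nonneg, by simpa using D.base⟩
  have hJb : BddAbove J := ⟨d, fun t ht => ht.2.1⟩
  set σ := sSup J with hσ
  have hσ0 : 0 ≤ σ := le_csSup hJb hJ0
  have hσd : σ ≤ d := csSup_le ⟨0, hJ0⟩ fun t ht => ht.2.1
  have hdown : ∀ t ∈ J, ∀ s, 0 ≤ s → s ≤ t → s ∈ J := by
    intro t ht s hs hst
    refine ⟨hs, hst.trans ht.2.1, ?_⟩
    rw [← pt_pt_left hs hst ht.2.1]
    exact D.star _ ht.2.2 s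
  have hlt : ∀ t, 0 ≤ t → t < σ → ∃ t' ∈ J, t < t' := by
    intro t h0 h1
    obtain ⟨t', ht', h⟩ := exists_lt_of_lt_csSup ⟨0, hJ0⟩ h1
    exact ⟨t', ht', h⟩
  have hltJ : ∀ t, 0 ≤ t → t < σ → t ∈ J := by
    intro t h0 h1
    obtain ⟨t', ht', h⟩ := hlt t h0 h1
    exact hdown t' ht' t h0 h.le
  set δ₀ : ℝ → V := fun t => (D.f (pt b x t)).1 with hδ₀
  have hpath : ∀ t ∈ J, Ω.P δ₀ 0 t := by
    intro t ht
    have h := (D.loc _ ht.2.2).path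
    rw [dist_left_pt ht.1 ht.2.1] at h
    refine Ω.congr (fun s hs => ?_) h
    simp only [hδ₀, pt_pt_left hs.1 hs.2 ht.2.1]
  have hinn : ∀ t ∈ J, 0 < t → GermEq (fun s => δ₀ (t - s)) ((D.f (pt b x t)).2 b) := by
    intro t ht h0
    refine GermEq.trans ?_ ((D.loc _ ht.2.2).inn (pt_ne_left h0 ht.2.1).symm)
    refine ⟨t, h0, fun s hs0 hs1 => ?_⟩
    simp only [hδ₀]
    rw [pt_comm hs0 (by rwa [dist_left_pt ht.1 ht.2.1]), dist_left_pt ht.1 ht.2.1,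
      pt_pt_left (by linarith) (by linarith) ht.2.1]
  have hout : ∀ t, 0 ≤ t → t < σ → GermEq (fun s => δ₀ (t + s)) ((D.f (pt b x t)).2 x) := by
    intro t h0 h1
    obtain ⟨r, hr, htr⟩ := hlt t h0 h1
    have htJ := hltJ t h0 h1
    have hdr := dist_left_pt hr.1 hr.2.1
    have h := (D.loc _ hr.2.2).out t h0 (by rwa [hdr])
    rw [pt_pt_left h0 htr.le hr.2.1,
      (D.loc _ htJ.2.2).chart.eq _ _ (pt_ne_pt h0 htr hr.2.1)
        (pt_ne_right h0 (htr.trans_le hr.2.1)) (gp_pt_pos h0 htr hr.2.1)] at h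
    refine GermEq.trans ?_ h
    refine ⟨r - t, by linarith, fun s hs0 hs1 => ?_⟩
    simp only [hδ₀]
    rw [show pt b x t = pt b (pt b x r) t from (pt_pt_left h0 htr.le hr.2.1).symm,
      pt_pt_right h0 hs0 (by rw [hdr]; linarith), pt_pt_left (by linarith) (by linarith) hr.2.1]
  have hfold : ∀ t, 0 < t → t < σ → ¬ GermEq (fun s => δ₀ (t - s)) (fun s => δ₀ (t + s)) := by
    intro t h0 h1 h
    have htJ := hltJ t h0.le h1
    have htd : t < dist b x := h1.trans_le hσd
    exact (D.loc _ htJ.2.2).chart.ne b x (pt_ne_left h0 htd.le) (pt_ne_right h0.le htd)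
      (gp_pt_eq_zero h0.le htd.le)
      (((hinn t htJ h0).symm.trans h).trans (hout t h0.le h1))
  have hnot : ∀ t, σ < t → t ≤ d → pt b x t ∉ D.S := by
    intro t h1 h2 h
    exact absurd (le_csSup hJb (show t ∈ J from ⟨hσ0.trans h1.le, h2, h⟩)) (not_le.2 h1)
  -- the extension along an initial segment of `[b, x]`
  have main : ∀ l, 0 < l → l ≤ d → pt b x l ∉ D.S → ∀ δ : ℝ → V, Ω.P δ 0 l →
      (∀ t, 0 ≤ t → t < σ → δ t = δ₀ t) →
      (∀ t, 0 < t → σ ≤ t → t < l → ¬ GermEq (fun s => δ (t - s)) (fun s => δ (t + s))) →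
      (∀ t ∈ J, δ t = δ₀ t) →
      (∀ t ∈ J, σ ≤ t → t < l → GermEq (fun s => δ (t + s)) ((D.f (pt b x t)).2 x)) →
      ∃ D' : PartialDev (T := T) Ω b, D ≤ D' ∧ ¬ D' ≤ D := by
    intro l hl0 hld hlS δ hP hagree hred heq hgerm
    have hdl := dist_left_pt hl0.le hld
    refine exists_extension hD hG hκ D hlS (δ := δ) (by rwa [hdl]) ?_ ?_ ?_
    · rw [hdl]
      intro t ht0 htl h
      rcases lt_or_ge t σ with htσ | htσ
      · refine hfold t ht0 htσ (GermEq.congr_of_lt (lt_min ht0 (sub_pos.2 htσ)) ?_ ?_ h)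
        · intro s hs0 hs1
          have := lt_min_iff.1 hs1
          exact hagree _ (by linarith) (by linarith)
        · intro s hs0 hs1
          have := lt_min_iff.1 hs1
          exact hagree _ (by linarith) (by linarith)
      · exact hred t ht0 htσ htl h
    · rw [hdl]
      intro t ht0 htl h
      rw [pt_pt_left ht0 htl hld] at h ⊢
      exact heq t ⟨ht0, htl.trans hld, h⟩
    · rw [hdl]
      intro t ht0 htl h
      rw [pt_pt_left ht0 htl.le hld] at h ⊢
      have htJ : t ∈ J := ⟨ht0, htl.le.trans hld, h⟩
      rw [(D.loc _ h).chart.eq _ _ (pt_ne_pt ht0 htl hld)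
        (pt_ne_right ht0 (htl.trans_le hld)) (gp_pt_pos ht0 htl hld)]
      rcases lt_or_ge t σ with htσ | htσ
      · refine GermEq.trans (GermEq.of_lt (sub_pos.2 htσ) fun s hs0 hs1 => ?_) (hout t ht0 htσ)
        exact hagree _ (by linarith) (by linarith)
      · exact hgerm t htJ htσ htl
  by_cases hσJ : σ ∈ J
  · have hσlt : σ < d := by
      refine lt_of_le_of_ne hσd fun h => hx ?_
      have := hσJ.2.2
      rwa [h, hd, pt_dist] at this
    have hxp := pt_ne_right hσ0 hσlt
    have hch := (D.loc _ hσJ.2.2).chart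
    obtain ⟨l₀, hl₀, hγP, hγr, hγ0⟩ := hch.germ x hxp
    set γ := (D.f (pt b x σ)).2 x with hγ
    -- The germ chosen for the direction of `x` is represented by a reduced path of length `l₀`
    -- only, so the extension stops there or at `x`.
    set l := min d (σ + l₀) with hl
    have hσl : σ < l := lt_min hσlt (by linarith)
    have hll : l ≤ σ + l₀ := min_le_right _ _
    let δ : ℝ → V := fun t => if t ≤ σ then δ₀ t else γ (t - σ)
    have hδ1 : ∀ t, t ≤ σ → δ t = δ₀ t := fun t ht => if_pos ht
    have hδ2 : ∀ t, σ ≤ t → δ t = γ (t - σ) := by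
      intro t ht
      rcases ht.lt_or_eq with h | rfl
      · exact if_neg (not_le.2 h)
      · rw [hδ1 _ le_rfl, sub_self, hγ0]
    refine main l (hσ0.trans_lt hσl) (min_le_left _ _) (hnot l hσl (min_le_left _ _)) δ ?_
      (fun t _ h => hδ1 t h.le) ?_ (fun t ht => hδ1 t (le_csSup hJb ht)) ?_
    · refine Ω.concat hσ0 hσl.le ?_ ?_
      · exact Ω.congr (fun s hs => (hδ1 s hs.2).symm) (hpath σ hσJ)
      · have h := Ω.shift (-σ) hγP
        rw [sub_neg_eq_add, zero_add, sub_neg_eq_add] at h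
        refine Ω.congr (fun s hs => ?_) (Ω.mono h le_rfl hσl.le (by linarith))
        rw [hδ2 s hs.1, sub_eq_add_neg]
    · intro t ht0 htσ htl h
      rcases htσ.lt_or_eq with hlt | rfl
      · refine hγr (t - σ) (by linarith) (by linarith)
          (GermEq.congr_of_lt (sub_pos.2 hlt) ?_ ?_ h)
        · intro s hs0 hs1
          rw [hδ2 _ (by linarith)]; congr 1; ring
        · intro s hs0 hs1
          rw [hδ2 _ (by linarith)]; congr 1; ring
      -- At the junction backtracking is excluded by the chart, which assigns different germs to the
      -- directions of `b` and `x`.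
      · refine hch.ne b x (pt_ne_left ht0 hσd) hxp (gp_pt_eq_zero hσ0 hσd) ?_
        refine (hinn σ hσJ ht0).symm.trans (GermEq.congr_of_lt ht0 ?_ ?_ h)
        · intro s hs0 hs1
          exact hδ1 _ (by linarith)
        · intro s hs0 hs1
          rw [hδ2 _ (by linarith), add_sub_cancel_left]
    · intro t ht htσ htl
      obtain rfl : t = σ := le_antisymm (le_csSup hJb ht) htσ
      refine ⟨1, one_pos, fun s hs0 _ => ?_⟩
      simp only
      rw [hδ2 _ (by linarith), add_sub_cancel_left]
  · have hσpos : 0 < σ := lt_of_le_of_ne hσ0 fun h => hσJ (by rw [← h]; exact hJ0)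
    -- Here only the point at time `σ` is new: closure of the path class under limits gives its
    -- value.
    obtain ⟨v, hv⟩ := Ω.extend hσpos fun c h0 h1 => hpath c (hltJ c h0 h1)
    refine main σ hσpos hσd (fun h => hσJ ⟨hσ0, hσd, h⟩) _ hv ?_ ?_ ?_ ?_
    · intro t _ h
      exact Function.update_of_ne h.ne _ _
    · intro t _ h1 h2
      exact absurd h1 (not_le.2 h2)
    · intro t ht
      exact Function.update_of_ne (ne_of_mem_of_not_mem ht hσJ) _ _
    · intro t _ h1 h2
      exact absurd h1 (not_le.2 h2)

end PartialDev

/-- Every geodesic tree all of whose points have as many directions as there are germs of reduced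
paths has a developing map. -/
theorem exists_developing (hD : ∀ p : T, #(Directions p) = κ) (hG : ∀ v, #(Ω.Germs v) = κ)
    (hκ : 1 < κ) (b : T) (v : V) : ∃ π : T → V, Ω.Developing π := by
  have := exists_partialDev (Ω := Ω) hD hG hκ b v
  obtain ⟨D, hmax⟩ := zorn_le_nonempty (α := PartialDev (T := T) Ω b)
    fun c hc hne => PartialDev.bddAbove_of_chain hc hne
  have hS : ∀ x, x ∈ D.S := by
    intro x
    by_contra hx
    obtain ⟨D', h1, h2⟩ := D.exists_gt hD hG hκ hx
    exact h2 (hmax h1)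
  have hloc : ∀ x, Ω.LocalDev b D.f x := fun x => D.loc x (hS x)
  let π : T → V := fun x => (D.f x).1
  have hgerm : ∀ x y, y ≠ x → GermEq (fun s => π (pt x y s)) ((D.f x).2 y) := by
    intro x y hyx
    -- Either `y` lies in the direction of `b` as seen from `x`, where the incoming condition at `x`
    -- applies, or `x` lies on `[b, y]`, where the outgoing condition for `y` applies.
    by_cases h0 : 0 < gp x y b
    · have hxb : x ≠ b := by
        rintro rfl
        have := gp_le_right x y x
        rw [dist_self] at this
        linarith
      rw [(hloc x).chart.eq y b hyx hxb.symm h0]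
      refine GermEq.trans ?_ ((hloc x).inn hxb)
      exact ⟨gp x y b, h0, fun s hs0 hs1 => by simp only [pt_eq_of_le_gp hs0 hs1, π]⟩
    · have h0' : gp x y b = 0 := le_antisymm (not_lt.1 h0) (gp_nonneg _ _ _)
      unfold gp at h0'
      have hx : x = pt b y (dist b x) := eq_pt rfl (by
        rw [dist_comm b y, dist_comm b x]; linarith)
      have h := (hloc y).out (dist b x) dist_nonneg (by
        have := dist_pos.2 hyx
        linarith [dist_comm x y, dist_comm b y, dist_comm x b])
      rwa [← hx] at h
  refine ⟨π, ?_, ?_, ?_⟩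
  · intro x y
    -- The segment from `x` to `y` splits at the branch point `r` into a reversed piece of `[b, x]`
    -- and a piece of `[b, y]`.
    have hr := dist_branch b x y
    set r := pt b x (gp b x y) with hrdef
    have hr' : r = pt b y (gp b x y) := pt_eq_of_le_gp (gp_nonneg _ _ _) le_rfl
    have hbr : dist b r = gp b x y := dist_left_pt (gp_nonneg _ _ _) (gp_le_left _ _ _)
    have hrx : dist b x = dist b r + dist r x := by
      rw [hbr, hrdef, dist_pt_right (gp_nonneg _ _ _) (gp_le_left _ _ _)]; ring
    have hry : dist b y = dist b r + dist r y := by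
      rw [hbr, hr', dist_pt_right (gp_nonneg _ _ _) (gp_le_right _ _ _)]; ring
    refine Ω.concat (b := dist x r) dist_nonneg (by rw [hr]; linarith [@dist_nonneg _ _ r y]) ?_ ?_
    · have hbr0 : 0 ≤ dist b r := dist_nonneg
      have h := Ω.shift (- dist b x) (Ω.rev (Ω.mono (hloc x).path (a' := dist b r) dist_nonneg
        (by rw [hrx]; linarith [@dist_nonneg _ _ r x]) le_rfl))
      have e1 : -dist b x - -dist b x = 0 := by ring
      have e2 : -dist b r - -dist b x = dist x r := by rw [dist_comm x r]; linarith
      rw [e1, e2] at h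
      refine Ω.congr (fun s hs => ?_) h
      have h1 : s ≤ dist x b := hs.2.trans (by linarith [dist_comm x b, dist_comm x r])
      have h2 : pt x y s = pt x b s := by
        rw [pt_left_add hr hs.1 hs.2, pt_left_add (z := b) (y := r) _ hs.1 hs.2]
        linarith [dist_comm b r, dist_comm b x, dist_comm x r]
      simp only [π]
      rw [h2, pt_comm hs.1 (by rwa [dist_comm])]
      congr 3
      ring
    · have h := Ω.shift (dist b r - dist x r) (Ω.mono (hloc y).path (a' := dist b r) dist_nonneg
        (by rw [hry]; linarith [@dist_nonneg _ _ r y]) le_rfl)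
      have e1 : dist b r - (dist b r - dist x r) = dist x r := by ring
      have e2 : dist b y - (dist b r - dist x r) = dist x y := by linarith
      rw [e1, e2] at h
      refine Ω.congr (fun s hs => ?_) h
      have h1 : s - dist x r ≤ dist r y := by linarith [hs.2]
      have h2 := pt_right_add hr (sub_nonneg.2 hs.1) h1
      have h3 := pt_right_add hry (sub_nonneg.2 hs.1) h1
      simp only [π]
      rw [show s = dist x r + (s - dist x r) by ring, h2, ← h3]
      congr 3
      ring
  · intro x y z hy hz h0 h
    exact (hloc x).chart.ne y z hy hz h0 (((hgerm x y hy).symm.trans h).trans (hgerm x z hz))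
  · intro x γ hγ
    obtain ⟨y, hy, h⟩ := (hloc x).chart.surj γ hγ
    exact ⟨y, hy, (hgerm x y hy).trans h⟩

end PathClass

/-! ### Lifting paths and symmetries along a developing map -/

namespace GeodesicTree

variable {T : Type*} [MetricSpace T] [GeodesicTree T]

theorem map_pt {T' : Type*} [MetricSpace T'] [GeodesicTree T'] {g : T → T'} (hg : Isometry g)
    {x z : T} {s : ℝ} (h0 : 0 ≤ s) (h : s ≤ dist x z) : g (pt x z s) = pt (g x) (g z) s :=
  eq_pt (by rw [hg.dist_eq, dist_left_pt h0 h]) (by rw [hg.dist_eq, hg.dist_eq, dist_pt_right h0 h])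

theorem pt_line {f : ℝ → T} (hf : Isometry f) {t s : ℝ} (h0 : 0 ≤ s) (h : s ≤ t) :
    pt (f 0) (f t) s = f s := by
  refine (eq_pt ?_ ?_).symm
  · rw [hf.dist_eq, Real.dist_eq, zero_sub, abs_neg, abs_of_nonneg h0]
  · rw [hf.dist_eq, hf.dist_eq, Real.dist_eq, Real.dist_eq, abs_sub_comm,
      abs_of_nonneg (by linarith), zero_sub, abs_neg, abs_of_nonneg (by linarith)]

end GeodesicTree

namespace PathClass

variable {V : Type} {Ω : PathClass V}

/-- A symmetry of a class of paths. -/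
def IsSymmetry (Ω : PathClass V) (Φ : V ≃ V) : Prop :=
  ∀ γ a b, Ω.P γ a b ↔ Ω.P (fun s => Φ (γ s)) a b

namespace Developing

variable {T : Type} [MetricSpace T] [GeodesicTree T] {π : T → V}

theorem isReducedPath (hπ : Ω.Developing π) (x y : T) :
    IsReducedPath (fun s => π (pt x y s)) 0 (dist x y) := by
  intro t h0 h1 h
  refine hπ.inj (pt x y t) x y (pt_ne_left h0 h1.le) (pt_ne_right h0.le h1)
    (gp_pt_eq_zero h0.le h1.le) (GermEq.congr_of_lt (lt_min h0 (sub_pos.2 h1)) ?_ ?_ h)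
  · intro s hs0 hs1
    have h2 := lt_min_iff.1 hs1
    have h3 := dist_left_pt h0.le h1.le
    simp only
    rw [pt_comm (x := x) hs0 (by rw [h3]; linarith), h3, pt_pt_left (by linarith) (by linarith) h1.le]
  · intro s hs0 hs1
    have h2 := lt_min_iff.1 hs1
    simp only
    rw [pt_pt_right h0.le hs0 (by linarith)]

/-- If the segments separated earlier, two distinct directions at the branch point would develop to
the same germ. -/
theorem le_gp_of_agree (hπ : Ω.Developing π) {x z z' : T} {r : ℝ} (hz : r ≤ dist x z)
    (hz' : r ≤ dist x z') (h : ∀ s, 0 ≤ s → s ≤ r → π (pt x z s) = π (pt x z' s)) :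
    r ≤ gp x z z' := by
  by_contra! hlt
  set c := gp x z z' with hc
  have hc0 : 0 ≤ c := gp_nonneg _ _ _
  have e : pt x z c = pt x z' c := pt_eq_of_le_gp hc0 le_rfl
  have d1 := dist_pt_right hc0 (hlt.le.trans hz)
  have d2 := dist_pt_right hc0 (hlt.le.trans hz')
  refine hπ.inj (pt x z c) z z' (pt_ne_right hc0 (hlt.trans_le hz))
    (e ▸ pt_ne_right hc0 (hlt.trans_le hz')) ?_ ⟨r - c, by linarith, fun s h0 h1 => ?_⟩
  · rw [← e] at d2
    have := dist_branch x z z'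
    rw [← hc, dist_comm z (pt x z c)] at this
    unfold gp
    linarith
  · simp only
    rw [pt_pt_right hc0 h0 (by linarith), e, pt_pt_right hc0 h0 (by linarith)]
    exact h _ (by linarith) (by linarith)

theorem lift_unique (hπ : Ω.Developing π) {x z z' : T} (hd : dist x z = dist x z')
    (h : ∀ s, 0 ≤ s → s ≤ dist x z → π (pt x z s) = π (pt x z' s)) : z = z' := by
  have h1 := hπ.le_gp_of_agree le_rfl hd.le h
  have h2 := pt_eq_of_le_gp dist_nonneg h1
  rwa [pt_dist, hd, pt_dist] at h2

/-- An open-closed argument on the length that can be lifted: completeness gives closedness, and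
surjectivity onto germs gives openness. -/
theorem exists_lift [CompleteSpace T] (hπ : Ω.Developing π) {x : T} {γ : ℝ → V} {l : ℝ}
    (hl : 0 ≤ l) (hP : Ω.P γ 0 l) (hred : IsReducedPath γ 0 l) (h0 : γ 0 = π x) :
    ∃ z, dist x z = l ∧ ∀ s, 0 ≤ s → s ≤ l → π (pt x z s) = γ s := by
  set I : Set ℝ := {t | 0 ≤ t ∧ t ≤ l ∧ ∃ z, dist x z = t ∧
    ∀ s, 0 ≤ s → s ≤ t → π (pt x z s) = γ s} with hI
  have hI0 : (0 : ℝ) ∈ I := by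
    refine ⟨le_rfl, hl, x, dist_self x, fun s hs0 hs1 => ?_⟩
    obtain rfl : s = 0 := le_antisymm hs1 hs0
    rw [pt_zero, h0]
  have hIb : BddAbove I := ⟨l, fun t ht => ht.2.1⟩
  set σ := sSup I with hσ
  have hσ0 : 0 ≤ σ := le_csSup hIb hI0
  have hσl : σ ≤ l := csSup_le ⟨0, hI0⟩ fun t ht => ht.2.1
  -- By uniqueness the lifts of increasing length are nested, so their endpoints form a Cauchy
  -- sequence.
  have hσI : σ ∈ I := by
    obtain ⟨u, humono, hulim, huI⟩ := exists_seq_tendsto_sSup ⟨0, hI0⟩ hIb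
    choose hu0 hul z hzd hzπ using huI
    have hz : ∀ m n, m ≤ n → z m = pt x (z n) (u m) := by
      intro m n hmn
      have hle : u m ≤ dist x (z n) := by rw [hzd]; exact humono hmn
      have hd := dist_left_pt (hu0 m) hle
      refine hπ.lift_unique (by rw [hd, hzd]) fun s hs0 hs1 => ?_
      rw [hzd] at hs1
      rw [pt_pt_left hs0 hs1 hle, hzπ m s hs0 hs1, hzπ n s hs0 (hs1.trans (humono hmn))]
    have hzdist : ∀ m n, m ≤ n → dist (z m) (z n) = u n - u m := by
      intro m n hmn
      rw [hz m n hmn, dist_pt_right (hu0 m) (by rw [hzd]; exact humono hmn), hzd]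
    have hcau : CauchySeq z := by
      have hu := hulim.cauchySeq
      rw [Metric.cauchySeq_iff'] at hu ⊢
      intro ε hε
      obtain ⟨N, hN⟩ := hu ε hε
      refine ⟨N, fun n hn => ?_⟩
      have := hN n hn
      rwa [Real.dist_eq, abs_of_nonneg (by linarith [humono hn]), ← hzdist N n hn, dist_comm] at this
    obtain ⟨w, hw⟩ := cauchySeq_tendsto_of_complete hcau
    have hwx : dist x w = σ :=
      tendsto_nhds_unique (tendsto_const_nhds.dist hw) (by simpa only [hzd] using hulim)
    have hwm : ∀ m, dist (z m) w = σ - u m := by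
      intro m
      refine tendsto_nhds_unique (tendsto_const_nhds.dist hw) ?_
      refine (hulim.sub_const (u m)).congr' ?_
      filter_upwards [Filter.eventually_ge_atTop m] with n hn
      exact (hzdist m n hn).symm
    have hwz : ∀ m, z m = pt x w (u m) := fun m => eq_pt (hzd m) (by rw [hwm, hwx])
    have hagree : ∀ s, 0 ≤ s → s < σ → π (pt x w s) = γ s := by
      intro s hs0 hs1
      obtain ⟨m, hm⟩ := (hulim.eventually (lt_mem_nhds hs1)).exists
      have hul : u m ≤ dist x w := hwx ▸ le_csSup hIb ⟨hu0 m, hul m, z m, hzd m, hzπ m⟩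
      rw [← hzπ m s hs0 hm.le, hwz m, pt_pt_left hs0 hm.le hul]
    refine ⟨hσ0, hσl, w, hwx, fun s hs0 hs1 => ?_⟩
    rcases hs1.lt_or_eq with h | rfl
    · exact hagree s hs0 h
    rcases hs0.lt_or_eq with h | h
    · have hw' := hπ.path x w
      rw [hwx] at hw'
      exact Ω.eq_right h hw' (Ω.mono hP le_rfl hσ0 hσl) fun s hs => hagree s hs.1 hs.2
    · rw [← h, pt_zero, h0]
  obtain ⟨-, -, z, hz, hzπ⟩ := hσI
  rcases hσl.lt_or_eq with hlt | heq
  · exfalso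
    have hP' : Ω.P (fun s => γ (σ + s)) 0 (l - σ) := by
      have h := Ω.shift σ (Ω.mono hP hσ0 hlt.le le_rfl)
      rw [sub_self] at h
      simpa only [add_comm] using h
    obtain ⟨y, hy, e, he, hye⟩ := hπ.surj z (fun s => γ (σ + s)) ⟨l - σ, by linarith, hP', by
      intro r hr0 hr1 h
      refine hred (σ + r) (by linarith) (by linarith) ?_
      simpa only [add_assoc, ← add_sub_assoc] using h, by
      have h1 := hzπ σ hσ0 le_rfl
      conv at h1 => enter [1, 1, 3]; rw [← hz]
      rw [pt_dist] at h1
      simp only [add_zero, h1]⟩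
    have hyd : 0 < dist z y := dist_pos.2 hy.symm
    -- If the new piece started back towards `x`, then `γ` would backtrack at time `σ`.
    have hgp : gp z x y = 0 := by
      by_contra hne
      have hpos : 0 < gp z x y := lt_of_le_of_ne (gp_nonneg _ _ _) (Ne.symm hne)
      have hσpos : 0 < σ := by
        rw [← hz, dist_comm]
        exact hpos.trans_le (gp_le_left _ _ _)
      refine hred σ hσpos hlt ⟨min e (gp z x y), lt_min he hpos, fun s hs0 hs1 => ?_⟩
      have h1 := hs1.trans (min_le_left _ _)
      have h2 := hs1.trans (min_le_right _ _)
      have h3 : s ≤ σ := by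
        rw [← hz, dist_comm]
        exact h2.trans (gp_le_left _ _ _)
      have h4 := hye s hs0 h1
      simp only at h4 ⊢
      rw [← h4, ← pt_eq_of_le_gp hs0 h2, pt_comm hs0 (by rwa [hz]), hz, hzπ _ (by linarith) (by linarith)]
    set r := min (min e (dist z y)) (l - σ) with hr
    have hr0 : 0 < r := lt_min (lt_min he hyd) (by linarith)
    have hre : r ≤ e := (min_le_left _ _).trans (min_le_left _ _)
    have hry : r ≤ dist z y := (min_le_left _ _).trans (min_le_right _ _)
    have hrl : r ≤ l - σ := min_le_right _ _
    have hxy : dist x y = dist x z + dist z y := by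
      unfold gp at hgp; linarith [dist_comm x z]
    have hmem : σ + r ∈ I := by
      refine ⟨by linarith, by linarith, pt x y (σ + r), dist_left_pt (by linarith) (by linarith), ?_⟩
      intro s hs0 hs1
      rw [pt_pt_left hs0 hs1 (by linarith)]
      rcases le_total s σ with h | h
      · rw [pt_left_add hxy hs0 (by linarith), hzπ s hs0 h]
      · have h5 := pt_right_add hxy (sub_nonneg.2 h) (by linarith : s - σ ≤ dist z y)
        rw [hz, add_sub_cancel] at h5
        have h4 := hye (s - σ) (by linarith) (by linarith)
        simp only [add_sub_cancel] at h4
        rw [h5, h4]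
    linarith [le_csSup hIb hmem]
  · rw [← heq]
    exact ⟨z, hz, hzπ⟩

theorem isometry_ext (hπ : Ω.Developing π) {g g' : T → T} (hg : Isometry g) (hg' : Isometry g')
    {x : T} (hx : g x = g' x) (h : ∀ z, π (g z) = π (g' z)) : g = g' := by
  funext z
  refine hπ.lift_unique (x := g x) (by rw [hg.dist_eq, hx, hg'.dist_eq]) fun s hs0 hs1 => ?_
  rw [hg.dist_eq] at hs1
  rw [← map_pt hg hs0 hs1, h, map_pt hg' hs0 hs1, hx]

variable [CompleteSpace T]

/-- Send `z` to the endpoint of the lift at `y` of the image under `Φ` of the developed segment from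
`x` to `z`. Since `Φ` is injective, segments agree for the same time before and after, so Gromov
products, and with them distances, are preserved. -/
theorem exists_isometry_aux (hπ : Ω.Developing π) {Φ : V ≃ V} (hΦ : Ω.IsSymmetry Φ) {x y : T}
    (hxy : Φ (π x) = π y) : ∃ g : T → T, Isometry g ∧ g x = y ∧ ∀ z, π (g z) = Φ (π z) := by
  have hex : ∀ z, ∃ w, dist y w = dist x z ∧
      ∀ s, 0 ≤ s → s ≤ dist x z → π (pt y w s) = Φ (π (pt x z s)) := by
    intro z
    refine hπ.exists_lift dist_nonneg ((hΦ _ _ _).1 (hπ.path x z)) ?_ (by rw [pt_zero, hxy])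
    rintro t h0 h1 ⟨e, he, h⟩
    exact hπ.isReducedPath x z t h0 h1 ⟨e, he, fun s hs0 hs1 => Φ.injective (h s hs0 hs1)⟩
  choose g hgd hgπ using hex
  have hgp : ∀ z z', gp y (g z) (g z') = gp x z z' := by
    intro z z'
    refine le_antisymm ?_ ?_
    · refine hπ.le_gp_of_agree ?_ ?_ fun s hs0 hs1 => ?_
      · rw [← hgd]; exact gp_le_left _ _ _
      · rw [← hgd]; exact gp_le_right _ _ _
      · apply Φ.injective
        rw [← hgπ z s hs0 (by rw [← hgd]; exact hs1.trans (gp_le_left _ _ _)),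
          ← hgπ z' s hs0 (by rw [← hgd]; exact hs1.trans (gp_le_right _ _ _)),
          pt_eq_of_le_gp hs0 hs1]
    · refine hπ.le_gp_of_agree ?_ ?_ fun s hs0 hs1 => ?_
      · rw [hgd]; exact gp_le_left _ _ _
      · rw [hgd]; exact gp_le_right _ _ _
      · rw [hgπ z s hs0 (hs1.trans (gp_le_left _ _ _)),
          hgπ z' s hs0 (hs1.trans (gp_le_right _ _ _)), pt_eq_of_le_gp hs0 hs1]
  refine ⟨g, Isometry.of_dist_eq fun z z' => ?_, ?_, fun z => ?_⟩
  · have := hgp z z'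
    unfold gp at this
    rw [hgd, hgd] at this
    linarith
  · have := hgd x
    rw [dist_self] at this
    exact (dist_eq_zero.1 this).symm
  · have := hgπ z (dist x z) dist_nonneg le_rfl
    rwa [pt_dist, ← hgd, pt_dist] at this

/-- Symmetries of the class of paths lift to isometries along a developing map. -/
theorem exists_isometry (hπ : Ω.Developing π) {Φ : V ≃ V} (hΦ : Ω.IsSymmetry Φ) {x y : T}
    (hxy : Φ (π x) = π y) : ∃ g : T ≃ᵢ T, g x = y ∧ ∀ z, π (g z) = Φ (π z) := by
  obtain ⟨g, hg, hgx, hgπ⟩ := hπ.exists_isometry_aux hΦ hxy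
  have hΦ' : Ω.IsSymmetry Φ.symm := fun γ a b => by
    rw [hΦ (fun s => Φ.symm (γ s))]
    simp
  obtain ⟨g', hg', hgx', hgπ'⟩ := hπ.exists_isometry_aux hΦ' (x := y) (y := x) (by simp [← hxy])
  have h1 : g' ∘ g = id := hπ.isometry_ext (hg'.comp hg) isometry_id (x := x) (by simp [hgx, hgx'])
    fun z => by simp [hgπ, hgπ']
  have h2 : g ∘ g' = id := hπ.isometry_ext (hg.comp hg') isometry_id (x := y) (by simp [hgx, hgx'])
    fun z => by simp [hgπ, hgπ']
  exact ⟨⟨⟨g, g', congrFun h1, congrFun h2⟩, hg⟩, hgx, hgπ⟩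

omit [CompleteSpace T] in
theorem line_ext (hπ : Ω.Developing π) {f f' : ℝ → T} (hf : Isometry f) (hf' : Isometry f')
    (h0 : f 0 = f' 0) (h : ∀ t, π (f t) = π (f' t)) : f = f' := by
  have key : ∀ f f' : ℝ → T, Isometry f → Isometry f' → f 0 = f' 0 → (∀ t, π (f t) = π (f' t)) →
      ∀ t, 0 ≤ t → f t = f' t := by
    intro f f' hf hf' h0 h t ht
    have hd : dist (f 0) (f t) = t := by
      rw [hf.dist_eq, Real.dist_eq, zero_sub, abs_neg, abs_of_nonneg ht]
    refine hπ.lift_unique (x := f 0) (by rw [hf.dist_eq, h0, hf'.dist_eq]) fun s hs0 hs1 => ?_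
    rw [hd] at hs1
    rw [pt_line hf hs0 hs1, h0, pt_line hf' hs0 hs1, h]
  funext t
  rcases le_total 0 t with ht | ht
  · exact key f f' hf hf' h0 h t ht
  · have hneg : Isometry fun t : ℝ => -t := isometry_neg
    have := key (fun t => f (-t)) (fun t => f' (-t)) (hf.comp hneg) (hf'.comp hneg) (by simpa using h0)
      (fun t => h _) (-t) (by linarith)
    simpa using this

/-- Lift the two rays separately. Reducedness at time `0` makes them leave `x` in different
directions, so together they form a geodesic line. -/
theorem exists_line (hπ : Ω.Developing π) {γ : ℝ → V} (hP : ∀ a b, a ≤ b → Ω.P γ a b)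
    (hred : ∀ a b, IsReducedPath γ a b) {x : T} (hx : γ 0 = π x) :
    ∃ f : ℝ → T, Isometry f ∧ f 0 = x ∧ ∀ t, π (f t) = γ t := by
  have hP' : ∀ b, 0 ≤ b → Ω.P (fun s => γ (-s)) 0 b := by
    intro b hb
    simpa using Ω.rev (hP (-b) 0 (by linarith))
  have hred' : ∀ b, IsReducedPath (fun s => γ (-s)) 0 b := by
    intro b t h0 h1 h
    refine hred (-t - 1) (-t + 1) (-t) (by linarith) (by linarith) ?_
    obtain ⟨e, he, h⟩ := h
    refine ⟨e, he, fun s hs0 hs1 => ?_⟩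
    have := h s hs0 hs1
    simp only [neg_sub, neg_add] at this ⊢
    rw [show -t - s = -t + -s by ring, show -t + s = s - t by ring, this]
  have hex1 : ∀ t, ∃ z, 0 ≤ t → dist x z = t ∧ ∀ s, 0 ≤ s → s ≤ t → π (pt x z s) = γ s := by
    intro t
    by_cases ht : 0 ≤ t
    · obtain ⟨z, hz⟩ := hπ.exists_lift ht (hP 0 t ht) (hred 0 t) hx
      exact ⟨z, fun _ => hz⟩
    · exact ⟨x, fun h => absurd h ht⟩
  have hex2 : ∀ t, ∃ z, 0 ≤ t → dist x z = t ∧ ∀ s, 0 ≤ s → s ≤ t → π (pt x z s) = γ (-s) := by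
    intro t
    by_cases ht : 0 ≤ t
    · obtain ⟨z, hz⟩ := hπ.exists_lift ht (hP' t ht) (hred' t) (by simpa using hx)
      exact ⟨z, fun _ => hz⟩
    · exact ⟨x, fun h => absurd h ht⟩
  choose p hp using hex1
  choose q hq using hex2
  have hdist : ∀ (γ : ℝ → V) (p : ℝ → T), (∀ t, 0 ≤ t → dist x (p t) = t ∧
      ∀ s, 0 ≤ s → s ≤ t → π (pt x (p t) s) = γ s) → ∀ s t, 0 ≤ s → s ≤ t →
      dist (p s) (p t) = t - s := by
    intro γ p hp s t hs hst
    have hle : s ≤ dist x (p t) := by rwa [(hp t (hs.trans hst)).1]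
    have : p s = pt x (p t) s := by
      refine hπ.lift_unique (x := x) (by rw [(hp s hs).1, dist_left_pt hs hle]) fun r hr0 hr1 => ?_
      rw [(hp s hs).1] at hr1
      rw [(hp s hs).2 r hr0 hr1, pt_pt_left hr0 hr1 hle, (hp t (hs.trans hst)).2 r hr0 (hr1.trans hst)]
    rw [this, dist_pt_right hs hle, (hp t (hs.trans hst)).1]
  have hcross : ∀ s t, 0 ≤ s → 0 ≤ t → dist (q s) (p t) = s + t := by
    intro s t hs ht
    have hgp : gp x (q s) (p t) = 0 := by
      by_contra hne
      have hpos : 0 < gp x (q s) (p t) := lt_of_le_of_ne (gp_nonneg _ _ _) (Ne.symm hne)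
      refine hred (-1) 1 0 (by norm_num) (by norm_num) ⟨_, hpos, fun r hr0 hr1 => ?_⟩
      have h1 := (hq s hs).2 r hr0 (hr1.trans ((gp_le_left _ _ _).trans (hq s hs).1.le))
      have h2 := (hp t ht).2 r hr0 (hr1.trans ((gp_le_right _ _ _).trans (hp t ht).1.le))
      rw [pt_eq_of_le_gp hr0 hr1, h2] at h1
      simpa using h1.symm
    unfold gp at hgp
    rw [(hq s hs).1, (hp t ht).1] at hgp
    linarith
  let f : ℝ → T := fun t => if 0 ≤ t then p t else q (-t)
  have hf1 : ∀ t, 0 ≤ t → f t = p t := fun t ht => if_pos ht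
  have hf2 : ∀ t, t < 0 → f t = q (-t) := fun t ht => if_neg (not_le.2 ht)
  have hle : ∀ s t, s ≤ t → dist (f s) (f t) = t - s := by
    intro s t hst
    rcases le_or_gt 0 s with h | h
    · rw [hf1 s h, hf1 t (h.trans hst), hdist γ p hp s t h hst]
    · rcases le_or_gt 0 t with h' | h'
      · rw [hf2 s h, hf1 t h', hcross _ _ (by linarith) h']; ring
      · rw [hf2 s h, hf2 t h', dist_comm, hdist (fun s => γ (-s)) q hq _ _ (by linarith) (by linarith)]
        ring
  refine ⟨f, Isometry.of_dist_eq fun s t => ?_, ?_, fun t => ?_⟩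
  · rw [Real.dist_eq]
    rcases le_total s t with h | h
    · rw [hle s t h, abs_sub_comm, abs_of_nonneg (by linarith)]
    · rw [dist_comm, hle t s h, abs_of_nonneg (by linarith)]
  · rw [hf1 0 le_rfl]
    exact (dist_eq_zero.1 (hp 0 le_rfl).1).symm
  · rcases le_or_gt 0 t with h | h
    · have := (hp t h).2 t h le_rfl
      conv at this => enter [1, 1, 3]; rw [← (hp t h).1]
      rw [hf1 t h, ← this, pt_dist]
    · have h' : 0 ≤ -t := by linarith
      have := (hq (-t) h').2 (-t) h' le_rfl
      conv at this => enter [1, 1, 3]; rw [← (hq (-t) h').1]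
      rw [pt_dist, neg_neg] at this
      rw [hf2 t h, this]

end Developing

end PathClass

/-! ### Labelled paths -/

section LabelledPaths

variable {A : Type}

/-- The velocity of a path with label `a`: unit speed in the height and in the coordinate `a`. -/
noncomputable def labelVec (a : A) : Option A → ℝ := by
  classical exact fun o => if o = none ∨ o = some a then 1 else 0

@[simp] theorem labelVec_none (a : A) : labelVec a none = 1 := by simp [labelVec]

@[simp] theorem labelVec_self (a : A) : labelVec a (some a) = 1 := by simp [labelVec]

theorem labelVec_of_ne {a a' : A} (h : a' ≠ a) : labelVec a (some a') = 0 := by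
  simp [labelVec, h]

/-- The path `γ` moves with a constant label on `[s, t]`. -/
def IsPure (γ : ℝ → Option A → ℝ) (s t : ℝ) : Prop :=
  ∃ (a : A) (ε : ℝ), (ε = 1 ∨ ε = -1) ∧
    ∀ u ∈ Set.Icc s t, γ u = γ s + (ε * (u - s)) • labelVec a

/-- Labelled paths: Lipschitz paths with countably many moving coordinates, whose label is locally
constant on a dense open set. -/
structure IsLabelledPath (γ : ℝ → Option A → ℝ) (a b : ℝ) : Prop where
  lip : ∀ s ∈ Set.Icc a b, ∀ t ∈ Set.Icc a b, ∀ o, |γ s o - γ t o| ≤ |s - t|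
  countable : ∃ C : Set (Option A), C.Countable ∧
    ∀ o ∉ C, ∀ s ∈ Set.Icc a b, ∀ t ∈ Set.Icc a b, γ s o = γ t o
  pure : ∀ s t, a ≤ s → s < t → t ≤ b → ∃ s' t', s ≤ s' ∧ s' < t' ∧ t' ≤ t ∧ IsPure γ s' t'

namespace IsLabelledPath

variable {γ γ' : ℝ → Option A → ℝ} {a b c : ℝ}

theorem point (γ : ℝ → Option A → ℝ) (a : ℝ) : IsLabelledPath γ a a := by
  refine ⟨fun s hs t ht o => ?_, ⟨∅, Set.countable_empty, fun o _ s hs t ht => ?_⟩,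
    fun s t h1 h2 h3 => absurd (h1.trans_lt h2) (not_lt.2 h3)⟩ <;>
  · rw [Set.Icc_self, Set.mem_singleton_iff] at hs ht
    subst hs; subst ht; simp

theorem congr (h : Set.EqOn γ γ' (Set.Icc a b)) (H : IsLabelledPath γ a b) :
    IsLabelledPath γ' a b := by
  refine ⟨fun s hs t ht o => ?_, ?_, fun s t h1 h2 h3 => ?_⟩
  · rw [← h hs, ← h ht]; exact H.lip s hs t ht o
  · obtain ⟨C, hC, h'⟩ := H.countable
    refine ⟨C, hC, fun o ho s hs t ht => ?_⟩
    rw [← h hs, ← h ht]; exact h' o ho s hs t ht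
  · obtain ⟨s', t', h4, h5, h6, x, ε, hε, h7⟩ := H.pure s t h1 h2 h3
    refine ⟨s', t', h4, h5, h6, x, ε, hε, fun u hu => ?_⟩
    rw [← h ⟨by linarith [hu.1], by linarith [hu.2]⟩, ← h ⟨by linarith, by linarith⟩]
    exact h7 u hu

theorem mono {a' b' : ℝ} (H : IsLabelledPath γ a b) (ha : a ≤ a') (hb : b' ≤ b) :
    IsLabelledPath γ a' b' := by
  have hsub : Set.Icc a' b' ⊆ Set.Icc a b := Set.Icc_subset_Icc ha hb
  obtain ⟨C, hC, h'⟩ := H.countable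
  exact ⟨fun s hs t ht o => H.lip s (hsub hs) t (hsub ht) o,
    ⟨C, hC, fun o ho s hs t ht => h' o ho s (hsub hs) t (hsub ht)⟩,
    fun s t h1 h2 h3 => H.pure s t (ha.trans h1) h2 (h3.trans hb)⟩

theorem shift (c : ℝ) (H : IsLabelledPath γ a b) :
    IsLabelledPath (fun s => γ (s + c)) (a - c) (b - c) := by
  have hsub : ∀ s ∈ Set.Icc (a - c) (b - c), s + c ∈ Set.Icc a b := fun s hs =>
    ⟨by linarith [hs.1], by linarith [hs.2]⟩
  refine ⟨fun s hs t ht o => ?_, ?_, fun s t h1 h2 h3 => ?_⟩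
  · simpa using H.lip _ (hsub s hs) _ (hsub t ht) o
  · obtain ⟨C, hC, h'⟩ := H.countable
    exact ⟨C, hC, fun o ho s hs t ht => h' o ho _ (hsub s hs) _ (hsub t ht)⟩
  · obtain ⟨s', t', h4, h5, h6, x, ε, hε, h7⟩ := H.pure (s + c) (t + c) (by linarith) (by linarith)
      (by linarith)
    refine ⟨s' - c, t' - c, by linarith, by linarith, by linarith, x, ε, hε, fun u hu => ?_⟩
    have := h7 (u + c) ⟨by linarith [hu.1], by linarith [hu.2]⟩
    simp only [this, sub_add_cancel]
    rw [show u + c - s' = u - (s' - c) by ring]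

theorem rev (H : IsLabelledPath γ a b) : IsLabelledPath (fun s => γ (-s)) (-b) (-a) := by
  have hsub : ∀ s ∈ Set.Icc (-b) (-a), -s ∈ Set.Icc a b := fun s hs =>
    ⟨by linarith [hs.2], by linarith [hs.1]⟩
  refine ⟨fun s hs t ht o => ?_, ?_, fun s t h1 h2 h3 => ?_⟩
  · refine (H.lip _ (hsub s hs) _ (hsub t ht) o).trans_eq ?_
    rw [abs_sub_comm]; congr 1; ring
  · obtain ⟨C, hC, h'⟩ := H.countable
    exact ⟨C, hC, fun o ho s hs t ht => h' o ho _ (hsub s hs) _ (hsub t ht)⟩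
  · obtain ⟨s', t', h4, h5, h6, x, ε, hε, h7⟩ := H.pure (-t) (-s) (by linarith) (by linarith)
      (by linarith)
    refine ⟨-t', -s', by linarith, by linarith, by linarith, x, -ε, ?_, fun u hu => ?_⟩
    · rcases hε with rfl | rfl <;> simp
    · have e1 := h7 (-u) ⟨by linarith [hu.2], by linarith [hu.1]⟩
      have e2 := h7 t' ⟨h5.le, le_rfl⟩
      simp only [neg_neg]
      rw [e1, e2, add_assoc, ← add_smul]
      congr 2; ring

theorem concat (hab : a ≤ b) (hbc : b ≤ c) (H : IsLabelledPath γ a b) (H' : IsLabelledPath γ b c) :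
    IsLabelledPath γ a c := by
  refine ⟨?_, ?_, fun s t h1 h2 h3 => ?_⟩
  · have key : ∀ s ∈ Set.Icc a c, ∀ t ∈ Set.Icc a c, s ≤ t → ∀ o, |γ s o - γ t o| ≤ |s - t| := by
      intro s hs t ht hst o
      rcases le_total t b with h | h
      · exact H.lip s ⟨hs.1, hst.trans h⟩ t ⟨ht.1, h⟩ o
      rcases le_total b s with h' | h'
      · exact H'.lip s ⟨h', hs.2⟩ t ⟨h, ht.2⟩ o
      have e1 := H.lip s ⟨hs.1, h'⟩ b ⟨hab, le_rfl⟩ o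
      have e2 := H'.lip b ⟨le_rfl, hbc⟩ t ⟨h, ht.2⟩ o
      rw [abs_of_nonpos (by linarith : s - b ≤ 0)] at e1
      rw [abs_of_nonpos (by linarith : b - t ≤ 0)] at e2
      rw [abs_of_nonpos (by linarith : s - t ≤ 0)]
      have := abs_sub_le (γ s o) (γ b o) (γ t o)
      linarith
    intro s hs t ht o
    rcases le_total s t with h | h
    · exact key s hs t ht h o
    · rw [abs_sub_comm, abs_sub_comm s]; exact key t ht s hs h o
  · obtain ⟨C, hC, h⟩ := H.countable
    obtain ⟨C', hC', h'⟩ := H'.countable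
    refine ⟨C ∪ C', hC.union hC', fun o ho => ?_⟩
    have key : ∀ s ∈ Set.Icc a c, γ s o = γ b o := by
      intro s hs
      rcases le_total s b with hsb | hsb
      · exact h o (fun h => ho (Or.inl h)) s ⟨hs.1, hsb⟩ b ⟨hab, le_rfl⟩
      · exact h' o (fun h => ho (Or.inr h)) s ⟨hsb, hs.2⟩ b ⟨le_rfl, hbc⟩
    intro s hs t ht
    rw [key s hs, key t ht]
  · rcases lt_or_ge s b with h | h
    · obtain ⟨s', t', h4, h5, h6, h7⟩ := H.pure s (min t b) h1 (lt_min h2 h) (min_le_right _ _)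
      exact ⟨s', t', h4, h5, h6.trans (min_le_left _ _), h7⟩
    · exact H'.pure s t h h2 h3

theorem eq_right (hab : a < b) (H : IsLabelledPath γ a b) (H' : IsLabelledPath γ' a b)
    (h : Set.EqOn γ γ' (Set.Ico a b)) : γ b = γ' b := by
  funext o
  by_contra hne
  have hpos : 0 < |γ b o - γ' b o| := abs_pos.2 (sub_ne_zero.2 hne)
  set e := |γ b o - γ' b o| with he
  set s := max a (b - e / 3) with hs
  have hsb : s < b := max_lt hab (by linarith)
  have has : a ≤ s := le_max_left _ _
  have hse : b - e / 3 ≤ s := le_max_right _ _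
  have e1 := H.lip b ⟨hab.le, le_rfl⟩ s ⟨has, hsb.le⟩ o
  have e2 := H'.lip s ⟨has, hsb.le⟩ b ⟨hab.le, le_rfl⟩ o
  rw [abs_of_nonneg (by linarith : 0 ≤ b - s)] at e1
  rw [abs_of_nonpos (by linarith : s - b ≤ 0), ← h ⟨has, hsb⟩] at e2
  have := abs_sub_le (γ b o) (γ s o) (γ' b o)
  linarith

/-- Each coordinate is Lipschitz and so has a limit at `b`. A sequence increasing to `b` shows that
the moving coordinates remain countable, and purity is found before `b`. -/
theorem extend (hab : a < b) (H : ∀ c, a ≤ c → c < b → IsLabelledPath γ a c) :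
    ∃ v, IsLabelledPath (Function.update γ b v) a b := by
  have hlip : ∀ o, ∃ g : ℝ → ℝ, LipschitzWith 1 g ∧ Set.EqOn (fun s => γ s o) g (Set.Ico a b) := by
    intro o
    refine LipschitzOnWith.extend_real (LipschitzOnWith.of_dist_le_mul fun s hs t ht => ?_)
    rw [Real.dist_eq, Real.dist_eq, NNReal.coe_one, one_mul]
    exact (H (max s t) (hs.1.trans (le_max_left _ _)) (max_lt hs.2 ht.2)).lip s
      ⟨hs.1, le_max_left _ _⟩ t ⟨ht.1, le_max_right _ _⟩ o
  choose g hg hγg using hlip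
  have hne : ∀ s, s < b → Function.update γ b (fun o => g o b) s = γ s := fun s hs =>
    Function.update_of_ne hs.ne _ _
  have heq : ∀ s ∈ Set.Icc a b, ∀ o, Function.update γ b (fun o => g o b) s o = g o s := by
    intro s hs o
    rcases hs.2.lt_or_eq with h | rfl
    · rw [hne s h]; exact hγg o ⟨hs.1, h⟩
    · rw [Function.update_self]
  refine ⟨fun o => g o b, fun s hs t ht o => ?_, ?_, fun s t h1 h2 h3 => ?_⟩
  · rw [heq s hs, heq t ht]
    have := (hg o).dist_le_mul s t
    rwa [Real.dist_eq, Real.dist_eq, NNReal.coe_one, one_mul] at this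
  · obtain ⟨u, -, hu, hulim⟩ := exists_seq_strictMono_tendsto' hab
    choose C hC hC' using fun n => (H (u n) (hu n).1.le (hu n).2).countable
    refine ⟨⋃ n, C n, Set.countable_iUnion hC, fun o ho => ?_⟩
    have hconst : ∀ s ∈ Set.Ico a b, g o s = g o a := by
      intro s hs
      obtain ⟨n, hn⟩ := (hulim.eventually (lt_mem_nhds hs.2)).exists
      have := hC' n o (fun h => ho (Set.mem_iUnion.2 ⟨n, h⟩)) s ⟨hs.1, hn.le⟩ a
        ⟨le_rfl, (hu n).1.le⟩
      rwa [show γ s o = g o s from hγg o hs, show γ a o = g o a from hγg o ⟨le_rfl, hab⟩] at this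
    have hb : g o b = g o a := by
      refine tendsto_nhds_unique (((hg o).continuous.tendsto b).comp hulim) ?_
      refine tendsto_const_nhds.congr fun n => ?_
      exact (hconst _ ⟨(hu n).1.le, (hu n).2⟩).symm
    have key : ∀ s ∈ Set.Icc a b, g o s = g o a := by
      intro s hs
      rcases hs.2.lt_or_eq with h | rfl
      · exact hconst s ⟨hs.1, h⟩
      · exact hb
    intro s hs t ht
    rw [heq s hs, heq t ht, key s hs, key t ht]
  · obtain ⟨s', t', h4, h5, h6, x, ε, hε, h7⟩ := (H ((s + t) / 2) (by linarith) (by linarith)).pure s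
      ((s + t) / 2) h1 (by linarith) le_rfl
    refine ⟨s', t', h4, h5, by linarith, x, ε, hε, fun u hu => ?_⟩
    rw [hne u (by linarith [hu.2]), hne s' (by linarith)]
    exact h7 u hu

/-- Relabelling and translation preserve labelled paths. -/
theorem map (H : IsLabelledPath γ a b) (w : Option A → ℝ) (σ : Equiv.Perm A) :
    IsLabelledPath (fun s o => w o + γ s (o.map σ)) a b := by
  refine ⟨fun s hs t ht o => ?_, ?_, fun s t h1 h2 h3 => ?_⟩
  · simpa using H.lip s hs t ht (o.map σ)
  · obtain ⟨C, hC, h⟩ := H.countable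
    refine ⟨(Option.map σ) ⁻¹' C, hC.preimage (Option.map_injective σ.injective), ?_⟩
    intro o ho s hs t ht
    rw [h (o.map σ) ho s hs t ht]
  · obtain ⟨s', t', h4, h5, h6, x, ε, hε, h7⟩ := H.pure s t h1 h2 h3
    refine ⟨s', t', h4, h5, h6, σ.symm x, ε, hε, fun u hu => ?_⟩
    funext o
    have hv : labelVec x (o.map σ) = labelVec (σ.symm x) o := by
      rcases o with _ | y
      · simp
      · by_cases hy : y = σ.symm x
        · subst hy; simp
        · rw [labelVec_of_ne hy, Option.map_some, labelVec_of_ne]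
          rintro rfl; simp at hy
    have h8 := congrFun (h7 u hu) (o.map σ)
    simp only [Pi.add_apply, Pi.smul_apply] at h8 ⊢
    rw [h8, hv, add_assoc]

end IsLabelledPath

/-- The class of labelled paths. -/
def labelledPaths (A : Type) : PathClass (Option A → ℝ) where
  P := IsLabelledPath
  point := IsLabelledPath.point
  congr := IsLabelledPath.congr
  mono H h1 _ h2 := H.mono h1 h2
  shift := IsLabelledPath.shift
  rev := IsLabelledPath.rev
  concat := IsLabelledPath.concat
  extend := IsLabelledPath.extend
  eq_right := IsLabelledPath.eq_right

/-- Translation by `w` composed with the relabelling by `σ`. -/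
def relabel (w : Option A → ℝ) (σ : Equiv.Perm A) : (Option A → ℝ) ≃ (Option A → ℝ) where
  toFun v o := w o + v (o.map σ)
  invFun v o := -w (o.map σ.symm) + v (o.map σ.symm)
  left_inv v := by funext o; simp
  right_inv v := by funext o; simp

theorem relabel_apply (w : Option A → ℝ) (σ : Equiv.Perm A) (v : Option A → ℝ) (o : Option A) :
    relabel w σ v o = w o + v (o.map σ) := rfl

theorem relabel_isSymmetry (w : Option A → ℝ) (σ : Equiv.Perm A) :
    (labelledPaths A).IsSymmetry (relabel w σ) := by
  intro γ a b
  refine ⟨fun H => H.map w σ, fun H => ?_⟩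
  have h := IsLabelledPath.map H (fun o => -w (o.map σ.symm)) σ.symm
  refine h.congr fun s _ => ?_
  exact (relabel w σ).symm_apply_apply (γ s)

theorem isLabelledPath_line (v : Option A → ℝ) (x : A) (a b : ℝ) :
    IsLabelledPath (fun t => v + t • labelVec x) a b := by
  refine ⟨fun s _ t _ o => ?_, ⟨{none, some x}, Set.toFinite _ |>.countable, fun o ho s _ t _ => ?_⟩,
    fun s t h1 h2 h3 => ⟨s, t, le_rfl, h2, le_rfl, x, 1, Or.inl rfl, fun u _ => ?_⟩⟩
  · have : (v + s • labelVec x) o - (v + t • labelVec x) o = (s - t) * labelVec x o := by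
      simp; ring
    rw [this, abs_mul]
    refine mul_le_of_le_one_right (abs_nonneg _) ?_
    unfold labelVec; split_ifs <;> simp
  · rcases o with _ | y
    · simp at ho
    · simp only [Set.mem_insert_iff, Set.mem_singleton_iff, not_or] at ho
      have : y ≠ x := fun h => ho.2 (by rw [h])
      simp [labelVec_of_ne this]
  · simp only [one_mul, add_assoc, ← add_smul, add_sub_cancel]

theorem isReducedPath_line (v : Option A → ℝ) (x : A) (a b : ℝ) :
    IsReducedPath (fun t => v + t • labelVec x) a b := by
  rintro t - - ⟨δ, hδ, h⟩
  have := congrFun (h δ hδ.le le_rfl) none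
  simp at this
  linarith

/-- For the upper bound a germ is encoded by a length, an enumeration of a countable set containing
the moving coordinates, and the values of these at rational times. The lower bound comes from the
straight lines of different labels. -/
theorem mk_germs_labelledPaths (hA : #A = 𝔠) (v : Option A → ℝ) :
    #((labelledPaths A).Germs v) = 𝔠 := by
  refine le_antisymm ?_ ?_
  · have hex : ∀ γ : {γ : ℝ → Option A → ℝ // (labelledPaths A).IsGerm v γ},
        ∃ (l : ℝ) (f : ℕ → Option A), 0 < l ∧ IsLabelledPath γ.1 0 l ∧ γ.1 0 = v ∧
          ∀ o ∉ Set.range f, ∀ s ∈ Set.Icc 0 l, ∀ t ∈ Set.Icc 0 l, γ.1 s o = γ.1 t o := by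
      rintro ⟨γ, l, hl, hP, -, h0⟩
      obtain ⟨C, hC, h⟩ := hP.countable
      obtain ⟨f, hf⟩ := (hC.union (Set.countable_singleton none)).exists_eq_range ⟨none, Or.inr rfl⟩
      exact ⟨l, f, hl, hP, h0, fun o ho => h o fun h' => ho (hf ▸ Or.inl h')⟩
    choose l f hl hP h0 hf using hex
    let code : (labelledPaths A).Germs v → ℝ × (ℕ → Option A) × (ℕ × ℚ → ℝ) := fun g =>
      (l g.out, f g.out, fun p => g.out.1 p.2 (f g.out p.1))
    have hinj : Function.Injective code := by
      intro g g' h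
      rw [← Quotient.out_eq g, ← Quotient.out_eq g']
      refine Quotient.sound ?_
      change GermEq g.out.1 g'.out.1
      simp only [code, Prod.mk.injEq] at h
      obtain ⟨hl', hf', hv⟩ := h
      have hP' := hP g'.out
      have hfix' := hf g'.out
      rw [← hl', ← hf'] at hfix'
      rw [← hl'] at hP'
      refine ⟨l g.out, hl _, fun s hs0 hs1 => funext fun o => ?_⟩
      have hs : s ∈ Set.Icc 0 (l g.out) := ⟨hs0, hs1⟩
      have h0' : (0 : ℝ) ∈ Set.Icc 0 (l g.out) := ⟨le_rfl, (hl _).le⟩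
      by_cases ho : o ∈ Set.range (f g.out)
      · obtain ⟨n, rfl⟩ := ho
        by_contra hne
        set o := f g.out n with ho
        have hpos : 0 < |g.out.1 s o - g'.out.1 s o| := abs_pos.2 (sub_ne_zero.2 hne)
        set e := |g.out.1 s o - g'.out.1 s o| with he
        have hlt : max 0 (s - e / 3) < min (l g.out) (s + e / 3) :=
          max_lt (lt_min (hl _) (by linarith)) (lt_min (by linarith) (by linarith))
        obtain ⟨q, hq1, hq2⟩ := exists_rat_btwn hlt
        obtain ⟨hq3, hq4⟩ := max_lt_iff.1 hq1
        obtain ⟨hq5, hq6⟩ := lt_min_iff.1 hq2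
        have hq : (q : ℝ) ∈ Set.Icc 0 (l g.out) := ⟨hq3.le, hq5.le⟩
        have e0 : g.out.1 q o = g'.out.1 q o := by
          have := congrFun hv (n, q)
          simp only [← hf'] at this
          exact this
        have e1 := (hP g.out).lip s hs q hq o
        have e2 := hP'.lip q hq s hs o
        have e3 : |s - q| ≤ e / 3 := abs_le.2 ⟨by linarith, by linarith⟩
        have := abs_sub_le (g.out.1 s o) (g.out.1 q o) (g'.out.1 s o)
        rw [e0] at this e1
        rw [abs_sub_comm (q : ℝ) s] at e2
        linarith
      · rw [hf _ o ho s hs 0 h0', hfix' o ho s hs 0 h0', h0, h0]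
    refine (Cardinal.mk_le_of_injective hinj).trans ?_
    have hO : #(Option A) = 𝔠 := by
      rw [mk_option, hA]; exact add_one_eq aleph0_le_continuum
    simp [hO, mk_prod, Cardinal.mk_real]
  · rw [← hA]
    have hg : ∀ x : A, (labelledPaths A).IsGerm v (fun t => v + t • labelVec x) := fun x =>
      ⟨1, one_pos, isLabelledPath_line v x 0 1, isReducedPath_line v x 0 1, by simp⟩
    refine Cardinal.mk_le_of_injective (f := fun x => Quotient.mk _ ⟨_, hg x⟩) fun x y h => ?_
    obtain ⟨δ, hδ, h⟩ := Quotient.exact h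
    have := congrFun (h δ hδ.le le_rfl) (some x)
    by_contra hne
    simp [labelVec_of_ne hne] at this
    linarith

end LabelledPaths

/-! ### Labelled trees -/

/-- A height function on `T`, a group of isometries of `T` parametrised by pairs of a translation
length and an element of `R`, and a family of lines labelled by `A` on which `R` acts. Isometries
translate heights via `c : R →+ ℝ` and permute the labels. -/
structure LabelledTree (T : Type) [MetricSpace T] (R : Type) [AddCommGroup R] (c : R →+ ℝ)
    (A : Type) [AddAction R A] where
  h : T → ℝ
  h_le : ∀ x y, |h x - h y| ≤ dist x y
  Sym : R → (T ≃ᵢ T) → Prop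
  sym_one : Sym 0 1
  sym_mul : ∀ {r r' g g'}, Sym r g → Sym r' g' → Sym (r + r') (g * g')
  sym_inv : ∀ {r g}, Sym r g → Sym (-r) g⁻¹
  h_sym : ∀ {r g}, Sym r g → ∀ x, h (g x) = h x + c r
  exists_sym : ∀ {r x y}, c r = h y - h x → ∃ g, Sym r g ∧ g x = y
  free : ∀ {g x}, Sym 0 g → g x = x → g = 1
  line : A → T → ℝ → T
  line_isometry : ∀ a x, Isometry (line a x)
  line_zero : ∀ a x, line a x 0 = x
  h_line : ∀ a x u, h (line a x u) = h x + u
  line_line : ∀ a x s u, line a (line a x s) u = line a x (s + u)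
  sym_line : ∀ {r g}, Sym r g → ∀ a x u, g (line a x u) = line (r +ᵥ a) (g x) u
  line_inj : ∀ {a a' x}, line a x = line a' x → a = a'
  eq_line : ∀ f : ℝ → T, Isometry f → Dense {s | ∃ r g, Sym r g ∧ ∀ t, g (f t) = f (t + s)} →
    ∃ a x, Set.range f = Set.range (line a x)

section

variable {A : Type}

/-- A path which is pure on an interval, up to a dense set of symmetries, is a labelled line. -/
theorem eq_labelled_line_of_dense {γ : ℝ → Option A → ℝ} {p q : ℝ} (hpq : p < q)
    (hpure : IsPure γ p q)
    (h : Dense {s | ∃ (w : Option A → ℝ) (σ : Equiv.Perm A), ∀ t, γ (t + s) = relabel w σ (γ t)}) :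
    ∃ (a : A) (ε : ℝ), (ε = 1 ∨ ε = -1) ∧ ∀ t, γ t = γ 0 + (ε * t) • labelVec a := by
  have hloc : ∀ t, ∃ (a : A) (ε : ℝ), (ε = 1 ∨ ε = -1) ∧ ∃ δ > 0, ∀ u, |u - t| < δ →
      γ u = γ t + (ε * (u - t)) • labelVec a := by
    intro t
    -- The shift `s` is chosen so that `t - s` falls into the pure interval `(p, q)`; the symmetry
    -- carries purity there to a neighbourhood of `t`.
    obtain ⟨s, ⟨hs1, hs2⟩, w, σ, hs⟩ := h.inter_open_nonempty (Set.Ioo (t - q) (t - p)) isOpen_Ioo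
      ⟨t - (p + q) / 2, by constructor <;> linarith⟩ |>.imp fun s hs => hs
    obtain ⟨a, ε, hε, hu⟩ := hpure
    refine ⟨σ.symm a, ε, hε, min (t - s - p) (q - (t - s)), lt_min (by linarith) (by linarith), ?_⟩
    intro u hut
    obtain ⟨h1, h2⟩ := lt_min_iff.1 hut
    have h3 := abs_lt.1 h1
    have h4 := abs_lt.1 h2
    have e1 := hu (u - s) ⟨by linarith, by linarith⟩
    have e2 := hu (t - s) ⟨by linarith, by linarith⟩
    have f1 := hs (u - s)
    have f2 := hs (t - s)
    rw [sub_add_cancel] at f1 f2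
    funext o
    have hv : labelVec a (o.map σ) = labelVec (σ.symm a) o := by
      rcases o with _ | y
      · simp
      · by_cases hy : y = σ.symm a
        · subst hy; simp
        · rw [labelVec_of_ne hy, Option.map_some, labelVec_of_ne]
          rintro rfl; simp at hy
    rw [f1, f2]
    simp only [relabel_apply, Pi.add_apply, Pi.smul_apply, smul_eq_mul]
    rw [e1, e2]
    simp only [Pi.add_apply, Pi.smul_apply, smul_eq_mul, hv]
    ring
  choose a ε hε δ hδ hu using hloc
  have huniq : ∀ t u, |u - t| < δ t → a u = a t ∧ ε u = ε t := by
    intro t u hut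
    -- A point `v` beyond `u`, close to both `t` and `u`, lets the two local descriptions be
    -- compared: the height determines the sign and the coordinate `a u` the label.
    obtain ⟨v, huv, hvt, hvu⟩ : ∃ v, u < v ∧ |v - t| < δ t ∧ |v - u| < δ u := by
      have h1 := abs_lt.1 hut
      set e := min (t + δ t - u) (δ u) with he
      have he0 : 0 < e := lt_min (by linarith) (hδ u)
      have he1 : e ≤ t + δ t - u := min_le_left _ _
      have he2 : e ≤ δ u := min_le_right _ _
      exact ⟨u + e / 2, by linarith, abs_lt.2 ⟨by linarith, by linarith⟩,
        abs_lt.2 ⟨by linarith, by linarith⟩⟩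
    have e1 := hu t u hut
    have e2 := hu t v hvt
    have e3 := hu u v hvu
    have key : (ε u * (v - u)) • labelVec (a u) = (ε t * (v - u)) • labelVec (a t) := by
      have : γ v - γ u = (ε t * (v - u)) • labelVec (a t) := by
        rw [e1, e2, add_sub_add_left_eq_sub, ← sub_smul]; congr 1; ring
      rw [← this, e3, add_sub_cancel_left]
    have hvu' : v - u ≠ 0 := by linarith
    have hεeq : ε u = ε t := by
      have := congrFun key none
      simpa [hvu'] using this
    refine ⟨?_, hεeq⟩
    by_contra hne
    have := congrFun key (some (a u))
    simp only [Pi.smul_apply, smul_eq_mul, labelVec_self, labelVec_of_ne hne, mul_one, mul_zero,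
      mul_eq_zero, hvu', or_false] at this
    rcases hε u with h | h <;> rw [h] at this <;> norm_num at this
  have hconst : ∀ t, a t = a 0 ∧ ε t = ε 0 := by
    have hlc : IsLocallyConstant fun t => (a t, ε t) := by
      rw [IsLocallyConstant.iff_eventually_eq]
      intro t
      filter_upwards [Metric.ball_mem_nhds t (hδ t)] with u hu'
      rw [Metric.mem_ball, Real.dist_eq] at hu'
      obtain ⟨h1, h2⟩ := huniq t u hu'
      rw [h1, h2]
    intro t
    have := hlc.apply_eq_of_preconnectedSpace t 0
    exact ⟨congrArg Prod.fst this, congrArg Prod.snd this⟩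
  refine ⟨a 0, ε 0, hε 0, fun t => ?_⟩
  have hlc : IsLocallyConstant fun t => γ t - (ε 0 * t) • labelVec (a 0) := by
    rw [IsLocallyConstant.iff_eventually_eq]
    intro t
    filter_upwards [Metric.ball_mem_nhds t (hδ t)] with u hu'
    rw [Metric.mem_ball, Real.dist_eq] at hu'
    rw [hu t u hu', (hconst t).1, (hconst t).2, add_sub_assoc, ← sub_smul,
      sub_eq_add_neg (γ t), ← neg_smul]
    congr 2; ring
  have := hlc.apply_eq_of_preconnectedSpace t 0
  simp only [mul_zero, zero_smul, sub_zero] at this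
  rw [← this, sub_add_cancel]

end

/-- The universal real tree carries a labelled tree structure for every set of labels of the size of
the continuum. -/
theorem IsUniversalRealTree.nonempty_labelledTree {T : Type} [MetricSpace T]
    (hT : IsUniversalRealTree T 𝔠) {R : Type} [AddCommGroup R] (c : R →+ ℝ) {A : Type}
    [AddAction R A] (hA : #A = 𝔠) : Nonempty (LabelledTree T R c A) := by
  have := hT.geodesicTree
  have := hT.complete
  obtain ⟨b⟩ := hT.nonempty
  obtain ⟨π, hπ⟩ := PathClass.exists_developing (Ω := labelledPaths A) hT.valence
    (mk_germs_labelledPaths hA) (by exact_mod_cast nat_lt_continuum 1) b 0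
  -- the relabelling permutation
  let τ : R → Equiv.Perm A := fun r => AddAction.toPerm (-r)
  have hτ : ∀ r r' (o : Option A), (o.map (τ r)).map (τ r') = o.map (τ (r + r')) := by
    intro r r' o
    rcases o with _ | a
    · rfl
    · simp only [Option.map_some, τ, AddAction.toPerm_apply, vadd_vadd, neg_add, add_comm (-r)]
  have hτ0 : ∀ o : Option A, o.map (τ 0) = o := by
    intro o
    rcases o with _ | a <;> simp [τ]
  -- The sign in `τ` is there because relabelling acts by precomposition: pulling back along `-r`
  -- turns the label `a` into `r +ᵥ a`.
  have hτv : ∀ r a o, labelVec a (o.map (τ r)) = labelVec (r +ᵥ a) o := by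
    intro r a o
    rcases o with _ | y
    · simp
    · by_cases hy : y = r +ᵥ a
      · subst hy; simp [τ]
      · rw [labelVec_of_ne hy, Option.map_some, labelVec_of_ne]
        rintro rfl; simp [τ] at hy
  have hline : ∀ a x, ∃ f : ℝ → T, Isometry f ∧ f 0 = x ∧ ∀ t, π (f t) = π x + t • labelVec a := by
    intro a x
    exact hπ.exists_line (γ := fun t => π x + t • labelVec a)
      (fun p q _ => isLabelledPath_line (π x) a p q) (fun p q => isReducedPath_line (π x) a p q)
      (by simp)
  choose line hl_iso hl_zero hl_π using hline
  have hl_eq : ∀ a x (f : ℝ → T), Isometry f → f 0 = x → (∀ t, π (f t) = π x + t • labelVec a) →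
      f = line a x := fun a x f hf h0 h =>
    hπ.line_ext hf (hl_iso a x) (h0.trans (hl_zero a x).symm) fun t => by rw [h, hl_π]
  have hlip : ∀ x y o, |π x o - π y o| ≤ dist x y := by
    intro x y o
    have := (hπ.path x y).lip 0 ⟨le_rfl, dist_nonneg⟩ (dist x y) ⟨dist_nonneg, le_rfl⟩ o
    rwa [pt_zero, pt_dist, zero_sub, abs_neg, abs_of_nonneg dist_nonneg] at this
  refine ⟨{
    h := fun x => π x none
    h_le := fun x y => hlip x y none
    -- Only the height component of `w` is tied to `r`. The freedom in the other components gives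
    -- transitivity on points with the right height difference, while for `r = 0` a fixed point
    -- forces `w = 0` and hence freeness.
    Sym := fun r g => ∃ w, w none = c r ∧ ∀ x, π (g x) = relabel w (τ r) (π x)
    sym_one := ⟨0, by simp, fun x => by funext o; simp [relabel_apply, hτ0]⟩
    sym_mul := ?_
    sym_inv := ?_
    h_sym := ?_
    exists_sym := ?_
    free := ?_
    line := line
    line_isometry := hl_iso
    line_zero := hl_zero
    h_line := fun a x u => by rw [hl_π]; simp
    line_line := ?_
    sym_line := ?_
    line_inj := ?_
    eq_line := ?_ }⟩
  · rintro r r' g g' ⟨w, hw, hg⟩ ⟨w', hw', hg'⟩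
    refine ⟨fun o => w o + w' (o.map (τ r)), by simp [hw, hw'], fun x => ?_⟩
    funext o
    simp only [IsometryEquiv.mul_apply, hg, hg', relabel_apply, hτ, add_assoc]
  · rintro r g ⟨w, hw, hg⟩
    refine ⟨fun o => -w (o.map (τ (-r))), by simp [hw], fun x => ?_⟩
    funext o
    have h1 := congrFun (hg (g⁻¹ x)) (o.map (τ (-r)))
    rw [IsometryEquiv.apply_inv_self, relabel_apply, hτ, neg_add_cancel, hτ0] at h1
    rw [relabel_apply, h1]
    ring
  · rintro r g ⟨w, hw, hg⟩ x
    rw [hg, relabel_apply, hw, Option.map_none, add_comm]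
  · rintro r x y hr
    set w : Option A → ℝ := fun o => π y o - π x (o.map (τ r)) with hwdef
    obtain ⟨g, hgx, hg⟩ := hπ.exists_isometry (relabel_isSymmetry w (τ r)) (x := x) (y := y) (by
      funext o; simp [relabel_apply, hwdef])
    exact ⟨g, ⟨w, by simp [hwdef, hr], hg⟩, hgx⟩
  · rintro g x ⟨w, hw, hg⟩ hx
    have hw0 : ∀ o, w o = 0 := by
      intro o
      have := congrFun (hg x) o
      rw [hx, relabel_apply, hτ0] at this
      linarith
    have : (g : T → T) = id := hπ.isometry_ext g.isometry isometry_id (x := x) hx fun z => by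
      funext o; simp [hg, relabel_apply, hw0, hτ0]
    ext z
    exact congrFun this z
  · intro a x s u
    have hadd : Isometry fun u : ℝ => s + u := isometry_add_left s
    refine (congrFun (hl_eq a (line a x s) (fun u => line a x (s + u))
      ((hl_iso a x).comp hadd) (by simp) fun t => ?_) u).symm
    simp only [hl_π]
    rw [add_smul, add_assoc]
  · rintro r g ⟨w, hw, hg⟩ a x u
    refine congrFun (hl_eq (r +ᵥ a) (g x) (fun u => g (line a x u))
      (g.isometry.comp (hl_iso a x)) (by simp [hl_zero]) fun t => ?_) u
    funext o
    simp only [hg, relabel_apply, hl_π, Pi.add_apply, Pi.smul_apply, hτv, add_assoc]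
  · intro a a' x h
    by_contra hne
    have h1 := hl_π a x 1
    rw [h, hl_π a' x 1] at h1
    have := congrFun h1 (some a)
    simp [labelVec_of_ne hne] at this
  · intro f hf hd
    have hpath := hπ.path (f 0) (f 1)
    have hd1 : dist (f 0) (f 1) = 1 := by rw [hf.dist_eq]; simp
    rw [hd1] at hpath
    -- Any nondegenerate piece of the line would do: every labelled path is pure on some
    -- subinterval.
    obtain ⟨p, q, hp, hpq, hq, a, ε, hε, hu⟩ := hpath.pure 0 1 le_rfl one_pos le_rfl
    have hpure : IsPure (fun t => π (f t)) p q := by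
      refine ⟨a, ε, hε, fun u hu' => ?_⟩
      have := hu u hu'
      simp only at this ⊢
      rwa [pt_line hf (by linarith [hu'.1]) (by linarith [hu'.2]),
        pt_line hf (by linarith) (by linarith)] at this
    obtain ⟨a, ε, hε, hγ⟩ := eq_labelled_line_of_dense hpq hpure (hd.mono fun s hs => by
      obtain ⟨r, g, ⟨w, -, hg⟩, hgf⟩ := hs
      exact ⟨w, τ r, fun t => by rw [← hgf, hg]⟩)
    refine ⟨a, f 0, ?_⟩
    rcases hε with rfl | rfl
    · rw [hl_eq a (f 0) f hf rfl fun t => by rw [hγ, one_mul]]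
      rw [hl_zero]
    -- A line run with decreasing height has the same range as the labelled line run upwards.
    · have hneg : Isometry fun t : ℝ => -t := isometry_neg
      rw [← hl_eq a (f 0) (fun t => f (-t)) (hf.comp hneg) (by simp) fun t => by rw [hγ]; simp]
      ext y
      constructor
      · rintro ⟨t, rfl⟩; exact ⟨-t, by simp⟩
      · rintro ⟨t, rfl⟩; exact ⟨-t, rfl⟩

/-! ### Coordinates of `ℓ¹(N)` and collinearity in trees -/

namespace EllOne

variable {N : Type}

theorem summable_abs (f : EllOne N) : Summable fun n => |f n| := by
  have := (lp.memℓp f).summable (by simp)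
  simpa using this

theorem norm_eq (f : EllOne N) : ‖f‖ = ∑' n, |f n| := by
  rw [lp.norm_eq_tsum_rpow (by simp)]
  simp

theorem dist_eq (f g : EllOne N) : dist f g = ∑' n, |f n - g n| := by
  rw [dist_eq_norm, norm_eq]
  rfl

/-- The element of `ℓ¹` given by an absolutely summable family. -/
def ofSummable (f : N → ℝ) (hf : Summable fun n => |f n|) : EllOne N :=
  ⟨f, memℓp_gen (by simpa using hf)⟩

@[simp] theorem ofSummable_apply (f : N → ℝ) (hf : Summable fun n => |f n|) (n : N) :
    ofSummable f hf n = f n := rfl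

/-- The coordinates of `ℓ¹`. -/
def coord (n : N) : EllOne N →+ ℝ where
  toFun r := r n
  map_zero' := rfl
  map_add' _ _ := rfl

@[simp] theorem coord_apply (n : N) (r : EllOne N) : coord n r = r n := rfl

theorem ext {f g : EllOne N} (h : ∀ n, f n = g n) : f = g := lp.ext (funext h)

theorem norm_add_of_disjoint {u w : EllOne N} (h : ∀ n, u n = 0 ∨ w n = 0) :
    ‖u + w‖ = ‖u‖ + ‖w‖ := by
  rw [norm_eq, norm_eq, norm_eq, ← (summable_abs u).tsum_add (summable_abs w)]
  refine tsum_congr fun n => ?_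
  rw [lp.coeFn_add, Pi.add_apply]
  rcases h n with h | h <;> simp [h]

theorem continuous_apply (n : N) : Continuous fun r : EllOne N => r n := by
  refine LipschitzWith.continuous (K := 1) (LipschitzWith.of_dist_le_mul fun f g => ?_)
  rw [dist_eq, NNReal.coe_one, one_mul, Real.dist_eq]
  have := summable_abs (f - g)
  exact this.le_tsum n fun _ _ => abs_nonneg _

end EllOne

namespace GeodesicTree

/-- The hypotheses make the sum of the diagonals equal to the sum of all four sides. By the
four-point condition it is at most the sum of one pair of opposite sides, so the other pair
vanishes. -/
theorem eq_or_eq_of_rectangle {T : Type*} [MetricSpace T] [GeodesicTree T] {p q r s : T}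
    (h1 : dist p s = dist p q + dist q s) (h2 : dist p s = dist p r + dist r s)
    (h3 : dist q r = dist q p + dist p r) (h4 : dist q r = dist q s + dist s r) :
    (q = p ∧ s = r) ∨ (r = p ∧ s = q) := by
  have h := four p s q r
  rw [dist_comm q p] at h3
  rw [dist_comm s r] at h4 h
  rw [dist_comm s q] at h
  rcases le_max_iff.1 h with h | h
  · right
    have e1 : dist p r = 0 := le_antisymm (by linarith) dist_nonneg
    have e2 : dist q s = 0 := by linarith
    exact ⟨(dist_eq_zero.1 e1).symm, (dist_eq_zero.1 e2).symm⟩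
  · left
    have e1 : dist p q = 0 := le_antisymm (by linarith) dist_nonneg
    have e2 : dist r s = 0 := by linarith
    exact ⟨(dist_eq_zero.1 e1).symm, (dist_eq_zero.1 e2).symm⟩

/-- A point which is collinear with any two points of a line lies on this line. -/
theorem mem_range_of_collinear {T : Type*} [MetricSpace T] [GeodesicTree T] {f : ℝ → T}
    (hf : Isometry f) {p : T} (h : ∀ s t, dist (f s) (f t) = dist (f s) p + dist p (f t) ∨
      dist p (f t) = dist p (f s) + dist (f s) (f t) ∨
      dist (f s) p = dist (f s) (f t) + dist (f t) p) : p ∈ Set.range f := by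
  -- The points `f (±(k + 1))` are farther from `f 0` than `p` is, so of the three collinear orders
  -- only the one with `p` in the middle is possible.
  set k := dist p (f 0) with hk
  have hk0 : 0 ≤ k := dist_nonneg
  have d1 : dist (f (-(k + 1))) (f (k + 1)) = 2 * (k + 1) := by
    rw [hf.dist_eq, Real.dist_eq, abs_of_nonpos (by linarith)]; ring
  have d2 : dist (f 0) (f (k + 1)) = k + 1 := by
    rw [hf.dist_eq, Real.dist_eq, abs_of_nonpos (by linarith)]; ring
  have d3 : dist (f (-(k + 1))) (f 0) = k + 1 := by
    rw [hf.dist_eq, Real.dist_eq, abs_of_nonpos (by linarith)]; ring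
  have t1 := dist_triangle p (f 0) (f (k + 1))
  have t2 := dist_triangle (f (-(k + 1))) (f 0) p
  rw [dist_comm (f 0) p] at t2
  rcases h (-(k + 1)) (k + 1) with h | h | h
  · rw [d1] at h
    refine ⟨-(k + 1) + dist (f (-(k + 1))) p, ?_⟩
    have hle : dist (f (-(k + 1))) p ≤ 2 * (k + 1) := by
      linarith [@dist_nonneg _ _ p (f (k + 1))]
    have hnn : 0 ≤ dist (f (-(k + 1))) p := dist_nonneg
    set e := dist (f (-(k + 1))) p with he
    have c1 : dist (f (-(k + 1))) (f (-(k + 1) + e)) = e := by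
      rw [hf.dist_eq, Real.dist_eq, abs_of_nonpos (by linarith)]; ring
    have c2 : dist (f (-(k + 1) + e)) (f (k + 1)) = 2 * (k + 1) - e := by
      rw [hf.dist_eq, Real.dist_eq, abs_of_nonpos (by linarith)]; ring
    exact eq_of_between (x := f (-(k + 1))) (y := f (k + 1)) (by rw [c1]) (by rw [c2]; linarith)
      (by rw [c1, c2, d1]; ring)
  · linarith [@dist_nonneg _ _ p (f (-(k + 1)))]
  · linarith [@dist_nonneg _ _ (f (k + 1)) p]

end GeodesicTree

/-! ### Flats in `ℓ¹` products of trees -/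

namespace L1Product

variable {N : Type} {T : N → Type} [∀ n, MetricSpace (T n)] {z : ∀ n, T n}

theorem dist_def (x y : L1Product T z) : dist x y = ∑' n, dist (x.1 n) (y.1 n) := rfl

theorem dist_apply_le (x y : L1Product T z) (n : N) : dist (x.1 n) (y.1 n) ≤ dist x y :=
  (summable_dist x y).le_tsum n fun _ _ => dist_nonneg

theorem continuous_apply (n : N) : Continuous fun x : L1Product T z => x.1 n := by
  refine LipschitzWith.continuous (K := 1) (LipschitzWith.of_dist_le_mul fun f g => ?_)
  rw [NNReal.coe_one, one_mul]
  exact dist_apply_le f g n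

/-- The defects in the coordinatewise triangle inequalities are nonnegative with sum zero. -/
theorem dist_apply_add {x y w : L1Product T z} (h : dist x w = dist x y + dist y w) (n : N) :
    dist (x.1 n) (w.1 n) = dist (x.1 n) (y.1 n) + dist (y.1 n) (w.1 n) := by
  have h1 := ((summable_dist x y).hasSum.add (summable_dist y w).hasSum).sub
    (summable_dist x w).hasSum
  rw [← dist_def, ← dist_def, ← dist_def, h, sub_self] at h1
  have h2 := congrFun ((hasSum_zero_iff_of_nonneg fun n => sub_nonneg.2
    (dist_triangle (x.1 n) (y.1 n) (w.1 n))).1 h1) n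
  simp only [Pi.zero_apply] at h2
  linarith

section Flat

variable [∀ n, GeodesicTree (T n)] {φ : EllOne N → L1Product T z}

omit [∀ n, GeodesicTree (T n)] in
theorem dist_apply_add_of_disjoint (hφ : Isometry φ) {x u w : EllOne N}
    (h : ∀ n, u n = 0 ∨ w n = 0) (m : N) :
    dist ((φ x).1 m) ((φ (x + u + w)).1 m) =
      dist ((φ x).1 m) ((φ (x + u)).1 m) + dist ((φ (x + u)).1 m) ((φ (x + u + w)).1 m) := by
  refine dist_apply_add ?_ m
  rw [hφ.dist_eq, hφ.dist_eq, hφ.dist_eq, dist_self_add_right, dist_self_add_right, add_assoc,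
    dist_self_add_right, EllOne.norm_add_of_disjoint h]

/-- Disjoint supports make each corner of `x, x + u, x + w, x + u + w` lie between its neighbours.
Betweenness passes to components, where the tree collapses the rectangle. -/
theorem rectangle (hφ : Isometry φ) {x u w : EllOne N} (h : ∀ n, u n = 0 ∨ w n = 0) (m : N) :
    ((φ (x + u)).1 m = (φ x).1 m ∧ (φ (x + u + w)).1 m = (φ (x + w)).1 m) ∨
      ((φ (x + w)).1 m = (φ x).1 m ∧ (φ (x + u + w)).1 m = (φ (x + u)).1 m) := by
  have h' : ∀ n, w n = 0 ∨ u n = 0 := fun n => (h n).symm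
  have hu : ∀ n, (-u) n = 0 ∨ w n = 0 := fun n => by simpa using h n
  have hw : ∀ n, w n = 0 ∨ (-u) n = 0 := fun n => (hu n).symm
  refine eq_or_eq_of_rectangle (dist_apply_add_of_disjoint hφ h m) ?_ ?_ ?_
  · have := dist_apply_add_of_disjoint hφ (x := x) h' m
    rwa [add_right_comm] at this
  · have := dist_apply_add_of_disjoint hφ (x := x + u) hu m
    rwa [add_neg_cancel_right] at this
  · have := dist_apply_add_of_disjoint hφ (x := x + u) hw m
    rwa [add_right_comm, add_neg_cancel_right] at this

/-- The components of a flat in an `ℓ¹` product of trees depend on at most one coordinate. -/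
theorem flat_component (hφ : Isometry φ) (m : N) :
    (∃ p, ∀ x, (φ x).1 m = p) ∨ ∃ (i : N) (f : ℝ → T m), ∀ x, (φ x).1 m = f (x i) := by
  classical
  by_cases hc : ∀ x i a, (φ (x + lp.single 1 i a)).1 m = (φ x).1 m
  · left
    refine ⟨(φ 0).1 m, fun x => ?_⟩
    -- No single-coordinate move changes the component, hence no finite sum of them does; these sums
    -- approximate every `x`.
    have hs : ∀ s : Finset N, (φ (∑ i ∈ s, lp.single 1 i (x i))).1 m = (φ 0).1 m := by
      intro s
      induction s using Finset.induction_on with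
      | empty => simp
      | insert i s hi ih => rw [Finset.sum_insert hi, add_comm, hc, ih]
    have h1 := lp.hasSum_single (E := fun _ : N => ℝ) (p := 1) (by simp) x
    have h2 := (((continuous_apply (T := T) (z := z) m).comp hφ.continuous).tendsto x).comp h1
    refine tendsto_nhds_unique h2 ?_
    refine tendsto_const_nhds.congr fun s => (hs s).symm
  · right
    push Not at hc
    obtain ⟨x₀, i, a, ha⟩ := hc
    refine ⟨i, fun t => (φ (x₀ + lp.single 1 i (t - x₀ i))).1 m, fun y => ?_⟩
    set u : EllOne N := lp.single 1 i (y i - x₀ i) with hu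
    set w : EllOne N := y - (x₀ + u) with hw
    have hwi : w i = 0 := by
      have : w i = y i - (x₀ i + u i) := rfl
      rw [this, hu, lp.single_apply_self]; ring
    have hy : y = x₀ + u + w := by rw [hw]; abel
    have hdis : ∀ b n, (lp.single 1 i b : EllOne N) n = 0 ∨ w n = 0 := by
      intro b n
      by_cases hn : n = i
      · right; rw [hn, hwi]
      · left; rw [lp.single_apply_ne _ _ _ hn]
    -- The component still varies in direction `i` at `x₀ + u`: otherwise moving back to `x₀` and
    -- then on by `a` would leave it unchanged. In the rectangle with the complementary move `w` it
    -- is therefore `w` that acts trivially.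
    obtain ⟨b, hb⟩ : ∃ b, (φ (x₀ + u + lp.single 1 i b)).1 m ≠ (φ (x₀ + u)).1 m := by
      by_contra! hcon
      have h1 := hcon (x₀ i - y i)
      have h2 := hcon (x₀ i - y i + a)
      rw [add_assoc, hu, ← lp.single_add] at h1 h2
      rw [show y i - x₀ i + (x₀ i - y i) = 0 by ring, lp.single_zero, add_zero] at h1
      rw [show y i - x₀ i + (x₀ i - y i + a) = a by ring] at h2
      exact ha (h2.trans h1.symm)
    rcases rectangle hφ (x := x₀ + u) (hdis b) m with h | h
    · exact absurd h.1 hb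
    · exact (congrArg (fun v => (φ v).1 m) hy).trans h.1

omit [∀ n, GeodesicTree (T n)] in
theorem dist_component_add (hφ : Isometry φ) {m i : N} {f : ℝ → T m}
    (hf : ∀ x, (φ x).1 m = f (x i)) {s t u : ℝ} (hst : s ≤ t) (htu : t ≤ u) :
    dist (f s) (f u) = dist (f s) (f t) + dist (f t) (f u) := by
  classical
  have he : ∀ s, f s = (φ (lp.single 1 i s)).1 m := fun s => by rw [hf, lp.single_apply_self]
  rw [he, he, he]
  refine dist_apply_add ?_ m
  have hi := lp.isometry_single (E := fun _ : N => ℝ) (p := 1) i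
  rw [hφ.dist_eq, hφ.dist_eq, hφ.dist_eq, hi.dist_eq, hi.dist_eq, hi.dist_eq, Real.dist_eq,
    Real.dist_eq, Real.dist_eq, abs_of_nonpos (by linarith), abs_of_nonpos (by linarith),
    abs_of_nonpos (by linarith)]
  ring

/-- The components of points of a flat are collinear. -/
theorem flat_collinear (hφ : Isometry φ) (m : N) (x y w : EllOne N) :
    dist ((φ x).1 m) ((φ y).1 m) = dist ((φ x).1 m) ((φ w).1 m) + dist ((φ w).1 m) ((φ y).1 m) ∨
    dist ((φ w).1 m) ((φ y).1 m) = dist ((φ w).1 m) ((φ x).1 m) + dist ((φ x).1 m) ((φ y).1 m) ∨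
    dist ((φ x).1 m) ((φ w).1 m) = dist ((φ x).1 m) ((φ y).1 m) + dist ((φ y).1 m) ((φ w).1 m) := by
  rcases flat_component hφ m with ⟨p, hp⟩ | ⟨i, f, hf⟩
  · simp [hp]
  · have key := @dist_component_add N T _ z φ hφ m i f hf
    rw [hf, hf, hf]
    generalize x i = a
    generalize y i = b
    generalize w i = c
    rcases le_total a b with h1 | h1 <;> rcases le_total b c with h2 | h2 <;>
      rcases le_total a c with h3 | h3
    · exact Or.inr (Or.inr (key h1 h2))
    · obtain rfl : a = c := le_antisymm (h1.trans h2) h3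
      left; simp
    · exact Or.inl (key h3 h2)
    · refine Or.inr (Or.inl (key h3 h1))
    · refine Or.inr (Or.inl ?_)
      have := key h1 h3
      linarith [dist_comm (f c) (f b), dist_comm (f c) (f a), dist_comm (f a) (f b)]
    · refine Or.inl ?_
      have := key h2 h3
      linarith [dist_comm (f c) (f b), dist_comm (f c) (f a), dist_comm (f a) (f b)]
    · obtain rfl : a = c := le_antisymm h3 (h2.trans h1)
      left; simp
    · refine Or.inr (Or.inr ?_)
      have := key h2 h1
      linarith [dist_comm (f c) (f b), dist_comm (f c) (f a), dist_comm (f a) (f b)]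

/-- If a component of a flat is equivariant under a dense set of translations, then it is constant or
a reparametrised line. -/
theorem flat_component_of_dense (hφ : Isometry φ) {H : Set (EllOne N)} (hH : Dense H) (m : N)
    {Q : (T m ≃ᵢ T m) → Prop} (hQ : ∀ h ∈ H, ∃ g, Q g ∧ ∀ x, g ((φ x).1 m) = (φ (h + x)).1 m) :
    (∃ p, ∀ x, (φ x).1 m = p) ∨ ∃ f : ℝ → T m, Isometry f ∧ (∀ x, (φ x).1 m ∈ Set.range f) ∧
      Dense {s | ∃ g, Q g ∧ ∀ t, g (f t) = f (t + s)} := by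
  classical
  rcases flat_component hφ m with hp | ⟨i, f, hf⟩
  · exact Or.inl hp
  have hadd := @dist_component_add N T _ z φ hφ m i f hf
  have he : ∀ s, f s = (φ (lp.single 1 i s)).1 m := fun s => by rw [hf, lp.single_apply_self]
  have hfc : Continuous f := by
    have : f = fun s => (φ (lp.single 1 i s)).1 m := funext he
    rw [this]
    exact (continuous_apply m).comp (hφ.continuous.comp
      (lp.isometry_single (E := fun _ : N => ℝ) (p := 1) i).continuous)
  have hg : ∀ h ∈ H, ∃ g, Q g ∧ ∀ t, g (f t) = f (t + h i) := by
    intro h hh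
    obtain ⟨g, hg, hgx⟩ := hQ h hh
    refine ⟨g, hg, fun t => ?_⟩
    rw [he t, hgx, hf, lp.coeFn_add, Pi.add_apply, lp.single_apply_self, add_comm]
  have hsurj : Function.Surjective fun r : EllOne N => r i :=
    fun t => ⟨lp.single 1 i t, lp.single_apply_self _ _ _⟩
  -- For shifts in the image of `H` this is invariance under isometries; continuity and density give
  -- all shifts.
  have hinv : ∀ s t u, dist (f (t + s)) (f (u + s)) = dist (f t) (f u) := by
    intro s t u
    have hd : Dense ((fun r : EllOne N => r i) '' H) :=
      hsurj.denseRange.dense_image (EllOne.continuous_apply i) hH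
    have hc1 : Continuous fun s => dist (f (t + s)) (f (u + s)) := by fun_prop
    refine congrFun (hc1.ext_on hd (continuous_const (y := dist (f t) (f u))) ?_) s
    rintro _ ⟨h, hh, rfl⟩
    obtain ⟨g, -, hg⟩ := hg h hh
    simp only
    rw [← hg, ← hg, g.isometry.dist_eq]
  -- The signed distance from `f 0` along `f` is additive because of `hinv`, and continuous, hence
  -- linear. So `f` dilates distances by a constant `k`: it is constant if `k = 0` and a line after
  -- rescaling otherwise.
  let θ : ℝ → ℝ := fun t => if 0 ≤ t then dist (f 0) (f t) else -dist (f 0) (f t)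
  have hθ1 : ∀ t, 0 ≤ t → θ t = dist (f 0) (f t) := fun t ht => if_pos ht
  have hθ2 : ∀ t, t ≤ 0 → θ t = -dist (f 0) (f t) := by
    intro t ht
    rcases ht.lt_or_eq with h | rfl
    · exact if_neg (not_le.2 h)
    · simp [θ]
  have hθsub : ∀ s t, s ≤ t → θ t - θ s = dist (f s) (f t) := by
    intro s t hst
    rcases le_total 0 s with h | h
    · rw [hθ1 s h, hθ1 t (h.trans hst), hadd h hst]; ring
    rcases le_total 0 t with h' | h'
    · rw [hθ2 s h, hθ1 t h', hadd h h', dist_comm (f 0) (f s)]; ring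
    · rw [hθ2 s h, hθ2 t h', dist_comm (f 0), dist_comm (f 0), hadd hst h']; ring
  have hθadd : ∀ s t, θ (s + t) = θ s + θ t := by
    intro s t
    rcases le_total 0 t with h | h
    · have h1 := hθsub s (s + t) (by linarith)
      have h2 := hinv s 0 t
      rw [zero_add, add_comm t s] at h2
      rw [hθ1 t h]; linarith
    · have h1 := hθsub (s + t) s (by linarith)
      have h2 := hinv s 0 t
      rw [zero_add, add_comm t s, dist_comm (f s)] at h2
      rw [hθ2 t h]; linarith
  have habs : ∀ s t, |θ s - θ t| = dist (f s) (f t) := by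
    intro s t
    rcases le_total s t with h | h
    · rw [abs_sub_comm, hθsub s t h, abs_of_nonneg dist_nonneg]
    · rw [hθsub t s h, abs_of_nonneg dist_nonneg, dist_comm]
  have hθc : Continuous θ := by
    rw [continuous_iff_continuousAt]
    intro t
    rw [ContinuousAt, tendsto_iff_dist_tendsto_zero]
    have := tendsto_iff_dist_tendsto_zero.1 (hfc.tendsto t)
    simpa only [Real.dist_eq, habs] using this
  have hθlin : ∀ t, θ t = t * θ 1 := by
    intro t
    have := map_real_smul (AddMonoidHom.mk' θ hθadd) hθc t 1
    simpa using this
  set k := θ 1 with hk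
  have hk0 : 0 ≤ k := by rw [hk, hθ1 1 zero_le_one]; exact dist_nonneg
  have hdist : ∀ s t, dist (f s) (f t) = k * |s - t| := by
    intro s t
    rw [← habs, hθlin s, hθlin t, ← sub_mul, abs_mul, abs_of_nonneg hk0, mul_comm]
  rcases hk0.lt_or_eq with hkpos | hkz
  · right
    refine ⟨fun t => f (t / k), Isometry.of_dist_eq fun s t => ?_, fun x => ?_, ?_⟩
    · rw [hdist, Real.dist_eq, ← sub_div, abs_div, abs_of_pos hkpos]
      field_simp
    · refine ⟨x i * k, ?_⟩
      simp only
      rw [hf, mul_div_cancel_right₀ _ hkpos.ne']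
    · have hs' : Function.Surjective fun r : EllOne N => k * r i := by
        intro t
        obtain ⟨r, hr⟩ := hsurj (t / k)
        refine ⟨r, ?_⟩
        simp only at hr ⊢
        rw [hr]; field_simp
      have hd : Dense ((fun r : EllOne N => k * r i) '' H) :=
        hs'.denseRange.dense_image (continuous_const.mul (EllOne.continuous_apply i)) hH
      refine hd.mono ?_
      rintro _ ⟨h, hh, rfl⟩
      obtain ⟨g, hgQ, hgf⟩ := hg h hh
      refine ⟨g, hgQ, fun t => ?_⟩
      simp only
      rw [hgf]
      congr 1
      field_simp
  · left
    refine ⟨f 0, fun x => ?_⟩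
    rw [hf]
    have := hdist (x i) 0
    rw [← hkz, zero_mul] at this
    exact dist_eq_zero.1 this

end Flat

end L1Product

/-! ### The group of families of isometries and its labelled flats -/

namespace LabelledTree

variable {T R A : Type} [MetricSpace T] [AddCommGroup R] {c : R →+ ℝ} [AddAction R A]
  (D : LabelledTree T R c A)

theorem range_line_eq {a : A} {x y : T} (hy : y ∈ Set.range (D.line a x)) :
    Set.range (D.line a y) = Set.range (D.line a x) := by
  obtain ⟨s, rfl⟩ := hy
  ext w
  constructor
  · rintro ⟨u, rfl⟩; exact ⟨s + u, (D.line_line a x s u).symm⟩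
  · rintro ⟨u, rfl⟩; exact ⟨-s + u, by rw [D.line_line]; congr 1; ring⟩

theorem eq_line_of_mem {a : A} {x y : T} (hy : y ∈ Set.range (D.line a x)) :
    y = D.line a x (D.h y - D.h x) := by
  obtain ⟨s, rfl⟩ := hy
  rw [D.h_line, add_sub_cancel_left]

/-- Height parametrises every labelled line, so an inclusion of ranges becomes an equality of lines
through a common point. -/
theorem label_eq_of_range_subset {a a' : A} {x x' : T}
    (h : Set.range (D.line a x) ⊆ Set.range (D.line a' x')) : a = a' := by
  have hx : x ∈ Set.range (D.line a' x') := h ⟨0, D.line_zero a x⟩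
  rw [← D.range_line_eq hx] at h
  refine D.line_inj (x := x) (funext fun u => ?_)
  have := D.eq_line_of_mem (h ⟨u, rfl⟩)
  rwa [D.h_line, add_sub_cancel_left] at this

end LabelledTree

section Group

variable {N : Type} {T : N → Type} [∀ n, MetricSpace (T n)] {A : N → Type}
  [∀ n, AddAction (EllOne N) (A n)]
  (D : ∀ n, LabelledTree (T n) (EllOne N) (EllOne.coord n) (A n)) (z : ∀ n, T n)

/-- The families of isometries in the given groups of isometries of the factors, with the same
translation part in all factors, which preserve the `ℓ¹` product. -/
def symGroup : Subgroup (Multiplicative (EllOne N) × ∀ n, T n ≃ᵢ T n) where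
  carrier := {g | (∀ n, (D n).Sym g.1.toAdd (g.2 n)) ∧ Summable fun n => dist (g.2 n (z n)) (z n)}
  one_mem' := ⟨fun n => (D n).sym_one, by simp⟩
  mul_mem' := by
    rintro g g' ⟨h1, h2⟩ ⟨h1', h2'⟩
    refine ⟨fun n => (D n).sym_mul (h1 n) (h1' n), ?_⟩
    refine Summable.of_nonneg_of_le (fun _ => dist_nonneg) (fun n => ?_) (h2'.add h2)
    refine (dist_triangle _ (g.2 n (z n)) _).trans_eq ?_
    simp [IsometryEquiv.dist_eq]
  inv_mem' := by
    rintro g ⟨h1, h2⟩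
    refine ⟨fun n => (D n).sym_inv (h1 n), h2.congr fun n => ?_⟩
    have := (g.2 n).dist_eq ((g.2 n)⁻¹ (z n)) (z n)
    rw [IsometryEquiv.apply_inv_self, dist_comm] at this
    exact this

namespace symGroup

variable {D z}

/-- The translation part. -/
def trans (g : symGroup D z) : EllOne N := g.1.1.toAdd

theorem sym (g : symGroup D z) (n : N) : (D n).Sym (trans g) (g.1.2 n) := g.2.1 n

instance : MulAction (symGroup D z) (L1Product T z) where
  smul g x := ⟨fun n => g.1.2 n (x.1 n), by
    refine Summable.of_nonneg_of_le (fun _ => dist_nonneg) (fun n => ?_) (x.2.add g.2.2)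
    refine (dist_triangle _ (g.1.2 n (z n)) _).trans_eq ?_
    rw [IsometryEquiv.dist_eq]⟩
  one_smul x := rfl
  mul_smul g g' x := rfl

theorem smul_apply (g : symGroup D z) (x : L1Product T z) (n : N) :
    (g • x).1 n = g.1.2 n (x.1 n) := rfl

theorem isometry_smul (g : symGroup D z) : Isometry fun x : L1Product T z => g • x :=
  Isometry.of_dist_eq fun x y => tsum_congr fun n => by
    rw [smul_apply, smul_apply, IsometryEquiv.dist_eq]

theorem h_smul (g : symGroup D z) (x : L1Product T z) (n : N) :
    (D n).h ((g • x).1 n) = (D n).h (x.1 n) + trans g n := by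
  rw [smul_apply, (D n).h_sym (sym g n)]
  rfl

/-- A fixed point has unchanged heights, so the translation part vanishes and freeness in each
factor applies. -/
theorem eq_one_of_smul_eq (g : symGroup D z) (x : L1Product T z) (h : g • x = x) : g = 1 := by
  have ht : trans g = 0 := EllOne.ext fun n => by
    have := h_smul g x n
    rw [h] at this
    simpa using this
  refine Subtype.ext (Prod.ext ht (funext fun n => ?_))
  have h1 := sym g n
  rw [ht] at h1
  exact (D n).free h1 (congrArg (fun x : L1Product T z => x.1 n) h)

/-- The common translation part has to be the family of height differences, which lies in `ℓ¹`
because heights are 1-Lipschitz. -/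
theorem exists_smul_eq (x y : L1Product T z) : ∃ g : symGroup D z, g • x = y := by
  have hs : Summable fun n => |(D n).h (y.1 n) - (D n).h (x.1 n)| :=
    Summable.of_nonneg_of_le (fun _ => abs_nonneg _) (fun n => (D n).h_le _ _)
      (L1Product.summable_dist y x)
  have hex : ∀ n, ∃ g, (D n).Sym (EllOne.ofSummable _ hs) g ∧ g (x.1 n) = y.1 n := fun n =>
    (D n).exists_sym (by simp)
  choose g hg hgx using hex
  refine ⟨⟨(Multiplicative.ofAdd (EllOne.ofSummable _ hs), g), hg, ?_⟩,
    Subtype.ext (funext hgx)⟩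
  refine Summable.of_nonneg_of_le (fun _ => dist_nonneg) (fun n => ?_) (x.2.add y.2)
  refine (dist_triangle _ (y.1 n) _).trans_eq ?_
  simp only
  rw [← hgx n, IsometryEquiv.dist_eq, dist_comm (z n)]

end symGroup

open symGroup

variable {z}

/-- The product of the lines with labels `a` through the components of `x`. -/
noncomputable def labelledFlat (a : ∀ n, A n) (x : L1Product T z) (r : EllOne N) : L1Product T z :=
  ⟨fun n => (D n).line (a n) (x.1 n) (r n), by
    refine Summable.of_nonneg_of_le (fun _ => dist_nonneg) (fun n => ?_)
      ((EllOne.summable_abs r).add x.2)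
    refine (dist_triangle _ (x.1 n) _).trans_eq ?_
    have : dist ((D n).line (a n) (x.1 n) (r n)) ((D n).line (a n) (x.1 n) 0) = |r n| := by
      rw [((D n).line_isometry _ _).dist_eq, Real.dist_eq, sub_zero]
    rw [(D n).line_zero] at this
    rw [this]⟩

theorem labelledFlat_apply (a : ∀ n, A n) (x : L1Product T z) (r : EllOne N) (n : N) :
    (labelledFlat D a x r).1 n = (D n).line (a n) (x.1 n) (r n) := rfl

theorem isometry_labelledFlat (a : ∀ n, A n) (x : L1Product T z) :
    Isometry (labelledFlat D a x) :=
  Isometry.of_dist_eq fun r s => by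
    rw [EllOne.dist_eq]
    refine tsum_congr fun n => ?_
    rw [labelledFlat_apply, labelledFlat_apply, ((D n).line_isometry _ _).dist_eq, Real.dist_eq]

theorem labelledFlat_zero (a : ∀ n, A n) (x : L1Product T z) : labelledFlat D a x 0 = x :=
  Subtype.ext (funext fun n => (D n).line_zero _ _)

theorem h_labelledFlat (a : ∀ n, A n) (x : L1Product T z) (r : EllOne N) (n : N) :
    (D n).h ((labelledFlat D a x r).1 n) = (D n).h (x.1 n) + r n := (D n).h_line _ _ _

theorem labelledFlat_labelledFlat (a : ∀ n, A n) (x : L1Product T z) (r s : EllOne N) :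
    labelledFlat D a (labelledFlat D a x r) s = labelledFlat D a x (r + s) :=
  Subtype.ext (funext fun n => (D n).line_line _ _ _ _)

theorem smul_labelledFlat (g : symGroup D z) (a : ∀ n, A n) (x : L1Product T z) (r : EllOne N) :
    g • labelledFlat D a x r = labelledFlat D (fun n => trans g +ᵥ a n) (g • x) r :=
  Subtype.ext (funext fun n => (D n).sym_line (sym g n) _ _ _)

theorem mem_range_labelledFlat {a : ∀ n, A n} {x y : L1Product T z} :
    y ∈ Set.range (labelledFlat D a x) ↔ ∀ n, y.1 n ∈ Set.range ((D n).line (a n) (x.1 n)) := by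
  constructor
  · rintro ⟨r, rfl⟩ n
    exact ⟨r n, rfl⟩
  · intro h
    have hs : Summable fun n => |(D n).h (y.1 n) - (D n).h (x.1 n)| :=
      Summable.of_nonneg_of_le (fun _ => abs_nonneg _) (fun n => (D n).h_le _ _)
        (L1Product.summable_dist y x)
    exact ⟨EllOne.ofSummable _ hs, Subtype.ext (funext fun n => ((D n).eq_line_of_mem (h n)).symm)⟩

theorem range_labelledFlat_eq {a : ∀ n, A n} {x y : L1Product T z}
    (hy : y ∈ Set.range (labelledFlat D a x)) :
    Set.range (labelledFlat D a y) = Set.range (labelledFlat D a x) := by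
  rw [mem_range_labelledFlat] at hy
  ext w
  simp only [mem_range_labelledFlat, fun n => (D n).range_line_eq (hy n)]

theorem labels_eq_of_range_eq {a a' : ∀ n, A n} {x x' : L1Product T z}
    (h : Set.range (labelledFlat D a x) = Set.range (labelledFlat D a' x')) : a = a' := by
  classical
  funext n
  refine (D n).label_eq_of_range_subset (x := x.1 n) (x' := x'.1 n) ?_
  rintro _ ⟨u, rfl⟩
  have : labelledFlat D a x (lp.single 1 n u) ∈ Set.range (labelledFlat D a' x') := h ▸ ⟨_, rfl⟩
  rw [mem_range_labelledFlat] at this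
  have h1 := this n
  rwa [labelledFlat_apply, lp.single_apply_self] at h1

theorem smul_range_labelledFlat (g : symGroup D z) (a : ∀ n, A n) (x : L1Product T z) :
    g • Set.range (labelledFlat D a x) =
      Set.range (labelledFlat D (fun n => trans g +ᵥ a n) (g • x)) := by
  ext w
  rw [Set.mem_smul_set]
  constructor
  · rintro ⟨_, ⟨r, rfl⟩, rfl⟩; exact ⟨r, (smul_labelledFlat D g a x r).symm⟩
  · rintro ⟨r, rfl⟩; exact ⟨_, ⟨r, rfl⟩, smul_labelledFlat D g a x r⟩

/-- Each component of a point of a larger flat is collinear with any two points of the labelled line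
in that factor, so it lies on this line. -/
theorem isMaximalFlat_labelledFlat [∀ n, GeodesicTree (T n)] (a : ∀ n, A n) (x : L1Product T z) :
    IsMaximalFlat N (Set.range (labelledFlat D a x)) := by
  classical
  refine ⟨⟨_, isometry_labelledFlat D a x, rfl⟩, ?_⟩
  rintro _ ⟨φ, hφ, rfl⟩ hle _ ⟨r, rfl⟩
  rw [mem_range_labelledFlat]
  intro n
  have hmem : ∀ u, ∃ r', (φ r').1 n = (D n).line (a n) (x.1 n) u := by
    intro u
    obtain ⟨r', hr'⟩ := hle ⟨lp.single 1 n u, rfl⟩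
    refine ⟨r', ?_⟩
    rw [hr', labelledFlat_apply, lp.single_apply_self]
  refine mem_range_of_collinear ((D n).line_isometry _ _) fun s t => ?_
  obtain ⟨r₁, h₁⟩ := hmem s
  obtain ⟨r₂, h₂⟩ := hmem t
  rw [← h₁, ← h₂]
  exact L1Product.flat_collinear hφ n r₁ r₂ r

/-- A maximal flat with a dense group of translations in its stabiliser is a product of labelled
lines. -/
theorem exists_eq_range_labelledFlat [∀ n, GeodesicTree (T n)] [∀ n, Nonempty (A n)]
    {F : Set (L1Product T z)} (hF : IsMaximalFlat N F) {H : AddSubgroup (EllOne N)}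
    (hH : Dense (H : Set (EllOne N))) (hact : StabiliserActsLike (symGroup D z) F H) :
    ∃ (a : ∀ n, A n) (x : L1Product T z), F = Set.range (labelledFlat D a x) := by
  obtain ⟨φ, ψ, hφ, rfl, heq⟩ := hact
  have hline : ∀ n, ∃ a p, ∀ r, (φ r).1 n ∈ Set.range ((D n).line a p) := by
    intro n
    rcases L1Product.flat_component_of_dense hφ hH n
      (Q := fun g => ∃ r, (D n).Sym r g) (by
        intro h hh
        set g := ψ.symm (Multiplicative.ofAdd ⟨h, hh⟩) with hg
        refine ⟨g.1.1.2 n, ⟨_, sym g.1 n⟩, fun x => ?_⟩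
        have h1 := heq g x
        rw [hg, MulEquiv.apply_symm_apply] at h1
        exact congrArg (fun y : L1Product T z => y.1 n) h1) with ⟨p, hp⟩ | ⟨f, hf, hmem, hd⟩
    · exact ⟨Classical.arbitrary _, p, fun r => ⟨0, by rw [(D n).line_zero, hp]⟩⟩
    · obtain ⟨a, p, hap⟩ := (D n).eq_line f hf (hd.mono fun s hs => by
        obtain ⟨g, ⟨r, hr⟩, hgf⟩ := hs
        exact ⟨r, g, hr, hgf⟩)
      exact ⟨a, p, fun r => hap ▸ hmem r⟩
  choose a p hap using hline
  refine ⟨a, φ 0, hF.eq_of_subset ⟨_, isometry_labelledFlat D a _, rfl⟩ ?_⟩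
  rintro _ ⟨r, rfl⟩
  rw [mem_range_labelledFlat]
  intro n
  rw [(D n).range_line_eq (hap n 0)]
  exact hap n r

/-- The elements of `ℓ¹` fixing all labels of a family. -/
def labelFixer (a : ∀ n, A n) : AddSubgroup (EllOne N) where
  carrier := {r | ∀ n, r +ᵥ a n = a n}
  zero_mem' n := zero_vadd _ _
  add_mem' h h' n := by rw [add_vadd, h' n, h n]
  neg_mem' h n := by rw [neg_vadd_eq_iff, h n]

theorem mem_labelFixer {a : ∀ n, A n} {r : EllOne N} : r ∈ labelFixer a ↔ ∀ n, r +ᵥ a n = a n :=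
  Iff.rfl

/-- A labelled flat determines its labels, so the translation part must fix them; heights then
determine where `x` goes within the flat. -/
theorem mem_stabilizer_labelledFlat {a : ∀ n, A n} {x : L1Product T z} {g : symGroup D z} :
    g ∈ MulAction.stabilizer (symGroup D z) (Set.range (labelledFlat D a x)) ↔
      trans g ∈ labelFixer a ∧ g • x = labelledFlat D a x (trans g) := by
  rw [MulAction.mem_stabilizer_iff, smul_range_labelledFlat]
  constructor
  · intro h
    have h1 := labels_eq_of_range_eq D h
    have h2 : g • x ∈ Set.range (labelledFlat D a x) := h ▸ ⟨0, labelledFlat_zero D _ _⟩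
    refine ⟨fun n => congrFun h1 n, ?_⟩
    obtain ⟨r, hr⟩ := h2
    rw [← hr]
    congr 1
    refine EllOne.ext fun n => ?_
    have h3 := h_smul g x n
    rw [← hr, h_labelledFlat] at h3
    linarith
  · rintro ⟨h1, h2⟩
    have h3 : (fun n => trans g +ᵥ a n) = a := funext h1
    rw [h3, h2, range_labelledFlat_eq D ⟨_, rfl⟩]

theorem exists_trans_eq {a : ∀ n, A n} (x : L1Product T z) {r : EllOne N} (hr : r ∈ labelFixer a) :
    ∃ g ∈ MulAction.stabilizer (symGroup D z) (Set.range (labelledFlat D a x)), trans g = r := by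
  obtain ⟨g, hg⟩ := exists_smul_eq (D := D) x (labelledFlat D a x r)
  have ht : trans g = r := EllOne.ext fun n => by
    have h3 := h_smul g x n
    rw [hg, h_labelledFlat] at h3
    linarith
  exact ⟨g, (mem_stabilizer_labelledFlat D).2 ⟨ht ▸ hr, by rw [hg, ht]⟩, ht⟩

theorem smul_labelledFlat_of_mem_stabilizer {a : ∀ n, A n} {x : L1Product T z} {g : symGroup D z}
    (hg : g ∈ MulAction.stabilizer (symGroup D z) (Set.range (labelledFlat D a x)))
    (r : EllOne N) : g • labelledFlat D a x r = labelledFlat D a x (trans g + r) := by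
  obtain ⟨h1, h2⟩ := (mem_stabilizer_labelledFlat D).1 hg
  rw [smul_labelledFlat, h2, show (fun n => trans g +ᵥ a n) = a from funext h1,
    labelledFlat_labelledFlat]

/-- The stabiliser of a labelled flat acts like `H` if and only if `H` is equivalent to the
fixer of the labels. -/
theorem stabiliserActsLike_labelledFlat_iff {a : ∀ n, A n} {x : L1Product T z}
    {H : AddSubgroup (EllOne N)} :
    StabiliserActsLike (symGroup D z) (Set.range (labelledFlat D a x)) H ↔
      ∃ L : EllOne N ≃ₗᵢ[ℝ] EllOne N, L '' (H : Set (EllOne N)) = labelFixer a := by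
  set F := Set.range (labelledFlat D a x) with hF
  have hiso := isometry_labelledFlat D a x
  constructor
  · rintro ⟨φ, ψ, hφ, hrange, heq⟩
    have hex : ∀ r, ∃ s, labelledFlat D a x s = φ r := fun r => by
      have : φ r ∈ F := hrange ▸ ⟨r, rfl⟩
      exact this
    -- The change between the two parametrisations is a surjective isometry of `ℓ¹`, hence affine by
    -- Mazur–Ulam; its linear part `L` carries `H` to the label fixer.
    choose B hB using hex
    have hBi : Isometry B := Isometry.of_dist_eq fun r s => by
      rw [← hiso.dist_eq, hB, hB, hφ.dist_eq]
    have hBs : Function.Surjective B := fun s => by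
      have : labelledFlat D a x s ∈ Set.range φ := hrange ▸ ⟨s, rfl⟩
      obtain ⟨r, hr⟩ := this
      exact ⟨r, hiso.injective (by rw [hB, hr])⟩
    let L := (IsometryEquiv.mk (Equiv.ofBijective B ⟨hBi.injective, hBs⟩)
      hBi).toRealLinearIsometryEquiv
    have hL : ∀ g, L ((ψ g).toAdd : EllOne N) = trans g.1 := by
      intro g
      have h1 := heq g 0
      rw [← hB, smul_labelledFlat_of_mem_stabilizer D g.2, ← hB] at h1
      have h2 := hiso.injective h1
      rw [add_zero] at h2
      rw [IsometryEquiv.toRealLinearIsometryEquiv_apply]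
      change B _ - B 0 = _
      rw [← h2, add_sub_cancel_right]
    refine ⟨L, ?_⟩
    ext r
    constructor
    · rintro ⟨h, hh, rfl⟩
      have := hL (ψ.symm (Multiplicative.ofAdd ⟨h, hh⟩))
      rw [MulEquiv.apply_symm_apply] at this
      change L h = _ at this
      rw [this]
      exact ((mem_stabilizer_labelledFlat D).1 (ψ.symm (Multiplicative.ofAdd ⟨h, hh⟩)).2).1
    · intro hr
      obtain ⟨g, hg, rfl⟩ := exists_trans_eq D x hr
      exact ⟨_, ((ψ ⟨g, hg⟩).toAdd).2, hL ⟨g, hg⟩⟩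
  · rintro ⟨L, hL⟩
    have hmem : ∀ g : MulAction.stabilizer (symGroup D z) F, L.symm (trans g.1) ∈ H := by
      intro g
      have : trans g.1 ∈ L '' (H : Set (EllOne N)) :=
        hL ▸ ((mem_stabilizer_labelledFlat D).1 g.2).1
      obtain ⟨h, hh, hLh⟩ := this
      rw [← hLh, L.symm_apply_apply]
      exact hh
    let ψ : MulAction.stabilizer (symGroup D z) F →* Multiplicative H :=
      { toFun := fun g => Multiplicative.ofAdd ⟨L.symm (trans g.1), hmem g⟩
        map_one' := by
          refine congrArg Multiplicative.ofAdd (Subtype.ext ?_)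
          exact map_zero L.symm
        map_mul' := fun g g' => by
          refine congrArg Multiplicative.ofAdd (Subtype.ext ?_)
          exact map_add L.symm _ _ }
    have hψ : ∀ g, ((ψ g).toAdd : EllOne N) = L.symm (trans g.1) := fun g => rfl
    -- A stabilising element with zero translation part fixes `x`, and the action is free.
    have hinj : Function.Injective ψ := by
      rw [injective_iff_map_eq_one]
      intro g hg
      have h1 : L.symm (trans g.1) = 0 := by
        rw [← hψ, hg]; rfl
      have h2 : trans g.1 = 0 := by
        rw [← L.apply_symm_apply (trans g.1), h1, map_zero]
      have h3 := ((mem_stabilizer_labelledFlat D).1 g.2).2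
      rw [h2, labelledFlat_zero] at h3
      exact Subtype.ext (eq_one_of_smul_eq _ _ h3)
    have hsurj : Function.Surjective ψ := by
      intro h
      have hh : L (h.toAdd : EllOne N) ∈ labelFixer a := by
        have : L (h.toAdd : EllOne N) ∈ L '' (H : Set (EllOne N)) := ⟨_, h.toAdd.2, rfl⟩
        rwa [hL] at this
      obtain ⟨g, hg, ht⟩ := exists_trans_eq D x hh
      refine ⟨⟨g, hg⟩, ?_⟩
      refine congrArg Multiplicative.ofAdd (Subtype.ext ?_)
      change L.symm (trans g) = _
      rw [ht, L.symm_apply_apply]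
      rfl
    refine ⟨fun r => labelledFlat D a x (L r), MulEquiv.ofBijective ψ ⟨hinj, hsurj⟩,
      hiso.comp L.isometry, ?_, fun g r => ?_⟩
    · exact L.surjective.range_comp (labelledFlat D a x)
    · rw [smul_labelledFlat_of_mem_stabilizer D g.2]
      change _ = labelledFlat D a x (L (L.symm (trans g.1) + r))
      rw [map_add, L.apply_symm_apply]

/-- Stabilisers are constant along orbits because the acting group is abelian. -/
theorem labelFixer_vadd (r : EllOne N) (a : ∀ n, A n) :
    labelFixer (fun n => r +ᵥ a n) = labelFixer a := by
  ext s
  simp only [mem_labelFixer]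
  refine forall_congr' fun n => ?_
  rw [vadd_comm]
  exact (AddAction.injective r).eq_iff

/-- Orbits of maximal flats with prescribed dense stabilisers are counted by orbits of labels. -/
theorem mk_flatOrbits [∀ n, GeodesicTree (T n)] [∀ n, Nonempty (A n)] {C : Type}
    (a₀ : C → ∀ n, A n)
    (hdense : ∀ a : ∀ n, A n, Dense (labelFixer a : Set (EllOne N)) →
      ∃ c, ∃ r : EllOne N, a = fun n => r +ᵥ a₀ c n)
    (hinj : ∀ c c' (r : EllOne N), (∀ n, r +ᵥ a₀ c n = a₀ c' n) → c = c')
    {H : AddSubgroup (EllOne N)} (hH : Dense (H : Set (EllOne N))) :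
    #(flatOrbits (symGroup D z) (L1Product T z) H) =
      #{c : C // ∃ L : EllOne N ≃ₗᵢ[ℝ] EllOne N, L '' (H : Set (EllOne N)) = labelFixer (a₀ c)} := by
  have x₀ : L1Product T z := ⟨z, by simp⟩
  symm
  refine Cardinal.mk_congr (Equiv.ofBijective (fun c => ⟨MulAction.orbit (symGroup D z)
    (Set.range (labelledFlat D (a₀ c.1) x₀)), _, isMaximalFlat_labelledFlat D _ _,
      (stabiliserActsLike_labelledFlat_iff D).2 c.2, rfl⟩) ⟨?_, ?_⟩)
  · intro c c' h
    have h1 := congrArg Subtype.val h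
    simp only at h1
    obtain ⟨g, hg⟩ := (MulAction.orbit_eq_iff.1 h1.symm)
    simp only [smul_range_labelledFlat] at hg
    exact Subtype.ext (hinj c.1 c'.1 _ (congrFun (labels_eq_of_range_eq D hg)))
  · rintro ⟨O, F, hF, hact, rfl⟩
    obtain ⟨a, x, rfl⟩ := exists_eq_range_labelledFlat D hF hH hact
    obtain ⟨L, hL⟩ := (stabiliserActsLike_labelledFlat_iff D).1 hact
    have hd : Dense (labelFixer a : Set (EllOne N)) := by
      rw [← hL]
      exact L.surjective.denseRange.dense_image L.continuous hH
    obtain ⟨c, r, rfl⟩ := hdense a hd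
    rw [labelFixer_vadd] at hL
    refine ⟨⟨c, L, hL⟩, Subtype.ext ?_⟩
    simp only
    symm
    rw [MulAction.orbit_eq_iff]
    have hs : Summable fun n => |(D n).h (x₀.1 n) - (D n).h (x.1 n)| :=
      Summable.of_nonneg_of_le (fun _ => abs_nonneg _) (fun n => (D n).h_le _ _)
        (L1Product.summable_dist x₀ x)
    -- The point `y` of the flat is chosen so that its heights are those of `x₀` plus `r`. An
    -- element moving `x₀` to `y` then has translation part exactly `r`, and so also moves the
    -- labels correctly.
    set y := labelledFlat D (fun n => r +ᵥ a₀ c n) x (EllOne.ofSummable _ hs + r) with hy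
    obtain ⟨g, hg⟩ := exists_smul_eq (D := D) x₀ y
    have ht : trans g = r := EllOne.ext fun n => by
      have h3 := h_smul g x₀ n
      rw [hg, hy, h_labelledFlat, lp.coeFn_add, Pi.add_apply, EllOne.ofSummable_apply] at h3
      linarith
    refine ⟨g, ?_⟩
    simp only
    rw [smul_range_labelledFlat, hg, ht]
    exact range_labelledFlat_eq D ⟨_, rfl⟩

end Group

/-! ### Choice of the labels and conclusion -/

/-- There is an `R`-set of the size of the continuum, in which the stabilisers of all but one orbit
are prescribed and the remaining orbit is free. -/
theorem exists_labels {R C : Type} [AddCommGroup R] (hR : #R = 𝔠) (hC : #C ≤ 𝔠)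
    (K : C → AddSubgroup R) : ∃ (A : Type) (_ : AddAction R A) (lab : C → A), #A = 𝔠 ∧
      (∀ c (r : R), r +ᵥ lab c = lab c ↔ r ∈ K c) ∧
      (∀ a : A, (∃ c, ∃ r : R, a = r +ᵥ lab c) ∨ ∀ r : R, r +ᵥ a = a → r = 0) ∧
      ∀ c c' (r : R), r +ᵥ lab c = lab c' → c = c' := by
  -- The extra index `none`, with trivial stabiliser, adds a copy of `R`; it guarantees `𝔠` labels
  -- even when `C` is empty or the prescribed quotients are small.
  let K' : Option C → AddSubgroup R := fun o => o.elim ⊥ K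
  let lab : Option C → (Σ o, R ⧸ K' o) := fun o => ⟨o, ((0 : R) : R ⧸ K' o)⟩
  have hvadd : ∀ (r s : R) o, r +ᵥ (⟨o, (s : R ⧸ K' o)⟩ : Σ o, R ⧸ K' o) =
      ⟨o, ((r + s : R) : R ⧸ K' o)⟩ := fun _ _ _ => rfl
  have hstab : ∀ (r s : R) o, r +ᵥ (⟨o, (s : R ⧸ K' o)⟩ : Σ o, R ⧸ K' o) =
      ⟨o, (s : R ⧸ K' o)⟩ ↔ r ∈ K' o := by
    intro r s o
    rw [hvadd]
    constructor
    · intro h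
      have h1 : ((r + s : R) : R ⧸ K' o) = (s : R ⧸ K' o) := by simpa using h
      rw [QuotientAddGroup.eq] at h1
      have h2 : -(r + s) + s = -r := by abel
      rw [h2] at h1
      exact neg_mem_iff.1 h1
    · intro h
      have h1 : ((r + s : R) : R ⧸ K' o) = (s : R ⧸ K' o) := by
        rw [QuotientAddGroup.eq]
        have h2 : -(r + s) + s = -r := by abel
        rw [h2]
        exact neg_mem h
      rw [h1]
  refine ⟨Σ o, R ⧸ K' o, inferInstance, fun c => lab (some c), ?_, ?_, ?_, ?_⟩
  · refine le_antisymm ?_ ?_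
    · have hO : #(Option C) ≤ 𝔠 := by
        rw [mk_option]
        exact add_le_of_le aleph0_le_continuum hC (by exact_mod_cast (nat_lt_continuum 1).le)
      have hs : Function.Surjective fun p : Option C × R =>
          (⟨p.1, (p.2 : R ⧸ K' p.1)⟩ : Σ o, R ⧸ K' o) := by
        rintro ⟨o, q⟩
        obtain ⟨r, rfl⟩ := QuotientAddGroup.mk_surjective q
        exact ⟨(o, r), rfl⟩
      refine (mk_le_of_surjective hs).trans ?_
      rw [mk_prod, lift_id, lift_id, hR]
      exact mul_le_of_le aleph0_le_continuum hO le_rfl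
    · rw [← hR]
      refine mk_le_of_injective (f := fun r : R => (⟨none, (r : R ⧸ K' none)⟩ : Σ o, R ⧸ K' o)) ?_
      intro r s h
      have h1 : (r : R ⧸ K' none) = (s : R ⧸ K' none) := by simpa using h
      rw [QuotientAddGroup.eq] at h1
      have h2 : -r + s = 0 := h1
      rw [neg_add_eq_zero] at h2
      exact h2
  · intro c r
    exact hstab r 0 (some c)
  · rintro ⟨o, q⟩
    obtain ⟨s, rfl⟩ := QuotientAddGroup.mk_surjective q
    rcases o with _ | c
    · right
      intro r hr
      exact (hstab r s none).1 hr
    · left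
      refine ⟨c, s, ?_⟩
      change _ = s +ᵥ lab (some c)
      simp only [lab, hvadd, add_zero]
  · intro c c' r h
    have := congrArg Sigma.fst h
    exact Option.some_injective _ this

namespace EllOne

theorem mk_eq {N : Type} [Countable N] (n : N) : #(EllOne N) = 𝔠 := by
  classical
  refine le_antisymm ?_ ?_
  · have hinj : Function.Injective fun (r : EllOne N) (n : N) => r n :=
      fun r s h => EllOne.ext (congrFun h)
    refine (mk_le_of_injective hinj).trans ?_
    have hN : #N ≤ ℵ₀ := mk_le_aleph0_iff.2 inferInstance
    calc #(N → ℝ) = 𝔠 ^ #N := by simp [Cardinal.mk_real]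
      _ ≤ 𝔠 ^ ℵ₀ := power_le_power_left continuum_ne_zero hN
      _ = 𝔠 := continuum_power_aleph0
  · rw [← Cardinal.mk_real]
    exact mk_le_of_injective (f := fun t : ℝ => (lp.single 1 n t : EllOne N)) fun s t h => by
      have := congrArg (fun r : EllOne N => r n) h
      simpa using this

theorem not_dense_bot {N : Type} (n : N) {S : Set (EllOne N)} (hS : ∀ r ∈ S, r = 0) :
    ¬ Dense S := by
  classical
  intro h
  have h1 := (h.mono (show S ⊆ {0} from hS)).closure_eq
  rw [isClosed_singleton.closure_eq] at h1
  have h2 : (lp.single 1 n 1 : EllOne N) ∈ ({0} : Set (EllOne N)) := h1 ▸ Set.mem_univ _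
  have h3 := congrArg (fun r : EllOne N => r n) (Set.mem_singleton_iff.1 h2)
  simp at h3

end EllOne

theorem geodesicTree_of_isometryEquiv {T : Type*} [MetricSpace T] (e : T ≃ᵢ ℝ) :
    GeodesicTree T where
  four x y z w := by
    simp only [← e.dist_eq, Real.dist_eq]
    generalize e x = x
    generalize e y = y
    generalize e z = z
    generalize e w = w
    rw [le_max_iff]
    rcases abs_choice (x - y) with h | h <;> rcases abs_choice (z - w) with h' | h' <;> rw [h, h']
    · right; linarith [le_abs_self (x - w), neg_abs_le (y - z)]
    · left; linarith [le_abs_self (x - z), neg_abs_le (y - w)]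
    · left; linarith [neg_abs_le (x - z), le_abs_self (y - w)]
    · right; linarith [neg_abs_le (x - w), le_abs_self (y - z)]
  geod x y t h0 h := by
    rw [← e.dist_eq, Real.dist_eq] at h
    have key : ∀ p, dist x (e.symm p) = |e x - p| ∧ dist (e.symm p) y = |p - e y| := fun p => by
      constructor
      · rw [← e.dist_eq, e.apply_symm_apply, Real.dist_eq]
      · rw [← e.dist_eq, e.apply_symm_apply, Real.dist_eq]
    have hd : dist x y = |e x - e y| := by rw [← e.dist_eq, Real.dist_eq]
    rcases le_total (e x) (e y) with hle | hle
    · rw [abs_of_nonpos (by linarith)] at h hd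
      refine ⟨e.symm (e x + t), ?_, ?_⟩
      · rw [(key _).1, abs_of_nonpos (by linarith)]; ring
      · rw [(key _).2, hd, abs_of_nonpos (by linarith)]; ring
    · rw [abs_of_nonneg (by linarith)] at h hd
      refine ⟨e.symm (e x - t), ?_, ?_⟩
      · rw [(key _).1, abs_of_nonneg (by linarith)]; ring
      · rw [(key _).2, hd, abs_of_nonneg (by linarith)]; ring

/-- With `t = y - f 0`, each of `f t` and `f (-t)` is either `y` or its mirror image in `f 0`; by
injectivity both can be the mirror image only when `t = 0`. -/
theorem Isometry.surjective_real {f : ℝ → ℝ} (hf : Isometry f) : Function.Surjective f := by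
  intro y
  set t := y - f 0 with ht
  by_cases h0 : t = 0
  · exact ⟨0, by linarith⟩
  have h1 : |f t - f 0| = |t| := by
    rw [← Real.dist_eq, hf.dist_eq, Real.dist_eq, sub_zero]
  have h2 : |f (-t) - f 0| = |t| := by
    rw [← Real.dist_eq, hf.dist_eq, Real.dist_eq, sub_zero, abs_neg]
  rcases abs_eq_abs.1 h1 with h1 | h1
  · exact ⟨t, by linarith⟩
  rcases abs_eq_abs.1 h2 with h2 | h2
  · exact ⟨-t, by linarith⟩
  exfalso
  have h3 : f t = f (-t) := by linarith
  have h4 := hf.injective h3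
  exact h0 (by linarith)

/-- The real line is a labelled tree with a single label. -/
theorem nonempty_labelledTree_of_isometryEquiv {T : Type} [MetricSpace T] (e : T ≃ᵢ ℝ) {R : Type}
    [AddCommGroup R] (c : R →+ ℝ) {A : Type} [AddAction R A] [Unique A] :
    Nonempty (LabelledTree T R c A) := by
  refine ⟨{
    h := e
    h_le := fun x y => by rw [← Real.dist_eq, e.dist_eq]
    Sym := fun r g => ∀ x, e (g x) = e x + c r
    sym_one := by simp
    sym_mul := fun {r r' g g'} h h' x => by
      rw [IsometryEquiv.mul_apply, h, h', map_add]; ring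
    sym_inv := fun {r g} h x => by
      have := h (g⁻¹ x)
      rw [IsometryEquiv.apply_inv_self] at this
      rw [map_neg]; linarith
    h_sym := fun h => h
    exists_sym := fun {r x y} h => ⟨(e.trans (IsometryEquiv.addRight (c r))).trans e.symm, by simp, by
      apply e.injective; simp [h]⟩
    free := fun {g x} h _ => by ext y; apply e.injective; simp [h y]
    line := fun _ x u => e.symm (e x + u)
    line_isometry := fun _ x => e.symm.isometry.comp (isometry_add_left _)
    line_zero := fun _ x => by simp
    h_line := fun _ x u => by simp
    line_line := fun _ x s u => by simp [add_assoc]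
    sym_line := fun {r g} h a x u => by
      apply e.injective
      rw [h, e.apply_symm_apply, e.apply_symm_apply, h]; ring
    line_inj := fun _ => Subsingleton.elim _ _
    eq_line := ?_ }⟩
  intro f hf _
  refine ⟨default, f 0, ?_⟩
  have h1 : Function.Surjective f := fun y => by
    obtain ⟨t, ht⟩ := (e.isometry.comp hf).surjective_real (e y)
    exact ⟨t, e.injective ht⟩
  have h2 : Function.Surjective fun u => e.symm (e (f 0) + u) := fun y =>
    ⟨e y - e (f 0), by simp⟩
  rw [h1.range_eq, h2.range_eq]

/-- The number of elements of a fibre of a disjoint union. -/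
theorem mk_sigma_fibre {Q : Type} (f : Q → Cardinal.{0}) (k : Q) :
    #{p : Σ q : {q : Q // f q ≠ 0}, (f q.1).out // k = p.1.1} = f k := by
  by_cases hk : f k = 0
  · rw [hk, mk_eq_zero_iff]
    refine ⟨?_⟩
    rintro ⟨⟨⟨q, hq⟩, _⟩, rfl⟩
    exact hq hk
  · conv_rhs => rw [← mk_out (f k)]
    symm
    refine mk_congr (Equiv.ofBijective (fun x => ⟨⟨⟨k, hk⟩, x⟩, rfl⟩) ⟨fun x y h => ?_, ?_⟩)
    · simpa using h
    · rintro ⟨⟨⟨q, hq⟩, x⟩, h⟩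
      obtain rfl : k = q := h
      exact ⟨x, rfl⟩

theorem theoremD {N : Type} [Countable N]
    (ι : DenseSubgroupClass N → Set.Iic (𝔠 : Cardinal.{0}))
    (hι : #{c : DenseSubgroupClass N // (ι c : Cardinal.{0}) ≠ 0} ≤ 𝔠)
    (η : N → Fin 2) (hη : ∃ n, η n = 1)
    (T : N → Type) [∀ n, MetricSpace (T n)]
    (hT₁ : ∀ n, η n = 1 → IsUniversalRealTree (T n) 𝔠)
    (hT₀ : ∀ n, η n = 0 → Nonempty (T n ≃ᵢ ℝ)) :
    ∃ (z : ∀ n, T n) (G : Type) (_ : Group G) (_ : MulAction G (L1Product T z)),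
      (∀ g : G, Isometry fun x : L1Product T z => g • x) ∧
      (∀ (g : G) (x : L1Product T z), g • x = x → g = 1) ∧
      (∀ x y : L1Product T z, ∃ g : G, g • x = y) ∧
      ∀ H : DenseSubgroup N,
        #(flatOrbits G (L1Product T z) H.1) = (ι (Quotient.mk _ H) : Cardinal.{0}) := by
  classical
  obtain ⟨n₀, hn₀⟩ := hη
  have hη' : ∀ n, η n = 0 ∨ η n = 1 := fun n => by
    generalize η n = k
    fin_cases k <;> simp
  have hgeo : ∀ n, GeodesicTree (T n) := fun n => by
    rcases hη' n with h | h
    · obtain ⟨e⟩ := hT₀ n h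
      exact geodesicTree_of_isometryEquiv e
    · exact (hT₁ n h).geodesicTree
  have hR : #(EllOne N) = 𝔠 := EllOne.mk_eq n₀
  let κ : DenseSubgroupClass N → Cardinal.{0} := fun k => (ι k : Cardinal.{0})
  -- One index for each orbit to be realised. Classes with value zero are dropped so that the
  -- hypothesis on `ι` bounds the size of `C` by `𝔠`.
  let C : Type := Σ k : {k : DenseSubgroupClass N // κ k ≠ 0}, (κ k.1).out
  let K : C → AddSubgroup (EllOne N) := fun p => (Quotient.out p.1.1).1
  have hC : #C ≤ 𝔠 := by
    rw [mk_sigma]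
    refine (sum_le_sum _ (fun _ => 𝔠) fun k => ?_).trans ?_
    · rw [mk_out]; exact (ι k.1).2
    · rw [sum_const']
      exact mul_le_of_le aleph0_le_continuum hι le_rfl
  -- All prescribed stabilisers are placed at `n₀`. Elsewhere every `lab c` is one and the same
  -- fixed point and all other labels are free, so these coordinates contribute no further families
  -- with dense fixer.
  have hfam : ∀ n, ∃ (A : Type) (_ : AddAction (EllOne N) A) (_ : Nonempty A)
      (_ : LabelledTree (T n) (EllOne N) (EllOne.coord n) A) (lab : C → A),
      (n = n₀ → (∀ c (r : EllOne N), r +ᵥ lab c = lab c ↔ r ∈ K c) ∧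
        (∀ a : A, (∃ c, ∃ r : EllOne N, a = r +ᵥ lab c) ∨ ∀ r : EllOne N, r +ᵥ a = a → r = 0) ∧
        ∀ c c' (r : EllOne N), r +ᵥ lab c = lab c' → c = c') ∧
      (n ≠ n₀ → (∀ c (r : EllOne N), r +ᵥ lab c = lab c) ∧
        ∀ (a : A) c, a = lab c ∨ ∀ r : EllOne N, r +ᵥ a = a → r = 0) := by
    intro n
    rcases hη' n with hn | hn
    · obtain ⟨e⟩ := hT₀ n hn
      let _ : AddAction (EllOne N) Unit :=
        { vadd := fun _ a => a, zero_vadd := fun _ => rfl, add_vadd := fun _ _ _ => rfl }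
      obtain ⟨D⟩ := nonempty_labelledTree_of_isometryEquiv e (EllOne.coord n) (A := Unit)
      refine ⟨Unit, inferInstance, inferInstance, D, fun _ => (), ?_, ?_⟩
      · rintro rfl
        rw [hn] at hn₀
        exact absurd hn₀ (by decide)
      · exact fun _ => ⟨fun _ _ => rfl, fun _ _ => Or.inl rfl⟩
    by_cases hnn : n = n₀
    · obtain ⟨A, act, lab, hA, h1, h2, h3⟩ := exists_labels hR hC K
      obtain ⟨D⟩ := (hT₁ n hn).nonempty_labelledTree (EllOne.coord n) hA
      have : Nonempty A := mk_ne_zero_iff.1 (hA ▸ continuum_ne_zero)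
      exact ⟨A, act, this, D, lab, fun _ => ⟨h1, h2, h3⟩, fun h => absurd hnn h⟩
    · obtain ⟨A, act, lab, hA, h1, h2, -⟩ := exists_labels hR
        (C := Unit) (by rw [mk_fintype]; exact_mod_cast (nat_lt_continuum 1).le) (fun _ => ⊤)
      obtain ⟨D⟩ := (hT₁ n hn).nonempty_labelledTree (EllOne.coord n) hA
      have : Nonempty A := mk_ne_zero_iff.1 (hA ▸ continuum_ne_zero)
      refine ⟨A, act, this, D, fun _ => lab (), fun h => absurd h hnn, fun _ =>
        ⟨fun _ r => (h1 () r).2 trivial, fun a _ => ?_⟩⟩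
      rcases h2 a with ⟨c, r, rfl⟩ | h
      · exact Or.inl ((h1 () r).2 trivial)
      · exact Or.inr h
  choose A act hne D lab h₀ h₁ using hfam
  obtain ⟨hstab, hcase, hinj⟩ := h₀ n₀ rfl
  have hz : ∀ n, Nonempty (T n) := fun n => by
    rcases hη' n with h | h
    · obtain ⟨e⟩ := hT₀ n h
      exact ⟨e.symm 0⟩
    · exact (hT₁ n h).nonempty
  let z : ∀ n, T n := fun n => (hz n).some
  let a₀ : C → ∀ n, A n := fun c n => lab n c
  -- Only the coordinate `n₀` imposes a condition, since the labels at the others are fixed by all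
  -- of `ℓ¹`.
  have hfix : ∀ c, labelFixer (a₀ c) = K c := by
    intro c
    ext r
    rw [mem_labelFixer]
    refine ⟨fun h => (hstab c r).1 (h n₀), fun h n => ?_⟩
    by_cases hn : n = n₀
    · subst hn; exact (hstab c r).2 h
    · exact (h₁ n hn).1 c r
  refine ⟨z, symGroup D z, inferInstance, inferInstance, symGroup.isometry_smul,
    symGroup.eq_one_of_smul_eq, symGroup.exists_smul_eq, fun H => ?_⟩
  rw [mk_flatOrbits D a₀ ?_ ?_ H.2]
  · refine Eq.trans ?_ (mk_sigma_fibre κ (Quotient.mk _ H))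
    refine mk_congr (Equiv.subtypeEquivRight fun c => ?_)
    rw [hfix]
    exact (Quotient.mk_eq_iff_out (x := H) (y := c.1.1)).symm
  · intro a ha
    -- One free label would make the fixer trivial, which is not dense because `ℓ¹(N)` is nonzero.
    have hnd : ∀ n, ¬ ∀ r : EllOne N, r +ᵥ a n = a n → r = 0 := fun n h =>
      EllOne.not_dense_bot n₀ (S := (labelFixer (a : ∀ n, A n) : Set (EllOne N)))
        (fun r hr => h r (mem_labelFixer.1 hr n)) ha
    obtain ⟨c, r, hr⟩ := (hcase (a n₀)).resolve_right (hnd n₀)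
    refine ⟨c, r, funext fun n => ?_⟩
    by_cases hn : n = n₀
    · subst hn; exact hr
    · rw [((h₁ n hn).2 (a n) c).resolve_right (hnd n)]
      exact ((h₁ n hn).1 c r).symm
  · exact fun c c' r h => hinj c c' r (h n₀)
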